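/- For $a\in\mathbb C$ let $H_0(a)$ and $N(a)$ be the operators generated in $L_2[0,\pi]$ by the Mathieu expression $-y''+2a\cos(2x)\,y$ with periodic boundary conditions ($y(\pi)=y(0)$, $y'(\pi)=y'(0)$) and Neumann boundary conditions ($y'(0)=y'(\pi)=0$), respectively. A $PN(a)$ eigenvalue is an eigenvalue of $H_0(a)$ that is also an eigenvalue of $N(a)$; its multiplicity is its algebraic multiplicity as an eigenvalue of $H_0(a)$. Let $I(2)=\{ix: 0<x<2\}$. For every $a\in I(2)$ there are exactly two $PN(a)$ eigenvalues, counted with multiplicity, in the disc $\{\lambda:|\lambda-3|\le 6\}$; denote them by $\lambda_0(a)$ and $\lambda_2^-(a)$ (in either order). For $k\ge 1$ let $$A_k(a,\lambda)=\sum_{n_1,\dots,n_{2k}}\frac{a^{2k+2}}{(\lambda-16)(\lambda-36)\prod_{s=1}^{2k-1}\bigl[\lambda-(6+2n_1+\dots+2n_s)^2\bigr]},$$ where the sum is over all $n_1,\dots,n_{2k}\in\{-1,1\}$ with $3+n_1+\dots+n_{2k}=1$ and $3+n_1+\dots+n_{2s}>1$ for $s=1,\dots,k-1$. Consider the equation $$\lambda^2-4\lambda-2a^2-\frac{a^2\lambda}{\lambda-16}-\sum_{k=1}^{\infty}\lambda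 A_k(a,\lambda)=0.\qquad(*)$$ (a) If $a\in I(2)$, then the series in $(*)$ converges for $|\lambda|\le 9$, the left-hand side of $(*)$ is analytic in a neighbourhood of this disc, and $(*)$ has exactly two roots, counted with multiplicity, in $|\lambda|<9$. These roots, with their multiplicities, are $\lambda_0(a)$ and $\lambda_2^-(a)$. (b) For each $a\in I(2)$ the number $\lambda_0(a)-\lambda_2^-(a)$ is real or purely imaginary. (c) There is a unique $a\in I(2)$ such that $\lambda_0(a)=\lambda_2^-(a)$. -/

import Mathlib

open MeasureTheory

namespace Mathieu

/-- `I(c) = {i x : 0 < x < c}`. -/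
def I (c : ℝ) : Set ℂ := {a | ∃ x : ℝ, 0 < x ∧ x < c ∧ a = Complex.I * (x : ℂ)}

/-- The Hilbert space `L₂[0, π]` of complex valued functions. -/
abbrev L2 : Type := Lp ℂ 2 (volume.restrict (Set.Icc (0 : ℝ) Real.pi))

/-- The Mathieu potential `q(x) = a e^{-2ix} + a e^{2ix} = 2 a cos 2x`. -/
noncomputable def potential (a : ℂ) (x : ℝ) : ℂ := 2 * a * (Real.cos (2 * x) : ℂ)

/-- `y` is differentiable on `[0, π]` with derivative `y₁`, and `y₁` is absolutely continuous
on `[0, π]` with `-y₁' + q y = h` almost everywhere (`y₁` is the integral of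
`y'' = q y - h`, which is integrable because `h ∈ L₂` and `y` is continuous). -/
def Solves (a : ℂ) (y y₁ : ℝ → ℂ) (h : L2) : Prop :=
  (∀ x ∈ Set.Icc (0 : ℝ) Real.pi,
      HasDerivWithinAt y (y₁ x) (Set.Icc (0 : ℝ) Real.pi) x) ∧
  ∀ x ∈ Set.Icc (0 : ℝ) Real.pi,
      y₁ x = y₁ 0 + ∫ t in (0 : ℝ)..x, (potential a t * y t - h t)

/-- Boundary values `(y(0), y'(0), y(π), y'(π))`. -/
abbrev BV : Type := ℂ × ℂ × ℂ × ℂ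

/-- Periodic boundary conditions `y(π) = y(0)`, `y'(π) = y'(0)`. -/
def periodicBC : Submodule ℂ BV where
  carrier := {v | v.2.2.1 = v.1 ∧ v.2.2.2 = v.2.1}
  add_mem' := by
    rintro u v ⟨h1, h2⟩ ⟨h3, h4⟩
    simp_all
  zero_mem' := by simp
  smul_mem' := by
    rintro c v ⟨h1, h2⟩
    simp_all

/-- Neumann boundary conditions `y'(0) = 0`, `y'(π) = 0`. -/
def neumannBC : Submodule ℂ BV where
  carrier := {v | v.2.1 = 0 ∧ v.2.2.2 = 0}
  add_mem' := by
    rintro u v ⟨h1, h2⟩ ⟨h3, h4⟩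
    simp_all
  zero_mem' := by simp
  smul_mem' := by
    rintro c v ⟨h1, h2⟩
    simp_all

lemma Solves.intervalIntegrable {a : ℂ} {y y₁ : ℝ → ℂ} {h : L2} (H : Solves a y y₁ h)
    {x : ℝ} (hx : x ∈ Set.Icc (0 : ℝ) Real.pi) :
    IntervalIntegrable (fun t => potential a t * y t - h t) volume 0 x := by
  have hy : ContinuousOn y (Set.Icc (0 : ℝ) Real.pi) :=
    fun t ht => (H.1 t ht).continuousWithinAt
  have hq : ContinuousOn (fun t => potential a t * y t) (Set.Icc (0 : ℝ) Real.pi) := by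
    refine ContinuousOn.mul ?_ hy
    unfold potential
    fun_prop
  have hh : IntegrableOn (fun t => h t) (Set.Icc (0 : ℝ) Real.pi) :=
    (Lp.memLp h).integrable (by norm_num)
  have hI : IntegrableOn (fun t => potential a t * y t - h t) (Set.Icc (0 : ℝ) Real.pi) :=
    (hq.integrableOn_compact isCompact_Icc).sub hh
  rw [intervalIntegrable_iff_integrableOn_Icc_of_le hx.1]
  exact hI.mono_set (Set.Icc_subset_Icc le_rfl hx.2)

/-- The graph `{(f, T f) : f ∈ dom T}` of the operator `T` generated in `L₂[0, π]` by the
differential expression `-y'' + 2 a cos(2x) y` and the boundary conditions `B`. -/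
noncomputable def graph (B : Submodule ℂ BV) (a : ℂ) : Submodule ℂ (L2 × L2) where
  carrier := {p | ∃ y y₁ : ℝ → ℂ,
    (p.1 : ℝ → ℂ) =ᵐ[volume.restrict (Set.Icc (0 : ℝ) Real.pi)] y ∧
    Solves a y y₁ p.2 ∧ (y 0, y₁ 0, y Real.pi, y₁ Real.pi) ∈ B}
  add_mem' := by
    rintro ⟨f, h⟩ ⟨f', h'⟩ ⟨y, y₁, hy, H, hB⟩ ⟨z, z₁, hz, H', hB'⟩
    refine ⟨y + z, y₁ + z₁, ?_, ⟨fun x hx => (H.1 x hx).add (H'.1 x hx), fun x hx => ?_⟩, ?_⟩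
    · filter_upwards [Lp.coeFn_add f f', hy, hz] with x h1 h2 h3
      simp only [Prod.fst_add, h1, Pi.add_apply, ← h2, ← h3]
    · have e : ∫ t in (0 : ℝ)..x, (potential a t * (y + z) t - (h + h' : L2) t) =
          ∫ t in (0 : ℝ)..x, ((potential a t * y t - h t) + (potential a t * z t - h' t)) := by
        rw [intervalIntegral.integral_of_le hx.1, intervalIntegral.integral_of_le hx.1]
        refine integral_congr_ae ?_
        have hs : Set.Ioc (0 : ℝ) x ⊆ Set.Icc 0 Real.pi :=
          fun t ht => ⟨ht.1.le, ht.2.trans hx.2⟩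
        filter_upwards [ae_restrict_of_ae_restrict_of_subset hs (Lp.coeFn_add h h')] with t ht
        simp only [ht, Pi.add_apply]
        ring
      simp only [Prod.snd_add, Pi.add_apply] at e ⊢
      rw [e, intervalIntegral.integral_add (H.intervalIntegrable hx) (H'.intervalIntegrable hx)]
      have h1 := H.2 x hx
      have h2 := H'.2 x hx
      simp only at h1 h2
      rw [h1, h2]
      ring
    · exact B.add_mem hB hB'
  zero_mem' := by
    refine ⟨0, 0, Lp.coeFn_zero _ _ _, ⟨fun x _ => hasDerivWithinAt_const _ _ _,
      fun x hx => ?_⟩, B.zero_mem⟩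
    have e : ∫ t in (0 : ℝ)..x, (potential a t * (0 : ℝ → ℂ) t - (0 : L2) t) =
        ∫ t in (0 : ℝ)..x, (0 : ℂ) := by
      rw [intervalIntegral.integral_of_le hx.1, intervalIntegral.integral_of_le hx.1]
      refine integral_congr_ae ?_
      have hs : Set.Ioc (0 : ℝ) x ⊆ Set.Icc 0 Real.pi :=
        fun t ht => ⟨ht.1.le, ht.2.trans hx.2⟩
      filter_upwards [ae_restrict_of_ae_restrict_of_subset hs
        (Lp.coeFn_zero ℂ 2 (volume.restrict (Set.Icc (0 : ℝ) Real.pi)))] with t ht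
      have ht' : (0 : L2) t = 0 := ht
      rw [ht']
      simp
    simp only [Prod.snd_zero]
    rw [e]
    simp
  smul_mem' := by
    rintro c ⟨f, h⟩ ⟨y, y₁, hy, H, hB⟩
    refine ⟨c • y, c • y₁, ?_, ⟨fun x hx => (H.1 x hx).const_smul c, fun x hx => ?_⟩, ?_⟩
    · filter_upwards [Lp.coeFn_smul c f, hy] with x h1 h2
      simp only [Prod.smul_fst, h1, Pi.smul_apply, ← h2]
    · have e : ∫ t in (0 : ℝ)..x, (potential a t * (c • y) t - (c • h : L2) t) =
          ∫ t in (0 : ℝ)..x, c * (potential a t * y t - h t) := by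
        rw [intervalIntegral.integral_of_le hx.1, intervalIntegral.integral_of_le hx.1]
        refine integral_congr_ae ?_
        have hs : Set.Ioc (0 : ℝ) x ⊆ Set.Icc 0 Real.pi :=
          fun t ht => ⟨ht.1.le, ht.2.trans hx.2⟩
        filter_upwards [ae_restrict_of_ae_restrict_of_subset hs (Lp.coeFn_smul c h)] with t ht
        simp only [ht, Pi.smul_apply, smul_eq_mul]
        ring
      simp only [Prod.smul_snd, Pi.smul_apply, smul_eq_mul] at e ⊢
      rw [e, intervalIntegral.integral_const_mul]
      have h1 := H.2 x hx
      simp only at h1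
      rw [h1]
      ring
    · exact B.smul_mem c hB

/-- (The graph of) the operator `H₀(a)`: the Mathieu operator on `[0, π]` with periodic
boundary conditions. -/
noncomputable def H0 (a : ℂ) : Submodule ℂ (L2 × L2) := graph periodicBC a

/-- (The graph of) the operator `N(a)`: the Mathieu operator on `[0, π]` with Neumann
boundary conditions. -/
noncomputable def Neu (a : ℂ) : Submodule ℂ (L2 × L2) := graph neumannBC a

/-- `z` is an eigenvalue of the operator with graph `G`. -/
def IsEigenvalue (G : Submodule ℂ (L2 × L2)) (z : ℂ) : Prop :=
  ∃ f : L2, f ≠ 0 ∧ (f, z • f) ∈ G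

/-- `ker (T - z)ⁿ` for the operator `T` with graph `G`: `ker (T - z)⁰ = 0`, and
`f ∈ ker (T - z)ⁿ⁺¹` iff `f ∈ dom T` and `T f - z f ∈ ker (T - z)ⁿ`. -/
noncomputable def kerPow (G : Submodule ℂ (L2 × L2)) (z : ℂ) : ℕ → Submodule ℂ L2
  | 0 => ⊥
  | n + 1 => (G ⊓ (kerPow G z n).comap
      (LinearMap.snd ℂ L2 L2 - z • LinearMap.fst ℂ L2 L2)).map (LinearMap.fst ℂ L2 L2)

/-- The (algebraic) multiplicity of `z` for the operator with graph `G`: the dimension of the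
root subspace `⋃ₙ ker (T - z)ⁿ`. -/
noncomputable def multiplicity (G : Submodule ℂ (L2 × L2)) (z : ℂ) : ℕ∞ :=
  Cardinal.toENat (Module.rank ℂ ↥(⨆ n, kerPow G z n))

/-- `z` is a `PN(a)` (periodic Neumann) eigenvalue: a periodic eigenvalue which is also a
Neumann eigenvalue. -/
def IsPN (a z : ℂ) : Prop := IsEigenvalue (H0 a) z ∧ IsEigenvalue (Neu a) z

/-- `μ, ν` is the list of the `PN(a)` eigenvalues in the closed disc `{z : |z - 3| ≤ 6}`, each
repeated according to its multiplicity as an eigenvalue of `H₀(a)`. -/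
def IsPNPair (a μ ν : ℂ) : Prop :=
  μ ∈ Metric.closedBall (3 : ℂ) 6 ∧ ν ∈ Metric.closedBall (3 : ℂ) 6 ∧
  (∀ z ∈ Metric.closedBall (3 : ℂ) 6, IsPN a z ↔ z = μ ∨ z = ν) ∧
  ∀ z ∈ Metric.closedBall (3 : ℂ) 6, IsPN a z →
    multiplicity (H0 a) z = ((({μ, ν} : Multiset ℂ).count z : ℕ) : ℕ∞)

/-- `3 + n₁ + ⋯ + n_s`, where `n₁, n₂, …, n_m` are the values of `n : Fin m → ℤ`. -/
def position {m : ℕ} (n : Fin m → ℤ) (s : ℕ) : ℤ :=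
  3 + ∑ i : Fin m with i.val < s, n i

/-- The sign sequences `n₁, …, n_{2k} ∈ {-1, 1}` such that `3 + n₁ + ⋯ + n_{2k} = 1` and
`3 + n₁ + ⋯ + n_{2s} > 1` for `s = 1, …, k - 1`. -/
def signs (k : ℕ) : Finset (Fin (2 * k) → ℤ) :=
  {n ∈ Fintype.piFinset (fun _ : Fin (2 * k) => ({-1, 1} : Finset ℤ)) |
    position n (2 * k) = 1 ∧ ∀ s ∈ Finset.Ico 1 k, 1 < position n (2 * s)}

/-- For `k ≥ 1`,
`A_k(a, z) = ∑ a^{2k+2} / ((z - 16) (z - 36) ∏_{s=1}^{2k-1} (z - (6 + 2n₁ + ⋯ + 2n_s)²))`,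
the sum being over the sign sequences in `signs k`. -/
noncomputable def A (k : ℕ) (a z : ℂ) : ℂ :=
  ∑ n ∈ signs k, a ^ (2 * k + 2) / ((z - 16) * (z - 36) *
    ∏ s ∈ Finset.Ico 1 (2 * k), (z - ((2 * position n s : ℤ) : ℂ) ^ 2))

/-- The left-hand side of the scalar equation
`z² - 4z - 2a² - a² z / (z - 16) - ∑_{k ≥ 1} z A_k(a, z) = 0`. -/
noncomputable def scalarFun (a z : ℂ) : ℂ :=
  z ^ 2 - 4 * z - 2 * a ^ 2 - a ^ 2 * z / (z - 16) - ∑' k : ℕ, z * A (k + 1) a z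

end Mathieu

/-! In the basis `e^{2inx}` the periodic operator acts on Fourier coefficients as `4 n² φ n + a (φ
(n - 1) + φ (n + 1))` (`mathieuSeq`). Constancy of the Wronskian shows that a `PN(a)` eigenvalue has
an eigenfunction that is periodic and Neumann at once. Such a function cannot have odd coefficients,
since then it would vanish at `0` together with its derivative; so the recursion has a nonzero even
solution.

For even sequences the levels `p ≥ 2` can be eliminated: when `‖a‖ ≤ 2` and `‖z‖ < 10` the truncated
recursion is a contraction, with resolvent `res`. The equations at levels `0` and `1` then leave the
scalar condition `charFun a z = z² - 4z - 2a² + z a² g(z) = 0`, where `g = green a` is the diagonal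
entry of the resolvent at level `2` (`isPN_iff`). Expanding `g` in its Neumann series is summing
over walks that end on first reaching level `1`, and this is precisely the series of the scalar
equation (`scalarFun_eq_charFun`).

Zeros are counted by divided differences, which are explicit through the resolvent identity. The
second difference `charFun₃` stays within `1 / 2` of `1`. One zero comes from the maximum principle
applied to `1 / charFun`, the second from a contraction, and then `charFun = (z - μ)(z - ν)
charFun₃` with nonvanishing last factor (`exists_charFun_factorization`).

Algebraic multiplicity equals the order of the zero. The formal eigenvector `chain₀` and its
`z`-derivatives satisfy the Jordan chain relations up to a defect at level `0`, and the defects are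
`charFun` and its divided differences over `a`. Because odd solutions do not coexist with even ones,
a nonzero defect cannot be repaired (`eq_smul_chain₀`).

For `a = i x` the function is real on the real axis (`green_conj`), so the two zeros are real or
conjugate. There it increases strictly with `x` (`realCharFun_lt`): a real zero at `y` becomes a
negative value at every `x < y`, flanked by two distinct real zeros, so at most one parameter has a
collision. The largest `x` at which a nonpositive value occurs gives a double zero
(`exists_double_zero`). -/

/-! ### The resolvent of the recursion truncated to the levels `p ≥ 2` -/

namespace Mathieu

/-- Bounded complex sequences indexed by `ℤ`. -/
abbrev Seq : Type := BoundedContinuousFunction ℤ ℂ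

/-- A bounded sequence as an element of `Seq`. -/
noncomputable def Seq.mk (f : ℤ → ℂ) (C : ℝ) (h : ∀ p, ‖f p‖ ≤ C) : Seq :=
  BoundedContinuousFunction.ofNormedAddCommGroupDiscrete f C h

lemma four_sq_ge {p : ℤ} (hp : 2 ≤ p) : (16 : ℝ) ≤ 4 * (p : ℝ) ^ 2 := by
  have : (2 : ℝ) ≤ p := by exact_mod_cast hp
  nlinarith

lemma four_sq_ge' {p : ℤ} (hp : 3 ≤ p) : (36 : ℝ) ≤ 4 * (p : ℝ) ^ 2 := by
  have : (3 : ℝ) ≤ p := by exact_mod_cast hp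
  nlinarith

lemma norm_four_sq (p : ℤ) : ‖4 * (p : ℂ) ^ 2‖ = 4 * (p : ℝ) ^ 2 := by
  have : 4 * (p : ℂ) ^ 2 = ((4 * (p : ℝ) ^ 2 : ℝ) : ℂ) := by push_cast; rfl
  rw [this, Complex.norm_real, Real.norm_of_nonneg (by positivity)]

/-- `1 / (4 p²)` on the levels `p ≥ 2`. -/
noncomputable def tailWeight : Seq :=
  Seq.mk (fun p => if 2 ≤ p then 1 / (4 * (p : ℂ) ^ 2) else 0) (1 / 16) (by
    intro p
    split_ifs with hp
    · rw [norm_div, norm_four_sq, norm_one]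
      exact one_div_le_one_div_of_le (by norm_num) (four_sq_ge hp)
    · simp)

lemma tailWeight_le (p : ℤ) : ‖tailWeight p‖ ≤ 1 / 16 := by
  change ‖(if 2 ≤ p then 1 / (4 * (p : ℂ) ^ 2) else 0)‖ ≤ 1 / 16
  split_ifs with hp
  · rw [norm_div, norm_four_sq, norm_one]
    exact one_div_le_one_div_of_le (by norm_num) (four_sq_ge hp)
  · simp

/-- The inverse of the free part on the levels `p ≥ 2`. -/
noncomputable def tailInv : Seq →L[ℂ] Seq := ContinuousLinearMap.mul ℂ Seq tailWeight

/-- The sum of the two neighbours. -/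
noncomputable def hop : Seq →L[ℂ] Seq :=
  BoundedContinuousFunction.compContinuousCLM ℂ ℂ ⟨fun p : ℤ => p - 1, continuous_of_discreteTopology⟩ +
  BoundedContinuousFunction.compContinuousCLM ℂ ℂ ⟨fun p : ℤ => p + 1, continuous_of_discreteTopology⟩

@[simp] lemma hop_apply (ω : Seq) (p : ℤ) : hop ω p = ω (p - 1) + ω (p + 1) := rfl

lemma tailInv_apply (ω : Seq) (p : ℤ) :
    tailInv ω p = if 2 ≤ p then 1 / (4 * (p : ℂ) ^ 2) * ω p else 0 := by
  change (if 2 ≤ p then 1 / (4 * (p : ℂ) ^ 2) else 0) * ω p = _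
  split_ifs <;> simp

lemma norm_tailInv_le : ‖tailInv‖ ≤ 1 / 16 :=
  (ContinuousLinearMap.opNorm_mul_apply_le ℂ Seq tailWeight).trans
    ((BoundedContinuousFunction.norm_le (by norm_num)).2 tailWeight_le)

lemma norm_hop_le : ‖hop‖ ≤ 2 := by
  refine (norm_add_le _ _).trans ?_
  have h1 := BoundedContinuousFunction.norm_compContinuousCLM_le_one (𝕜 := ℂ) (β := ℂ)
    (⟨fun p : ℤ => p - 1, continuous_of_discreteTopology⟩ : C(ℤ, ℤ))
  have h2 := BoundedContinuousFunction.norm_compContinuousCLM_le_one (𝕜 := ℂ) (β := ℂ)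
    (⟨fun p : ℤ => p + 1, continuous_of_discreteTopology⟩ : C(ℤ, ℤ))
  linarith

/-- The perturbation `z D - a D S` of the identity on the levels `p ≥ 2`. -/
noncomputable def tailOp (a z : ℂ) : Seq →L[ℂ] Seq := z • tailInv - a • (tailInv * hop)

/-- The free part is at least `16` on these levels, against less than `10` from `z` and at most `2 *
2` from the two neighbours: the norm is below `14 / 16`. -/
lemma norm_tailOp_lt {a z : ℂ} (ha : ‖a‖ ≤ 2) (hz : ‖z‖ < 10) : ‖tailOp a z‖ < 1 := by
  have h1 : ‖z • tailInv‖ ≤ ‖z‖ * (1 / 16) := by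
    rw [norm_smul]; gcongr; exact norm_tailInv_le
  have h2 : ‖a • (tailInv * hop)‖ ≤ 2 * (1 / 16 * 2) := by
    rw [norm_smul]
    gcongr
    refine (norm_mul_le _ _).trans ?_
    gcongr
    · exact norm_tailInv_le
    · exact norm_hop_le
  have := norm_sub_le (z • tailInv) (a • (tailInv * hop))
  unfold tailOp
  linarith

lemma isUnit_tail {a z : ℂ} (ha : ‖a‖ ≤ 2) (hz : ‖z‖ < 10) : IsUnit (1 - tailOp a z) :=
  isUnit_one_sub_of_norm_lt_one (R := Seq →L[ℂ] Seq) (norm_tailOp_lt ha hz)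

/-- The resolvent of the truncation of the Mathieu Jacobi matrix to the levels `p ≥ 2`. -/
noncomputable def res (a z : ℂ) : Seq →L[ℂ] Seq := Ring.inverse (1 - tailOp a z) * tailInv

/-- `ω` vanishes below level `2` and solves the Mathieu recursion with source `η` above it. -/
def IsTail (a z : ℂ) (η ω : ℤ → ℂ) : Prop :=
  (∀ p : ℤ, p < 2 → ω p = 0) ∧
    ∀ p : ℤ, 2 ≤ p → (4 * (p : ℂ) ^ 2 - z) * ω p + a * (ω (p - 1) + ω (p + 1)) = η p

/-- Division by `4 p²` makes the recursion a perturbation of the identity, so invertibility of `1 -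
tailOp a z` yields existence and uniqueness of bounded tails. -/
lemma isTail_iff {a z : ℂ} (η ω : Seq) :
    IsTail a z η ω ↔ (1 - tailOp a z) ω = tailInv η := by
  have key : ∀ p, ((1 - tailOp a z) ω) p =
      ω p - (z * tailInv ω p - a * tailInv (hop ω) p) := fun p => rfl
  constructor
  · rintro ⟨h1, h2⟩
    ext p
    rw [key]
    simp only [tailInv_apply, hop_apply]
    split_ifs with hp
    · rw [← h2 p hp]
      have hp0 : (p : ℂ) ≠ 0 := by exact_mod_cast (by omega : p ≠ 0)
      field_simp
      ring
    · rw [h1 p (by omega)]; ring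
  · intro h
    have h' : ∀ p, ω p - (z * tailInv ω p - a * tailInv (hop ω) p) = tailInv η p :=
      fun p => by rw [← key, h]
    simp only [tailInv_apply, hop_apply] at h'
    refine ⟨fun p hp => ?_, fun p hp => ?_⟩
    · have := h' p
      rw [if_neg (by omega), if_neg (by omega), if_neg (by omega)] at this
      linear_combination this
    · have := h' p
      rw [if_pos hp, if_pos hp, if_pos hp] at this
      have hp0 : (p : ℂ) ≠ 0 := by exact_mod_cast (by omega : p ≠ 0)
      field_simp at this
      linear_combination this

lemma isTail_res {a z : ℂ} (ha : ‖a‖ ≤ 2) (hz : ‖z‖ < 10) (η : Seq) :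
    IsTail a z η (res a z η) := by
  rw [isTail_iff]
  have := Ring.mul_inverse_cancel _ (isUnit_tail ha hz)
  calc (1 - tailOp a z) (res a z η)
      = ((1 - tailOp a z) * Ring.inverse (1 - tailOp a z)) (tailInv η) := rfl
    _ = tailInv η := by rw [this]; rfl

lemma IsTail.eq_res {a z : ℂ} (ha : ‖a‖ ≤ 2) (hz : ‖z‖ < 10) {η ω : Seq}
    (h : IsTail a z η ω) : ω = res a z η := by
  rw [isTail_iff] at h
  have := Ring.inverse_mul_cancel _ (isUnit_tail ha hz)
  calc ω = (Ring.inverse (1 - tailOp a z) * (1 - tailOp a z)) ω := by rw [this]; rfl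
    _ = Ring.inverse (1 - tailOp a z) ((1 - tailOp a z) ω) := rfl
    _ = res a z η := by rw [h]; rfl

lemma IsTail.smul {a z : ℂ} {η ω : ℤ → ℂ} (c : ℂ) (h : IsTail a z η ω) :
    IsTail a z (fun p => c * η p) (fun p => c * ω p) :=
  ⟨fun p hp => by simp [h.1 p hp], fun p hp => by linear_combination c * h.2 p hp⟩

/-- The first resolvent identity. -/
lemma res_sub_res {a z w : ℂ} (ha : ‖a‖ ≤ 2) (hz : ‖z‖ < 10) (hw : ‖w‖ < 10) (η : Seq) :
    res a z η - res a w η = (z - w) • res a z (res a w η) := by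
  rw [← map_smul]
  -- By uniqueness it is enough that the difference solves the recursion at `z` with source `(z - w)
  -- • res a w η`.
  refine IsTail.eq_res ha hz ?_
  have h1 := isTail_res ha hz η
  have h2 := isTail_res ha hw η
  refine ⟨fun p hp => ?_, fun p hp => ?_⟩
  · simp [h1.1 p hp, h2.1 p hp]
  · have e1 := h1.2 p hp
    have e2 := h2.2 p hp
    simp only [BoundedContinuousFunction.coe_sub, Pi.sub_apply,
      BoundedContinuousFunction.coe_smul, smul_eq_mul]
    linear_combination e1 - e2

/-- The second resolvent identity, for a change of the parameter of the potential. -/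
lemma res_sub_res_param {a b z : ℂ} (ha : ‖a‖ ≤ 2) (hb : ‖b‖ ≤ 2) (hz : ‖z‖ < 10) (η : Seq) :
    res a z η - res b z η = (b - a) • res a z (hop (res b z η)) := by
  rw [← map_smul]
  refine IsTail.eq_res ha hz ?_
  have h1 := isTail_res ha hz η
  have h2 := isTail_res hb hz η
  refine ⟨fun p hp => ?_, fun p hp => ?_⟩
  · simp [h1.1 p hp, h2.1 p hp]
  · have e1 := h1.2 p hp
    have e2 := h2.2 p hp
    simp only [BoundedContinuousFunction.coe_sub, Pi.sub_apply, hop_apply,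
      BoundedContinuousFunction.coe_smul, smul_eq_mul]
    linear_combination e1 - e2

lemma norm_level_sub_ge {z : ℂ} (p : ℤ) : 4 * (p : ℝ) ^ 2 - ‖z‖ ≤ ‖4 * (p : ℂ) ^ 2 - z‖ := by
  rw [← norm_four_sq]; exact norm_sub_norm_le _ _

lemma IsTail.level_bound {a z : ℂ} {η ω : ℤ → ℂ} (h : IsTail a z η ω) {p : ℤ} (hp : 2 ≤ p) :
    (4 * (p : ℝ) ^ 2 - ‖z‖) * ‖ω p‖ ≤ ‖η p‖ + ‖a‖ * (‖ω (p - 1)‖ + ‖ω (p + 1)‖) := by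
  calc (4 * (p : ℝ) ^ 2 - ‖z‖) * ‖ω p‖ ≤ ‖4 * (p : ℂ) ^ 2 - z‖ * ‖ω p‖ := by
        gcongr; exact norm_level_sub_ge p
    _ = ‖η p - a * (ω (p - 1) + ω (p + 1))‖ := by
        rw [← norm_mul, ← h.2 p hp]; congr 1; ring
    _ ≤ ‖η p‖ + ‖a * (ω (p - 1) + ω (p + 1))‖ := norm_sub_le _ _
    _ ≤ _ := by
        rw [norm_mul]; gcongr; exact norm_add_le _ _

/-- Let `W` and `H` be the sup norms of tail and source. At level `2` the lower neighbour vanishes,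
so `7 W ≤ H + 2 W` if the sup is governed there, with `7 = 16 - 9`; higher levels give the stronger
`27 W ≤ H + 4 W`, with `27 = 36 - 9`. -/
lemma norm_res_le {a z : ℂ} (ha : ‖a‖ ≤ 2) (hz : ‖z‖ ≤ 9) (η : Seq) :
    ‖res a z η‖ ≤ ‖η‖ / 5 := by
  set ω := res a z η with hω
  have ht : IsTail a z η ω := isTail_res ha (by linarith) η
  have hW : ∀ p, ‖ω p‖ ≤ ‖ω‖ := fun p => ω.norm_coe_le_norm p
  have hH : ∀ p, ‖η p‖ ≤ ‖η‖ := fun p => η.norm_coe_le_norm p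
  have hW0 := norm_nonneg ω
  have hH0 := norm_nonneg η
  have key : ‖ω‖ ≤ max ((‖η‖ + 2 * ‖ω‖) / 7) ((‖η‖ + 4 * ‖ω‖) / 27) := by
    rw [BoundedContinuousFunction.norm_le (le_max_of_le_left (by positivity))]
    intro p
    rcases lt_or_ge p 2 with hp | hp
    · rw [ht.1 p hp, norm_zero]; exact le_max_of_le_left (by positivity)
    have hb := ht.level_bound hp
    have hn : ‖a‖ * (‖ω (p - 1)‖ + ‖ω (p + 1)‖) ≤ 2 * (‖ω (p - 1)‖ + ‖ω (p + 1)‖) := by gcongr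
    rcases hp.eq_or_lt with rfl | hp
    · apply le_max_of_le_left
      rw [ht.1 (2 - 1) (by norm_num), norm_zero] at hn hb
      have := four_sq_ge (le_refl 2)
      have h7 : 7 * ‖ω 2‖ ≤ (4 * ((2 : ℤ) : ℝ) ^ 2 - ‖z‖) * ‖ω 2‖ := by
        gcongr; linarith
      linarith [hH 2, hW (2 + 1)]
    · apply le_max_of_le_right
      have := four_sq_ge' (show 3 ≤ p by omega)
      have h7 : 27 * ‖ω p‖ ≤ (4 * (p : ℝ) ^ 2 - ‖z‖) * ‖ω p‖ := by
        gcongr; linarith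
      linarith [hH p, hW (p + 1), hW (p - 1)]
  rcases le_max_iff.1 key with h | h <;> linarith

/-- On levels `p ≥ 3` the resolvent is smaller. -/
lemma norm_res_apply_le {a z : ℂ} (ha : ‖a‖ ≤ 2) (hz : ‖z‖ ≤ 9) (η : Seq) {p : ℤ} (hp : 3 ≤ p) :
    27 * ‖res a z η p‖ ≤ ‖η p‖ + ‖a‖ * (2 / 5 * ‖η‖) := by
  have ht : IsTail a z η (res a z η) := isTail_res ha (by linarith) η
  have hW : ∀ p, ‖res a z η p‖ ≤ ‖η‖ / 5 :=
    fun p => ((res a z η).norm_coe_le_norm p).trans (norm_res_le ha hz η)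
  have hb := ht.level_bound (show 2 ≤ p by omega)
  have h7 : 27 * ‖res a z η p‖ ≤ (4 * (p : ℝ) ^ 2 - ‖z‖) * ‖res a z η p‖ := by
    gcongr; linarith [four_sq_ge' hp]
  have : ‖a‖ * (‖res a z η (p - 1)‖ + ‖res a z η (p + 1)‖) ≤ ‖a‖ * (2 / 5 * ‖η‖) := by
    gcongr; linarith [hW (p - 1), hW (p + 1)]
  linarith

lemma norm_res_apply_two_le {a z : ℂ} (ha : ‖a‖ ≤ 2) (hz : ‖z‖ ≤ 9) (η : Seq) :
    7 * ‖res a z η 2‖ ≤ ‖η 2‖ + ‖a‖ * ‖res a z η 3‖ := by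
  have ht : IsTail a z η (res a z η) := isTail_res ha (by linarith) η
  have hb := ht.level_bound le_rfl
  have h7 : 7 * ‖res a z η 2‖ ≤ (4 * ((2 : ℤ) : ℝ) ^ 2 - ‖z‖) * ‖res a z η 2‖ := by
    gcongr; linarith [four_sq_ge (le_refl 2)]
  rw [ht.1 (2 - 1) (by norm_num), norm_zero, zero_add] at hb
  exact h7.trans hb

lemma differentiableAt_res {a z : ℂ} (ha : ‖a‖ ≤ 2) (hz : ‖z‖ < 10) :
    DifferentiableAt ℂ (res a) z := by
  have h1 : DifferentiableAt ℂ (fun z => 1 - tailOp a z) z :=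
    ((differentiableAt_id.smul_const tailInv).sub_const _).const_sub 1
  have h0 : DifferentiableAt ℂ (Ring.inverse (M₀ := Seq →L[ℂ] Seq)) (1 - tailOp a z) :=
    differentiableAt_inverse (𝕜 := ℂ) (R := Seq →L[ℂ] Seq) (isUnit_tail ha hz)
  have h2 : DifferentiableAt ℂ
      ((Ring.inverse (M₀ := Seq →L[ℂ] Seq)) ∘ (fun z => 1 - tailOp a z)) z :=
    DifferentiableAt.comp (𝕜 := ℂ) (E := ℂ) (F := Seq →L[ℂ] Seq) (G := Seq →L[ℂ] Seq) z h0 h1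
  exact h2.mul_const tailInv

lemma continuousAt_res {q : ℂ × ℂ} (ha : ‖q.1‖ ≤ 2) (hz : ‖q.2‖ < 10) :
    ContinuousAt (fun q : ℂ × ℂ => res q.1 q.2) q := by
  have h1 : ContinuousAt (fun q : ℂ × ℂ => 1 - tailOp q.1 q.2) q := by
    unfold tailOp; fun_prop
  have h2 : ContinuousAt (Ring.inverse (M₀ := Seq →L[ℂ] Seq)) (1 - tailOp q.1 q.2) :=
    (differentiableAt_inverse (𝕜 := ℂ) (R := Seq →L[ℂ] Seq) (isUnit_tail ha hz)).continuousAt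
  exact (ContinuousAt.comp (f := fun q : ℂ × ℂ => 1 - tailOp q.1 q.2) h2 h1).mul continuousAt_const

end Mathieu

/-! ### The characteristic function and its divided differences -/

namespace Mathieu

/-- The unit sequence at level `2`. -/
noncomputable def delta2 : Seq := Seq.mk (fun p => if p = 2 then 1 else 0) 1 (by
  intro p; split_ifs <;> simp)

lemma delta2_apply (p : ℤ) : delta2 p = if p = 2 then 1 else 0 := rfl

lemma norm_delta2_le : ‖delta2‖ ≤ 1 := by
  rw [BoundedContinuousFunction.norm_le zero_le_one]
  intro p
  rw [delta2_apply]
  split_ifs <;> simp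

/-- The diagonal entry of the resolvent at level `2`. -/
noncomputable def green (a z : ℂ) : ℂ := res a z delta2 2

/-- The divided difference of `green a`. -/
noncomputable def green₂ (a z w : ℂ) : ℂ := res a z (res a w delta2) 2

/-- The second divided difference of `green a`. -/
noncomputable def green₃ (a z w v : ℂ) : ℂ := res a z (res a w (res a v delta2)) 2

/-- The function whose zeros are the `PN(a)` eigenvalues. -/
noncomputable def charFun (a z : ℂ) : ℂ := z ^ 2 - 4 * z - 2 * a ^ 2 + z * a ^ 2 * green a z

/-- The divided difference of `charFun a`. -/
noncomputable def charFun₂ (a z w : ℂ) : ℂ := z + w - 4 + a ^ 2 * (green a z + w * green₂ a z w)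

/-- The second divided difference of `charFun a`. -/
noncomputable def charFun₃ (a z w v : ℂ) : ℂ := 1 + a ^ 2 * (green₂ a z w + v * green₃ a z w v)

section Algebra

variable {a z w v : ℂ}

lemma green_sub (ha : ‖a‖ ≤ 2) (hz : ‖z‖ < 10) (hw : ‖w‖ < 10) :
    green a z - green a w = (z - w) * green₂ a z w :=
  congrArg (fun f : Seq => f 2) (res_sub_res ha hz hw delta2)

lemma green₂_sub (ha : ‖a‖ ≤ 2) (hz : ‖z‖ < 10) (hw : ‖w‖ < 10) :
    green₂ a z v - green₂ a w v = (z - w) * green₃ a z w v :=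
  congrArg (fun f : Seq => f 2) (res_sub_res ha hz hw (res a v delta2))

lemma charFun_sub (ha : ‖a‖ ≤ 2) (hz : ‖z‖ < 10) (hw : ‖w‖ < 10) :
    charFun a z - charFun a w = (z - w) * charFun₂ a z w := by
  unfold charFun charFun₂
  linear_combination w * a ^ 2 * green_sub ha hz hw

lemma charFun₂_sub (ha : ‖a‖ ≤ 2) (hz : ‖z‖ < 10) (hw : ‖w‖ < 10) :
    charFun₂ a z v - charFun₂ a w v = (z - w) * charFun₃ a z w v := by
  unfold charFun₂ charFun₃
  linear_combination a ^ 2 * green_sub ha hz hw + v * a ^ 2 * green₂_sub (v := v) ha hz hw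

end Algebra

section Bounds

variable {a z w v : ℂ}

/-- The source vanishes here, so only the coupling remains, with `2 / 135 = (2 / 5) / 27`. Keeping
the factor `‖a‖` is what later gives a bound proportional to `x`. -/
lemma norm_res_delta2_ge_three (ha : ‖a‖ ≤ 2) (hz : ‖z‖ ≤ 9) {p : ℤ} (hp : 3 ≤ p) :
    ‖res a z delta2 p‖ ≤ ‖a‖ * (2 / 135) := by
  have h := norm_res_apply_le ha hz delta2 hp
  rw [delta2_apply, if_neg (by omega), norm_zero] at h
  have : ‖a‖ * (2 / 5 * ‖delta2‖) ≤ ‖a‖ * (2 / 5 * 1) := by gcongr; exact norm_delta2_le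
  linarith

/-- Level `2` gives `(1 + 8 / 135) / 7`, rounded up to `19 / 125`. -/
lemma norm_green_le (ha : ‖a‖ ≤ 2) (hz : ‖z‖ ≤ 9) : ‖green a z‖ ≤ 19 / 125 := by
  have h := norm_res_apply_two_le ha hz delta2
  have h3 := norm_res_delta2_ge_three ha hz (le_refl 3)
  have : ‖a‖ * ‖res a z delta2 3‖ ≤ 2 * (2 * (2 / 135)) := by
    gcongr; linarith
  rw [delta2_apply, if_pos rfl, norm_one] at h
  unfold green
  linarith

lemma norm_res_delta2_le (ha : ‖a‖ ≤ 2) (hz : ‖z‖ ≤ 9) : ‖res a z delta2‖ ≤ 19 / 125 := by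
  rw [BoundedContinuousFunction.norm_le (by norm_num)]
  intro p
  rcases lt_trichotomy p 2 with hp | rfl | hp
  · rw [(isTail_res ha (by linarith) delta2).1 p hp]; norm_num
  · exact norm_green_le ha hz
  · have := norm_res_delta2_ge_three ha hz (show 3 ≤ p by omega)
    linarith

lemma norm_green₂_le (ha : ‖a‖ ≤ 2) (hz : ‖z‖ ≤ 9) (hw : ‖w‖ ≤ 9) :
    ‖green₂ a z w‖ ≤ 19 / 625 := by
  have h1 := (res a z (res a w delta2)).norm_coe_le_norm 2
  have h2 := norm_res_le ha hz (res a w delta2)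
  have h3 := norm_res_delta2_le ha hw
  unfold green₂
  linarith

lemma norm_green₃_le (ha : ‖a‖ ≤ 2) (hz : ‖z‖ ≤ 9) (hw : ‖w‖ ≤ 9) (hv : ‖v‖ ≤ 9) :
    ‖green₃ a z w v‖ ≤ 19 / 3125 := by
  have h1 := (res a z (res a w (res a v delta2))).norm_coe_le_norm 2
  have h2 := norm_res_le ha hz (res a w (res a v delta2))
  have h4 := norm_res_le ha hw (res a v delta2)
  have h3 := norm_res_delta2_le ha hv
  unfold green₃
  linarith

lemma norm_sq_le (ha : ‖a‖ ≤ 2) : ‖a ^ 2‖ ≤ 4 := by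
  rw [norm_pow]; nlinarith [norm_nonneg a]

/-- This is the sense in which `charFun` is close to a monic quadratic. The constant `1 / 2` serves
twice: it keeps `charFun₃` away from `0`, and it is the contraction factor in the search for the
second zero. -/
lemma norm_charFun₃_sub_one_le (ha : ‖a‖ ≤ 2) (hz : ‖z‖ ≤ 9) (hw : ‖w‖ ≤ 9) (hv : ‖v‖ ≤ 9) :
    ‖a ^ 2 * (green₂ a z w + v * green₃ a z w v)‖ ≤ 1 / 2 := by
  have h1 : ‖green₂ a z w + v * green₃ a z w v‖ ≤ 19 / 625 + 9 * (19 / 3125) := by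
    refine (norm_add_le _ _).trans ?_
    rw [norm_mul]
    gcongr
    · exact norm_green₂_le ha hz hw
    · exact norm_green₃_le ha hz hw hv
  rw [norm_mul]
  have h2 : ‖a ^ 2‖ * ‖green₂ a z w + v * green₃ a z w v‖ ≤ 4 * (19 / 625 + 9 * (19 / 3125)) := by
    gcongr
    exact norm_sq_le ha
  linarith

lemma charFun₃_ne_zero (ha : ‖a‖ ≤ 2) (hz : ‖z‖ ≤ 9) (hw : ‖w‖ ≤ 9) (hv : ‖v‖ ≤ 9) :
    charFun₃ a z w v ≠ 0 := by
  intro h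
  have h1 := norm_charFun₃_sub_one_le ha hz hw hv
  have h2 : a ^ 2 * (green₂ a z w + v * green₃ a z w v) = -1 := by
    unfold charFun₃ at h; linear_combination h
  rw [h2, norm_neg, norm_one] at h1
  norm_num at h1

end Bounds

section Analytic

variable {a : ℂ}

lemma differentiableAt_res_apply (ha : ‖a‖ ≤ 2) {z : ℂ} (hz : ‖z‖ < 10) (η : Seq) (p : ℤ) :
    DifferentiableAt ℂ (fun z => res a z η p) z := by
  have h1 : DifferentiableAt ℂ (fun z => res a z η) z :=
    (differentiableAt_res ha hz).clm_apply (differentiableAt_const η)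
  exact (BoundedContinuousFunction.evalCLM ℂ p : Seq →L[ℂ] ℂ).differentiableAt.comp z h1

lemma differentiableAt_charFun (ha : ‖a‖ ≤ 2) {z : ℂ} (hz : ‖z‖ < 10) :
    DifferentiableAt ℂ (charFun a) z := by
  have h := differentiableAt_res_apply ha hz delta2 2
  change DifferentiableAt ℂ (fun z => z ^ 2 - 4 * z - 2 * a ^ 2 + z * a ^ 2 * res a z delta2 2) z
  fun_prop

lemma differentiableAt_charFun₃ (ha : ‖a‖ ≤ 2) {z : ℂ} (hz : ‖z‖ < 10) (w v : ℂ) :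
    DifferentiableAt ℂ (fun z => charFun₃ a z w v) z := by
  have h := differentiableAt_res_apply ha hz (res a w delta2) 2
  have h' := differentiableAt_res_apply ha hz (res a w (res a v delta2)) 2
  change DifferentiableAt ℂ (fun z => 1 + a ^ 2 * (res a z (res a w delta2) 2 +
    v * res a z (res a w (res a v delta2)) 2)) z
  fun_prop

lemma analyticAt_of_differentiableAt_ball {f : ℂ → ℂ}
    (hf : ∀ z, ‖z‖ < 10 → DifferentiableAt ℂ f z) {z : ℂ} (hz : ‖z‖ < 10) : AnalyticAt ℂ f z :=
  DifferentiableOn.analyticAt (s := Metric.ball 0 10)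
    (fun w hw => (hf w (by simpa using hw)).differentiableWithinAt)
    (Metric.isOpen_ball.mem_nhds (by simpa using hz))

lemma analyticAt_charFun (ha : ‖a‖ ≤ 2) {z : ℂ} (hz : ‖z‖ < 10) : AnalyticAt ℂ (charFun a) z :=
  analyticAt_of_differentiableAt_ball (fun _ h => differentiableAt_charFun ha h) hz

/-- The slope is `charFun₂ a w z`, which is continuous in `w` up to the diagonal. -/
lemma hasDerivAt_charFun (ha : ‖a‖ ≤ 2) {z : ℂ} (hz : ‖z‖ < 10) :
    HasDerivAt (charFun a) (charFun₂ a z z) z := by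
  have hc : ContinuousAt (fun w => charFun₂ a w z) z := by
    have h := differentiableAt_res_apply ha hz delta2 2
    have h' := differentiableAt_res_apply ha hz (res a z delta2) 2
    have : DifferentiableAt ℂ (fun w => w + z - 4 + a ^ 2 * (res a w delta2 2 +
      z * res a w (res a z delta2) 2)) z := by fun_prop
    exact this.continuousAt
  rw [hasDerivAt_iff_tendsto_slope]
  refine (hc.tendsto.mono_left nhdsWithin_le_nhds).congr' ?_
  have hb : Metric.ball (0 : ℂ) 10 ∈ nhdsWithin z {z}ᶜ :=
    mem_nhdsWithin_of_mem_nhds (Metric.isOpen_ball.mem_nhds (by simpa using hz))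
  filter_upwards [hb, self_mem_nhdsWithin] with w hw hne
  rw [slope_def_field, charFun_sub ha (by simpa using hw) hz,
    mul_div_cancel_left₀ _ (sub_ne_zero.2 hne)]

end Analytic

/-! ### Exactly two zeros for a purely imaginary parameter -/

section Imaginary

variable {x : ℝ}

lemma norm_I_mul (hx : 0 ≤ x) : ‖Complex.I * (x : ℂ)‖ = x := by
  simp [abs_of_nonneg hx]

lemma I_mul_sq (x : ℝ) : (Complex.I * (x : ℂ)) ^ 2 = -((x ^ 2 : ℝ) : ℂ) := by
  rw [mul_pow, Complex.I_sq]; push_cast; ring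

lemma norm_I_mul_le (hx : 0 ≤ x) (hx2 : x ≤ 2) : ‖Complex.I * (x : ℂ)‖ ≤ 2 := by
  rwa [norm_I_mul hx]

/-- Off the disc of radius `5` about `2` the function `charFun` is large. -/
lemma norm_charFun_ge (hx : 0 ≤ x) (hx2 : x ≤ 2) {z : ℂ} (hz : ‖z‖ ≤ 9) (hz2 : 5 ≤ ‖z - 2‖) :
    15 ≤ ‖charFun (Complex.I * x) z‖ := by
  have ha := norm_I_mul_le hx hx2
  have hg := norm_green_le ha hz
  set a := Complex.I * (x : ℂ) with hadef
  -- Here `a = i x` matters: `4 + 2 a² = 4 - 2 x²` lies in `[-4, 4]`. The total is then at least `25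
  -- - 4 - 36 * 19 / 125 > 15`.
  have h1 : ‖(4 : ℂ) + 2 * a ^ 2‖ ≤ 4 := by
    have : (4 : ℂ) + 2 * a ^ 2 = ((4 - 2 * x ^ 2 : ℝ) : ℂ) := by
      rw [hadef, I_mul_sq]; push_cast; ring
    rw [this, Complex.norm_real, Real.norm_eq_abs, abs_le]
    constructor <;> nlinarith
  have h2 : ‖z * a ^ 2 * green a z‖ ≤ 9 * 4 * (19 / 125) := by
    rw [norm_mul, norm_mul]
    gcongr
    exact norm_sq_le ha
  have h3 : (25 : ℝ) ≤ ‖(z - 2) ^ 2‖ := by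
    rw [norm_pow]; nlinarith
  have h4 : charFun a z = (z - 2) ^ 2 - (4 + 2 * a ^ 2) + z * a ^ 2 * green a z := by
    unfold charFun; ring
  have h5 := norm_sub_norm_le ((z - 2) ^ 2) (4 + 2 * a ^ 2)
  have h6 := norm_sub_norm_le ((z - 2) ^ 2 - (4 + 2 * a ^ 2)) (-(z * a ^ 2 * green a z))
  rw [sub_neg_eq_add, norm_neg, ← h4] at h6
  linarith

lemma norm_le_seven {z : ℂ} (hz : ‖z - 2‖ ≤ 5) : ‖z‖ ≤ 7 := by
  have := norm_add_le (z - 2) 2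
  rw [sub_add_cancel] at this
  have h2 : ‖(2 : ℂ)‖ = 2 := by simp
  linarith

/-- Without a zero, the maximum principle for `1 / charFun` on the disc of radius `5` about `2`
would give modulus at least `15` at the centre, where it is at most `4 + 8 * 19 / 125`. -/
lemma exists_charFun_eq_zero (hx : 0 ≤ x) (hx2 : x ≤ 2) :
    ∃ z, ‖z - 2‖ < 5 ∧ charFun (Complex.I * x) z = 0 := by
  have ha := norm_I_mul_le hx hx2
  by_contra! hne
  have hbig : ∀ z ∈ Metric.sphere (2 : ℂ) 5, 15 ≤ ‖charFun (Complex.I * x) z‖ := by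
    intro z hz
    have hz' : ‖z - 2‖ = 5 := by simpa [dist_eq_norm] using hz
    exact norm_charFun_ge hx hx2 (by linarith [norm_le_seven hz'.le]) hz'.ge
  have hne' : ∀ z ∈ Metric.closedBall (2 : ℂ) 5, charFun (Complex.I * x) z ≠ 0 := by
    intro z hz
    have hz' : ‖z - 2‖ ≤ 5 := by simpa [dist_eq_norm] using hz
    rcases hz'.eq_or_lt with h | h
    · intro h0
      have := hbig z (by simpa [dist_eq_norm] using h)
      rw [h0, norm_zero] at this
      norm_num at this
    · exact hne z h
  have hd : DiffContOnCl ℂ (fun z => (charFun (Complex.I * x) z)⁻¹) (Metric.ball 2 5) := by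
    refine DifferentiableOn.diffContOnCl ?_
    rw [closure_ball _ (by norm_num)]
    intro z hz
    refine DifferentiableAt.differentiableWithinAt (DifferentiableAt.inv ?_ (hne' z hz))
    have hz' : ‖z - 2‖ ≤ 5 := by simpa [dist_eq_norm] using hz
    exact differentiableAt_charFun ha (by linarith [norm_le_seven hz'])
  have hmax := Complex.norm_le_of_forall_mem_frontier_norm_le Metric.isBounded_ball hd
    (C := 1 / 15) (by
      rw [frontier_ball _ (by norm_num)]
      intro z hz
      rw [norm_inv, ← one_div]
      exact one_div_le_one_div_of_le (by norm_num) (hbig z hz))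
    (subset_closure (Metric.mem_ball_self (by norm_num : (0 : ℝ) < 5)))
  rw [norm_inv, ← one_div] at hmax
  have hpos : 0 < ‖charFun (Complex.I * x) 2‖ := norm_pos_iff.2 (hne 2 (by simp))
  rw [div_le_div_iff₀ hpos (by norm_num)] at hmax
  have hg := norm_green_le ha (show ‖(2 : ℂ)‖ ≤ 9 by simp; norm_num)
  have hval : charFun (Complex.I * x) 2 = ((-4 + 2 * x ^ 2 : ℝ) : ℂ) -
      ((2 * x ^ 2 : ℝ) : ℂ) * green (Complex.I * x) 2 := by
    unfold charFun; rw [I_mul_sq]; push_cast; ring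
  have h1 := norm_sub_le (((-4 + 2 * x ^ 2 : ℝ) : ℂ))
    (((2 * x ^ 2 : ℝ) : ℂ) * green (Complex.I * x) 2)
  rw [← hval, norm_mul, Complex.norm_real, Complex.norm_real] at h1
  have h2 : ‖(-4 + 2 * x ^ 2 : ℝ)‖ ≤ 4 := by
    rw [Real.norm_eq_abs, abs_le]; constructor <;> nlinarith
  have h3 : ‖(2 * x ^ 2 : ℝ)‖ ≤ 8 := by
    rw [Real.norm_eq_abs, abs_le]; constructor <;> nlinarith
  have h4 : ‖(2 * x ^ 2 : ℝ)‖ * ‖green (Complex.I * x) 2‖ ≤ 8 * (19 / 125) := by gcongr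
  linarith

/-- The equation is linear in `z` up to a small term, so it is a fixed point problem near `4 - μ`,
the other root of the quadratic with root sum `4`. The second divided difference controls the
Lipschitz constant. -/
lemma exists_charFun₂_eq_zero {a μ : ℂ} (ha : ‖a‖ ≤ 2) (hμ : ‖μ - 2‖ ≤ 5) :
    ∃ z, ‖z‖ ≤ 9 ∧ charFun₂ a z μ = 0 := by
  have hμ7 := norm_le_seven hμ
  have hμ9 : ‖μ‖ ≤ 9 := by linarith
  set Φ : ℂ → ℂ := fun z => 4 - μ - a ^ 2 * (green a z + μ * green₂ a z μ) with hΦ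
  set s := Metric.closedBall (4 - μ) 2 with hs
  -- The radii add up as `2 + 5 + 2 = 9`, just inside the range of the estimates.
  have hs9 : ∀ z ∈ s, ‖z‖ ≤ 9 := by
    intro z hz
    have h1 : ‖z - (4 - μ)‖ ≤ 2 := by simpa [hs, dist_eq_norm] using hz
    have h2 : z = (z - (4 - μ)) + (-(μ - 2)) + 2 := by ring
    have h3 := norm_add₃_le (a := z - (4 - μ)) (b := -(μ - 2)) (c := 2)
    rw [← h2, norm_neg] at h3
    have : ‖(2 : ℂ)‖ = 2 := by simp
    linarith
  have hmaps : Set.MapsTo Φ s s := by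
    intro z hz
    have hz9 := hs9 z hz
    have h1 : ‖green a z + μ * green₂ a z μ‖ ≤ 19 / 125 + 7 * (19 / 625) := by
      refine (norm_add_le _ _).trans ?_
      rw [norm_mul]
      gcongr
      · exact norm_green_le ha hz9
      · exact norm_green₂_le ha hz9 hμ9
    have h2 : ‖a ^ 2 * (green a z + μ * green₂ a z μ)‖ ≤ 4 * (19 / 125 + 7 * (19 / 625)) := by
      rw [norm_mul]; gcongr; exact norm_sq_le ha
    have h3 : Φ z - (4 - μ) = -(a ^ 2 * (green a z + μ * green₂ a z μ)) := by rw [hΦ]; ring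
    rw [hs, Metric.mem_closedBall, dist_eq_norm, h3, norm_neg]
    linarith
  have hlip : ContractingWith (1 / 2) (hmaps.restrict Φ s s) := by
    refine ⟨by rw [← NNReal.coe_lt_coe]; norm_num, LipschitzWith.of_dist_le_mul ?_⟩
    rintro ⟨z, hz⟩ ⟨w, hw⟩
    have hz9 := hs9 z hz
    have hw9 := hs9 w hw
    change dist (Φ z) (Φ w) ≤ _ * dist z w
    have e : Φ z - Φ w = -((z - w) * (a ^ 2 * (green₂ a z w + μ * green₃ a z w μ))) := by
      have := charFun₂_sub (v := μ) ha (show ‖z‖ < 10 by linarith) (show ‖w‖ < 10 by linarith)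
      unfold charFun₂ charFun₃ at this
      rw [hΦ]
      linear_combination -this
    rw [dist_eq_norm, dist_eq_norm, e, norm_neg, norm_mul, mul_comm]
    gcongr
    simpa using norm_charFun₃_sub_one_le ha hz9 hw9 hμ9
  obtain ⟨z, hz, hfix, -⟩ := hlip.exists_fixedPoint'
    (Metric.isClosed_closedBall.isComplete) hmaps
    (Metric.mem_closedBall_self (by norm_num : (0 : ℝ) ≤ 2)) (edist_ne_top _ _)
  refine ⟨z, hs9 z hz, ?_⟩
  have hfix' : 4 - μ - a ^ 2 * (green a z + μ * green₂ a z μ) = z := hfix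
  unfold charFun₂
  linear_combination -hfix'

/-- `charFun` has exactly two zeros in `|z| ≤ 9`, counted with multiplicity. -/
theorem exists_charFun_factorization (hx : 0 ≤ x) (hx2 : x ≤ 2) :
    ∃ μ ν : ℂ, ‖μ - 2‖ < 5 ∧ ‖ν - 2‖ < 5 ∧ ∀ z, ‖z‖ ≤ 9 →
      charFun (Complex.I * x) z = (z - μ) * (z - ν) * charFun₃ (Complex.I * x) z ν μ := by
  have ha := norm_I_mul_le hx hx2
  obtain ⟨μ, hμ, hμ0⟩ := exists_charFun_eq_zero hx hx2
  obtain ⟨ν, hν, hν0⟩ := exists_charFun₂_eq_zero ha hμ.le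
  have hμ7 := norm_le_seven hμ.le
  have key : ∀ z, ‖z‖ ≤ 9 →
      charFun (Complex.I * x) z = (z - μ) * (z - ν) * charFun₃ (Complex.I * x) z ν μ := by
    intro z hz
    have h1 := charFun_sub ha (show ‖z‖ < 10 by linarith) (show ‖μ‖ < 10 by linarith)
    have h2 := charFun₂_sub (v := μ) ha (show ‖z‖ < 10 by linarith) (show ‖ν‖ < 10 by linarith)
    rw [hμ0] at h1
    rw [hν0] at h2
    linear_combination h1 + (z - μ) * h2
  -- So far `ν` is only known to satisfy `‖ν‖ ≤ 9`; being a zero, it cannot lie where `charFun` is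
  -- large.
  refine ⟨μ, ν, hμ, ?_, key⟩
  by_contra! h
  have := norm_charFun_ge hx hx2 hν h
  rw [key ν hν, sub_self, mul_zero, zero_mul, norm_zero] at this
  norm_num at this

end Imaginary

lemma count_pair (μ ν z : ℂ) : ({μ, ν} : Multiset ℂ).count z =
    (if z = μ then 1 else 0) + (if z = ν then 1 else 0) := by
  rw [Multiset.insert_eq_cons, Multiset.count_cons, Multiset.count_singleton, add_comm]

lemma analyticOrderAt_of_factorization {f H : ℂ → ℂ} {μ ν z : ℂ} (hf : AnalyticAt ℂ f z)
    (hH : AnalyticAt ℂ H z) (h0 : H z ≠ 0)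
    (h : ∀ᶠ w in nhds z, f w = (w - μ) * (w - ν) * H w) :
    analyticOrderAt f z = ((({μ, ν} : Multiset ℂ).count z : ℕ) : ℕ∞) := by
  rw [hf.analyticOrderAt_eq_natCast, count_pair]
  by_cases h1 : z = μ <;> by_cases h2 : z = ν
  · refine ⟨H, hH, h0, h.mono fun w hw => ?_⟩
    rw [if_pos h1, if_pos h2, hw, ← h1, ← h2, smul_eq_mul]; ring
  · refine ⟨fun w => (w - ν) * H w, (analyticAt_id.sub analyticAt_const).mul hH,
      mul_ne_zero (sub_ne_zero.2 h2) h0, h.mono fun w hw => ?_⟩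
    rw [if_pos h1, if_neg h2, hw, ← h1, smul_eq_mul]; ring
  · refine ⟨fun w => (w - μ) * H w, (analyticAt_id.sub analyticAt_const).mul hH,
      mul_ne_zero (sub_ne_zero.2 h1) h0, h.mono fun w hw => ?_⟩
    rw [if_neg h1, if_pos h2, hw, ← h2, smul_eq_mul]; ring
  · refine ⟨fun w => (w - μ) * (w - ν) * H w, ((analyticAt_id.sub analyticAt_const).mul
      (analyticAt_id.sub analyticAt_const)).mul hH,
      mul_ne_zero (mul_ne_zero (sub_ne_zero.2 h1) (sub_ne_zero.2 h2)) h0, h.mono fun w hw => ?_⟩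
    rw [if_neg h1, if_neg h2, hw, smul_eq_mul]; ring

end Mathieu

/-! ### The real axis: symmetry, monotonicity in the parameter, and a double zero -/

namespace Mathieu

section Real

variable {x y : ℝ}

/-- Conjugation turns `a = i x` into `-a`, and the alternating factor `(-1)^p` undoes that sign in
the coupling. Level `2` is even, so its entry is unaffected. -/
lemma green_conj (hx : 0 ≤ x) (hx2 : x ≤ 2) {z : ℂ} (hz : ‖z‖ < 10) :
    green (Complex.I * x) (starRingEnd ℂ z) = starRingEnd ℂ (green (Complex.I * x) z) := by
  have ha := norm_I_mul_le hx hx2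
  have hz' : ‖starRingEnd ℂ z‖ < 10 := by rwa [Complex.norm_conj]
  set a := Complex.I * (x : ℂ) with hadef
  have hac : starRingEnd ℂ a = -a := by simp [hadef]
  have ht := isTail_res ha hz delta2
  set ω : Seq := Seq.mk (fun p => (-1 : ℂ) ^ p * starRingEnd ℂ (res a z delta2 p))
    ‖res a z delta2‖ (by
      intro p
      rw [norm_mul, Complex.norm_conj, norm_zpow, norm_neg, norm_one, one_zpow, one_mul]
      exact (res a z delta2).norm_coe_le_norm p) with hω
  have hω_apply : ∀ p, ω p = (-1 : ℂ) ^ p * starRingEnd ℂ (res a z delta2 p) := fun p => rfl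
  have htail : IsTail a (starRingEnd ℂ z) delta2 ω := by
    refine ⟨fun p hp => by rw [hω_apply, ht.1 p hp]; simp, fun p hp => ?_⟩
    have e := congrArg (starRingEnd ℂ) (ht.2 p hp)
    have hd : starRingEnd ℂ (delta2 p) = (-1 : ℂ) ^ p * delta2 p := by
      rw [delta2_apply]
      split_ifs with h
      · rw [h]; norm_num
      · simp
    have hd2 : (-1 : ℂ) ^ p * (-1 : ℂ) ^ p = 1 := by
      rw [← mul_zpow]; norm_num
    simp only [map_mul, map_add, map_sub, map_pow, hac, Complex.conj_ofNat, map_intCast,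
      hd] at e
    rw [hω_apply, hω_apply, hω_apply, zpow_sub_one₀ (by norm_num), zpow_add_one₀ (by norm_num),
      inv_neg_one]
    linear_combination (-1 : ℂ) ^ p * e + delta2 p * hd2
  have := htail.eq_res ha hz'
  have h2 : ω 2 = res a (starRingEnd ℂ z) delta2 2 := by rw [this]
  rw [hω_apply] at h2
  unfold green
  rw [← h2]
  norm_num

lemma charFun_conj (hx : 0 ≤ x) (hx2 : x ≤ 2) {z : ℂ} (hz : ‖z‖ < 10) :
    charFun (Complex.I * x) (starRingEnd ℂ z) = starRingEnd ℂ (charFun (Complex.I * x) z) := by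
  unfold charFun
  rw [green_conj hx hx2 hz, I_mul_sq]
  simp [Complex.conj_ofNat, Complex.conj_ofReal]

/-- `charFun` on the real axis, for a purely imaginary parameter. -/
noncomputable def realCharFun (x l : ℝ) : ℝ := (charFun (Complex.I * x) l).re

lemma norm_ofReal_lt {l : ℝ} (hl : l ∈ Set.Icc (-3 : ℝ) 9) : ‖(l : ℂ)‖ ≤ 9 := by
  rw [Complex.norm_real, Real.norm_eq_abs, abs_le]
  constructor <;> linarith [hl.1, hl.2]

lemma charFun_ofReal (hx : 0 ≤ x) (hx2 : x ≤ 2) {l : ℝ} (hl : ‖(l : ℂ)‖ < 10) :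
    charFun (Complex.I * x) l = realCharFun x l := by
  have := charFun_conj hx hx2 hl
  rw [Complex.conj_ofReal] at this
  exact (Complex.conj_eq_iff_re.1 this.symm).symm

lemma realCharFun_eq (l : ℝ) : realCharFun x l =
    (l - 2) ^ 2 - 4 + 2 * x ^ 2 - l * x ^ 2 * (green (Complex.I * x) l).re := by
  unfold realCharFun charFun
  have : (l : ℂ) ^ 2 - 4 * l - 2 * (Complex.I * x) ^ 2 +
      l * (Complex.I * x) ^ 2 * green (Complex.I * x) l =
      (((l - 2) ^ 2 - 4 + 2 * x ^ 2 : ℝ) : ℂ) - ((l * x ^ 2 : ℝ) : ℂ) * green (Complex.I * x) l := by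
    rw [I_mul_sq]; push_cast; ring
  rw [this, Complex.sub_re, Complex.ofReal_re, Complex.re_ofReal_mul]

/-- The second resolvent identity gives the factor `y - x`. The rest is `O(y + x)`: the source at
level `2` sees only level `3` of a resolvent column, of size `O(x)`, and every other contribution
returns through a coupling of size `y`. Hence the dependence is Lipschitz in `x²`. -/
lemma norm_green_I_sub_le (hx : 0 ≤ x) (hxy : x ≤ y) (hy : y ≤ 2) {z : ℂ} (hz : ‖z‖ ≤ 9) :
    ‖green (Complex.I * y) z - green (Complex.I * x) z‖ ≤ 3 / 1000 * (y ^ 2 - x ^ 2) := by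
  have ha := norm_I_mul_le hx (hxy.trans hy)
  have hb := norm_I_mul_le (hx.trans hxy) hy
  have na := norm_I_mul hx
  have nb := norm_I_mul (hx.trans hxy)
  have nba : ‖Complex.I * (x : ℂ) - Complex.I * y‖ = y - x := by
    rw [← mul_sub, norm_mul, Complex.norm_I, one_mul, ← Complex.ofReal_sub, Complex.norm_real,
      Real.norm_eq_abs, abs_sub_comm, abs_of_nonneg (by linarith)]
  set a := Complex.I * (x : ℂ)
  set b := Complex.I * (y : ℂ)
  set η := hop (res a z delta2) with hη
  have e : green b z - green a z = (a - b) * res b z η 2 :=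
    congrArg (fun f : Seq => f 2) (res_sub_res_param hb ha (show ‖z‖ < 10 by linarith) delta2)
  have hη1 : ‖η‖ ≤ 2 * (19 / 125) := by
    refine (hop.le_opNorm _).trans ?_
    gcongr
    · exact norm_hop_le
    · exact norm_res_delta2_le ha hz
  have hη2 : ‖η 2‖ ≤ x * (2 / 135) := by
    rw [hη, hop_apply, (isTail_res ha (by linarith) delta2).1 (2 - 1) (by norm_num), zero_add, ← na]
    exact norm_res_delta2_ge_three ha hz le_rfl
  have h3 := norm_res_apply_le hb hz η (le_refl 3)
  have h4 : ‖b‖ * (2 / 5 * ‖η‖) ≤ 2 * (2 / 5 * (2 * (19 / 125))) := by gcongr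
  have h5 := (η.norm_coe_le_norm 3).trans hη1
  have h6 := norm_res_apply_two_le hb hz η
  have h7 : ‖b‖ * ‖res b z η 3‖ ≤ y * (21 / 1000) := by
    rw [nb]
    have : 0 ≤ y := hx.trans hxy
    gcongr
    linarith
  have h8 : ‖res b z η 2‖ ≤ 3 / 1000 * (y + x) := by linarith
  rw [e, norm_mul, nba]
  calc (y - x) * ‖res b z η 2‖ ≤ (y - x) * (3 / 1000 * (y + x)) := by
        gcongr
    _ = _ := by ring

/-- The explicit term grows by `2 (y² - x²)`, while the resolvent term changes by at most `9 (19 /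
125 + 12 / 1000) (y² - x²)`, a factor below `3 / 2`. -/
lemma realCharFun_lt (hx : 0 ≤ x) (hxy : x < y) (hy : y ≤ 2) {l : ℝ}
    (hl : l ∈ Set.Icc (-3 : ℝ) 9) : realCharFun x l < realCharFun y l := by
  have hn := norm_ofReal_lt hl
  rw [realCharFun_eq, realCharFun_eq]
  have h1 := (Complex.abs_re_le_norm _).trans
    (norm_green_le (norm_I_mul_le (hx.trans hxy.le) hy) hn)
  have h2 := (Complex.abs_re_le_norm _).trans (norm_green_I_sub_le hx hxy.le hy hn)
  rw [Complex.sub_re] at h2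
  set g := (green (Complex.I * x) l).re
  set h := (green (Complex.I * y) l).re
  have hd : 0 < y ^ 2 - x ^ 2 := by nlinarith
  have hx4 : x ^ 2 ≤ 4 := by nlinarith
  have h3 : |(y ^ 2 - x ^ 2) * h + x ^ 2 * (h - g)| ≤
      (y ^ 2 - x ^ 2) * (19 / 125) + 4 * (3 / 1000 * (y ^ 2 - x ^ 2)) := by
    refine (abs_add_le _ _).trans ?_
    rw [abs_mul, abs_mul, abs_of_pos hd, abs_of_nonneg (sq_nonneg x)]
    gcongr
  have h4 : |l| ≤ 9 := by rwa [Complex.norm_real, Real.norm_eq_abs] at hn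
  have h5 : |l * ((y ^ 2 - x ^ 2) * h + x ^ 2 * (h - g))| ≤
      9 * ((y ^ 2 - x ^ 2) * (19 / 125) + 4 * (3 / 1000 * (y ^ 2 - x ^ 2))) := by
    rw [abs_mul]; gcongr
  have h6 := (abs_le.1 h5).2
  have h7 : l * ((y ^ 2 - x ^ 2) * h + x ^ 2 * (h - g)) = l * y ^ 2 * h - l * x ^ 2 * g := by ring
  rw [h7] at h6
  linarith

lemma abs_mul_green_le (hx : 0 ≤ x) (hx2 : x ≤ 2) {l : ℝ} (hl : l ∈ Set.Icc (-3 : ℝ) 9) :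
    |l * x ^ 2 * (green (Complex.I * x) l).re| ≤ |l| * (4 * (19 / 125)) := by
  have h1 := (Complex.abs_re_le_norm _).trans
    (norm_green_le (norm_I_mul_le hx hx2) (norm_ofReal_lt hl))
  have hx4 : x ^ 2 ≤ 4 := by nlinarith
  rw [mul_assoc, abs_mul, abs_mul, abs_of_nonneg (sq_nonneg x)]
  gcongr

lemma realCharFun_neg_three_pos (hx : 0 ≤ x) (hx2 : x ≤ 2) : 0 < realCharFun x (-3) := by
  have h := (abs_le.1 (abs_mul_green_le hx hx2 (l := -3) (by norm_num))).2
  rw [show |(-3 : ℝ)| = 3 by norm_num] at h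
  rw [realCharFun_eq]
  nlinarith

lemma realCharFun_nine_pos (hx : 0 ≤ x) (hx2 : x ≤ 2) : 0 < realCharFun x 9 := by
  have h := (abs_le.1 (abs_mul_green_le hx hx2 (l := 9) (by norm_num))).2
  rw [show |(9 : ℝ)| = 9 by norm_num] at h
  rw [realCharFun_eq]
  nlinarith

lemma realCharFun_two_pos {l : ℝ} (hl : l ∈ Set.Icc (-3 : ℝ) 9) : 0 < realCharFun 2 l := by
  have h := (abs_le.1 (abs_mul_green_le (x := 2) (by norm_num) le_rfl hl)).2
  rw [realCharFun_eq]
  rcases abs_cases l with ⟨h1, -⟩ | ⟨h1, -⟩ <;> rw [h1] at h <;> nlinarith [sq_nonneg (l - 3)]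

lemma realCharFun_one_two_neg : realCharFun 1 2 < 0 := by
  have h := (abs_le.1 (abs_mul_green_le (x := 1) (l := 2) (by norm_num) (by norm_num)
    (by norm_num))).1
  rw [show |(2 : ℝ)| = 2 by norm_num] at h
  rw [realCharFun_eq]
  linarith

lemma continuousOn_realCharFun : ContinuousOn (fun q : ℝ × ℝ => realCharFun q.1 q.2)
    (Set.Icc 0 2 ×ˢ Set.Icc (-3) 9) := by
  rintro ⟨x, l⟩ ⟨hx, hl⟩
  refine ContinuousAt.continuousWithinAt ?_
  have h1 : ContinuousAt (fun q : ℝ × ℝ => (Complex.I * (q.1 : ℂ), (q.2 : ℂ))) (x, l) := by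
    fun_prop
  have h0 : ContinuousAt (fun q : ℂ × ℂ => res q.1 q.2) (Complex.I * (x : ℂ), (l : ℂ)) :=
    continuousAt_res (norm_I_mul_le hx.1 hx.2) ((norm_ofReal_lt hl).trans_lt (by norm_num))
  have h2 : ContinuousAt (fun q : ℝ × ℝ => res (Complex.I * (q.1 : ℂ)) (q.2 : ℂ)) (x, l) :=
    ContinuousAt.comp (g := fun q : ℂ × ℂ => res q.1 q.2)
      (f := fun q : ℝ × ℝ => (Complex.I * (q.1 : ℂ), (q.2 : ℂ))) (x := (x, l)) h0 h1
  have h3 : ContinuousAt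
      (fun q : ℝ × ℝ => res (Complex.I * (q.1 : ℂ)) (q.2 : ℂ) delta2) (x, l) :=
    h2.clm_apply continuousAt_const
  have h4 : ContinuousAt (fun q : ℝ × ℝ => green (Complex.I * (q.1 : ℂ)) (q.2 : ℂ)) (x, l) :=
    (BoundedContinuousFunction.evalCLM ℂ (2 : ℤ) : Seq →L[ℂ] ℂ).continuous.continuousAt.comp h3
  simp only [realCharFun_eq]
  have h5 := Complex.continuous_re.continuousAt.comp h4
  simp only [Function.comp_def] at h5
  fun_prop

lemma continuousOn_realCharFun_right (hx : 0 ≤ x) (hx2 : x ≤ 2) :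
    ContinuousOn (realCharFun x) (Set.Icc (-3) 9) :=
  continuousOn_realCharFun.comp (f := fun l => (x, l)) (by fun_prop) fun _ hl => ⟨⟨hx, hx2⟩, hl⟩

/-- If the zeros are real at `y`, then at each `x < y` there are two distinct real zeros. -/
lemma exists_two_zeros (hx : 0 ≤ x) (hxy : x < y) (hy : y ≤ 2) {l : ℝ}
    (hl : l ∈ Set.Icc (-3 : ℝ) 9) (h0 : realCharFun y l = 0) :
    ∃ l₁ ∈ Set.Icc (-3 : ℝ) 9, ∃ l₂ ∈ Set.Icc (-3 : ℝ) 9, l₁ < l₂ ∧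
      realCharFun x l₁ = 0 ∧ realCharFun x l₂ = 0 := by
  have hx2 : x ≤ 2 := hxy.le.trans hy
  -- Monotonicity pushes the zero below the axis; the values at `-3` and `9` are positive, so there
  -- is a zero on each side of `l`.
  have hneg : realCharFun x l < 0 := h0 ▸ realCharFun_lt hx hxy hy hl
  have hc := continuousOn_realCharFun_right hx hx2
  obtain ⟨l₁, hl₁, e₁⟩ := intermediate_value_Icc' hl.1 (hc.mono (Set.Icc_subset_Icc le_rfl hl.2))
    ⟨hneg.le, (realCharFun_neg_three_pos hx hx2).le⟩
  obtain ⟨l₂, hl₂, e₂⟩ := intermediate_value_Icc hl.2 (hc.mono (Set.Icc_subset_Icc hl.1 le_rfl))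
    ⟨hneg.le, (realCharFun_nine_pos hx hx2).le⟩
  refine ⟨l₁, ⟨hl₁.1, hl₁.2.trans hl.2⟩, l₂, ⟨hl.1.trans hl₂.1, hl₂.2⟩, ?_, e₁, e₂⟩
  have n1 : l₁ ≠ l := by rintro rfl; linarith
  exact (hl₁.2.lt_of_ne n1).trans_le hl₂.1

/-- For some parameter the function `charFun` has a real zero of order at least two. -/
lemma exists_double_zero : ∃ x : ℝ, 0 < x ∧ x < 2 ∧ ∃ l : ℝ, l ∈ Set.Icc (-3 : ℝ) 9 ∧
    charFun (Complex.I * x) l = 0 ∧ HasDerivAt (charFun (Complex.I * x)) 0 (l : ℂ) := by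
  set K : Set (ℝ × ℝ) := Set.Icc 0 2 ×ˢ Set.Icc (-3) 9 with hK
  have hKc : IsCompact K := isCompact_Icc.prod isCompact_Icc
  -- A point of `C` with the largest parameter is the moment at which the graph last touches the
  -- axis.
  set C : Set (ℝ × ℝ) := K ∩ (fun q : ℝ × ℝ => realCharFun q.1 q.2) ⁻¹' Set.Iic 0 with hC
  have hCc : IsCompact C :=
    hKc.of_isClosed_subset (continuousOn_realCharFun.preimage_isClosed_of_isClosed
      hKc.isClosed isClosed_Iic) Set.inter_subset_left
  have hmem : ((1, 2) : ℝ × ℝ) ∈ C :=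
    ⟨⟨by norm_num, by norm_num⟩, realCharFun_one_two_neg.le⟩
  obtain ⟨⟨x, l⟩, ⟨⟨hx, hl⟩, hle⟩, hmax⟩ := hCc.exists_isMaxOn ⟨_, hmem⟩ continuous_fst.continuousOn
  have hle' : realCharFun x l ≤ 0 := hle
  have hx1 : 1 ≤ x := hmax hmem
  have hx0 : 0 ≤ x := hx.1
  have hx2 : x < 2 := by
    refine hx.2.lt_of_ne ?_
    rintro rfl
    exact absurd hle' (realCharFun_two_pos hl).not_ge
  -- A negative value at `x` would have to cross zero at a later parameter, since all values at
  -- parameter `2` are positive; this contradicts maximality.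
  have hnonneg : ∀ l' ∈ Set.Icc (-3 : ℝ) 9, 0 ≤ realCharFun x l' := by
    intro l' hl'
    by_contra! hlt
    have hc : ContinuousOn (fun x => realCharFun x l') (Set.Icc 0 2) :=
      continuousOn_realCharFun.comp (f := fun x => (x, l')) (by fun_prop) fun _ hx => ⟨hx, hl'⟩
    obtain ⟨x', hx', e⟩ := intermediate_value_Icc hx2.le
      (hc.mono (Set.Icc_subset_Icc hx0 le_rfl)) ⟨hlt.le, (realCharFun_two_pos hl').le⟩
    have : x' ≤ x := hmax (show ((x', l') : ℝ × ℝ) ∈ C from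
      ⟨⟨⟨hx0.trans hx'.1, hx'.2⟩, hl'⟩, (show realCharFun x' l' = 0 from e).le⟩)
    have hxx : x' = x := le_antisymm this hx'.1
    rw [hxx] at e
    exact hlt.ne e
  have h0 : realCharFun x l = 0 := le_antisymm hle' (hnonneg l hl)
  have hl3 : l ≠ -3 := by
    rintro rfl; exact (realCharFun_neg_three_pos hx0 hx.2).ne' h0
  have hl9 : l ≠ 9 := by
    rintro rfl; exact (realCharFun_nine_pos hx0 hx.2).ne' h0
  have hnhds : Set.Icc (-3 : ℝ) 9 ∈ nhds l :=
    Icc_mem_nhds (hl.1.lt_of_ne' hl3) (hl.2.lt_of_ne hl9)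
  refine ⟨x, by linarith, hx2, l, hl, ?_, ?_⟩
  · rw [charFun_ofReal hx0 hx.2 ((norm_ofReal_lt hl).trans_lt (by norm_num)), h0,
      Complex.ofReal_zero]
  have hd := hasDerivAt_charFun (norm_I_mul_le hx0 hx.2)
    ((norm_ofReal_lt hl).trans_lt (by norm_num : (9 : ℝ) < 10))
  have hmin : IsLocalMin (realCharFun x) l := by
    filter_upwards [hnhds] with l' hl'
    rw [h0]; exact hnonneg l' hl'
  have hre := hmin.hasDerivAt_eq_zero hd.real_of_complex
  -- The minimum controls only the real part of the derivative; the imaginary part vanishes because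
  -- `charFun` is real along the axis.
  have him : (charFun₂ (Complex.I * x) l l).im = 0 := by
    have h1 : HasDerivAt (fun t : ℝ => (charFun (Complex.I * x) t).im)
        (charFun₂ (Complex.I * x) l l).im l :=
      (Complex.imCLM.hasFDerivAt.comp_hasDerivAt l hd.comp_ofReal)
    have h2 : HasDerivAt (fun t : ℝ => (charFun (Complex.I * x) t).im) 0 l := by
      refine (hasDerivAt_const l (0 : ℝ)).congr_of_eventuallyEq ?_
      filter_upwards [hnhds] with t ht
      rw [charFun_ofReal hx0 hx.2 ((norm_ofReal_lt ht).trans_lt (by norm_num)), Complex.ofReal_im]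
    exact h1.unique h2
  have hz : charFun₂ (Complex.I * x) l l = 0 := Complex.ext hre him
  rwa [hz] at hd

end Real

end Mathieu

/-! ### The resolvent as a sum over walks, and the scalar equation -/

namespace Mathieu

/-- The weight of a level in the expansion of the resolvent over walks. -/
noncomputable def weight (z : ℂ) (p : ℤ) : ℂ := if 2 ≤ p then 1 / (z - 4 * (p : ℂ) ^ 2) else 0

lemma weight_of_lt (z : ℂ) {p : ℤ} (hp : p < 2) : weight z p = 0 := if_neg (by omega)

lemma weight_of_le (z : ℂ) {p : ℤ} (hp : 2 ≤ p) : weight z p = 1 / (z - 4 * (p : ℂ) ^ 2) := if_pos hp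

/-- One step of the fixed point iteration for the resolvent. -/
noncomputable def stepFun (a z : ℂ) (f : ℤ → ℂ) (p : ℤ) : ℂ :=
  a * weight z p * (f (p - 1) + f (p + 1))

lemma level_sub_ge {z : ℂ} (hz : ‖z‖ < 10) (p : ℤ) :
    4 * (p : ℝ) ^ 2 - 10 ≤ ‖z - 4 * (p : ℂ) ^ 2‖ := by
  rw [norm_sub_rev]
  linarith [norm_level_sub_ge (z := z) p]

lemma stepFun_of_lt (a z : ℂ) (f : ℤ → ℂ) {p : ℤ} (hp : p < 2) : stepFun a z f p = 0 := by
  rw [stepFun, weight_of_lt z hp]; ring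

/-- At level `2` only the upper neighbour survives, giving `2 * (1 / 6)`; from level `3` on both
count, but `4 / 26` is smaller still. -/
lemma norm_stepFun_le {a z : ℂ} (ha : ‖a‖ ≤ 2) (hz : ‖z‖ < 10) {f : ℤ → ℂ} {B : ℝ}
    (h0 : ∀ p < 2, f p = 0) (hB : ∀ p, ‖f p‖ ≤ B) (p : ℤ) : ‖stepFun a z f p‖ ≤ B / 3 := by
  have hB0 : 0 ≤ B := (norm_nonneg _).trans (hB 0)
  rcases lt_trichotomy p 2 with hp | rfl | hp
  · rw [stepFun_of_lt a z f hp, norm_zero]; positivity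
  · have hw : ‖weight z 2‖ ≤ 1 / 6 := by
      rw [weight_of_le z le_rfl, norm_div, norm_one]
      refine one_div_le_one_div_of_le (by norm_num) ?_
      have := level_sub_ge hz 2
      norm_num at this ⊢
      linarith
    rw [stepFun, h0 (2 - 1) (by norm_num), zero_add, norm_mul, norm_mul]
    calc _ ≤ 2 * (1 / 6) * B := by gcongr; exact hB _
      _ = B / 3 := by ring
  · have hw : ‖weight z p‖ ≤ 1 / 26 := by
      rw [weight_of_le z hp.le, norm_div, norm_one]
      refine one_div_le_one_div_of_le (by norm_num) ?_
      linarith [level_sub_ge hz p, four_sq_ge' (show 3 ≤ p by omega)]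
    rw [stepFun, norm_mul, norm_mul]
    calc _ ≤ 2 * (1 / 26) * (B + B) := by
          gcongr; exact (norm_add_le _ _).trans (add_le_add (hB _) (hB _))
      _ ≤ B / 3 := by linarith

/-- The terms of the Neumann series of the resolvent. -/
noncomputable def neumannTerm (a z : ℂ) : ℕ → ℤ → ℂ
  | 0 => fun p => if p = 2 then -weight z 2 else 0
  | k + 1 => stepFun a z (neumannTerm a z k)

lemma neumannTerm_of_lt (a z : ℂ) (k : ℕ) {p : ℤ} (hp : p < 2) : neumannTerm a z k p = 0 := by
  cases k with
  | zero => exact if_neg (by omega)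
  | succ k => exact stepFun_of_lt a z _ hp

lemma norm_neumannTerm_le {a z : ℂ} (ha : ‖a‖ ≤ 2) (hz : ‖z‖ < 10) (k : ℕ) (p : ℤ) :
    ‖neumannTerm a z k p‖ ≤ ‖weight z 2‖ * (1 / 3) ^ k := by
  induction k generalizing p with
  | zero =>
    simp only [neumannTerm]
    split_ifs <;> simp
  | succ k ih =>
    refine (norm_stepFun_le ha hz (fun p hp => neumannTerm_of_lt a z k hp) ih p).trans_eq ?_
    rw [pow_succ]; ring

lemma res_eq_neumann {a z : ℂ} (ha : ‖a‖ ≤ 2) (hz : ‖z‖ < 10) (p : ℤ) :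
    res a z delta2 p = neumannTerm a z 0 p + stepFun a z (res a z delta2) p := by
  have ht := isTail_res ha hz delta2
  rcases lt_or_ge p 2 with hp | hp
  · rw [ht.1 p hp, neumannTerm_of_lt a z 0 hp, stepFun_of_lt a z _ hp, zero_add]
  · have e := ht.2 p hp
    have hne : z - 4 * (p : ℂ) ^ 2 ≠ 0 := by
      rw [← norm_pos_iff]
      linarith [level_sub_ge hz p, four_sq_ge hp]
    have h0 : neumannTerm a z 0 p = -weight z p * delta2 p := by
      rw [delta2_apply]
      change (if p = 2 then -weight z 2 else 0) = _
      split_ifs with h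
      · rw [h, mul_one]
      · rw [mul_zero]
    rw [h0, stepFun, weight_of_le z hp, ← e]
    field_simp
    ring

lemma norm_res_sub_sum_le {a z : ℂ} (ha : ‖a‖ ≤ 2) (hz : ‖z‖ < 10) (N : ℕ) :
    (∀ p < 2, res a z delta2 p - ∑ k ∈ Finset.range N, neumannTerm a z k p = 0) ∧
    ∀ p, ‖res a z delta2 p - ∑ k ∈ Finset.range N, neumannTerm a z k p‖ ≤
      ‖res a z delta2‖ * (1 / 3) ^ N := by
  have h1 : ∀ N : ℕ, ∀ p < 2, res a z delta2 p - ∑ k ∈ Finset.range N, neumannTerm a z k p = 0 := by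
    intro N p hp
    rw [(isTail_res ha hz delta2).1 p hp, Finset.sum_eq_zero, sub_zero]
    exact fun k _ => neumannTerm_of_lt a z k hp
  refine ⟨h1 N, ?_⟩
  induction N with
  | zero => intro p; simpa using (res a z delta2).norm_coe_le_norm p
  | succ N ih =>
    intro p
    have e : res a z delta2 p - ∑ k ∈ Finset.range (N + 1), neumannTerm a z k p =
        stepFun a z (fun p => res a z delta2 p - ∑ k ∈ Finset.range N, neumannTerm a z k p) p := by
      rw [Finset.sum_range_succ', res_eq_neumann ha hz p]
      simp only [neumannTerm, stepFun]
      rw [← Finset.mul_sum, Finset.sum_add_distrib]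
      ring
    rw [e]
    refine (norm_stepFun_le ha hz (h1 N) ih p).trans_eq ?_
    rw [pow_succ]; ring

lemma hasSum_neumannTerm {a z : ℂ} (ha : ‖a‖ ≤ 2) (hz : ‖z‖ < 10) :
    HasSum (fun k => neumannTerm a z k 2) (green a z) := by
  have hs : Summable (fun k => neumannTerm a z k 2) :=
    Summable.of_norm_bounded ((summable_geometric_of_lt_one (by norm_num) (by norm_num)).mul_left _)
      fun k => norm_neumannTerm_le ha hz k 2
  rw [hs.hasSum_iff_tendsto_nat, tendsto_iff_norm_sub_tendsto_zero]
  refine squeeze_zero (fun _ => norm_nonneg _) (fun N => ?_)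
    (g := fun N => ‖res a z delta2‖ * (1 / 3) ^ N) ?_
  · rw [norm_sub_rev]
    exact (norm_res_sub_sum_le ha hz N).2 2
  · rw [← mul_zero ‖res a z delta2‖]
    exact (tendsto_pow_atTop_nhds_zero_of_lt_one (by norm_num) (by norm_num)).const_mul _

/-- The iteration starts at level `2` and each step changes the level by one. Thus only even terms
contribute to the entry at level `2`. -/
lemma neumannTerm_of_odd (a z : ℂ) (k : ℕ) {p : ℤ} (h : Odd (k + p)) : neumannTerm a z k p = 0 := by
  induction k generalizing p with
  | zero =>
    refine if_neg ?_
    rintro rfl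
    revert h; decide
  | succ k ih =>
    have h1 : Odd ((k : ℤ) + (p + 1)) := by convert h using 1; push_cast; ring
    have h2 : Odd ((k : ℤ) + (p - 1)) := by
      have : (k : ℤ) + (p - 1) = k + (p + 1) - 2 := by ring
      rw [this]; exact h1.sub_even (by decide)
    change stepFun a z (neumannTerm a z k) p = 0
    rw [stepFun, ih h1, ih h2]; ring

lemma hasSum_neumannTerm_even {a z : ℂ} (ha : ‖a‖ ≤ 2) (hz : ‖z‖ < 10) :
    HasSum (fun k => neumannTerm a z (2 * k) 2) (green a z) := by
  have hinj : Function.Injective (fun k : ℕ => 2 * k) := fun i j h => by simpa using h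
  refine (hinj.hasSum_iff ?_).2 (hasSum_neumannTerm ha hz)
  intro k hk
  refine neumannTerm_of_odd a z k ?_
  have : Odd k := by
    rw [← Nat.not_even_iff_odd]
    rintro ⟨j, hj⟩
    exact hk ⟨j, show 2 * j = k by omega⟩
  have : Odd (k : ℤ) := by exact_mod_cast this
  exact this.add_even even_two

/-- The level reached from `p` after `s` steps. -/
def walkPos {m : ℕ} (p : ℤ) (n : Fin m → ℤ) (s : ℕ) : ℤ := p + ∑ i : Fin m with i.val < s, n i

lemma walkPos_zero {m : ℕ} (p : ℤ) (n : Fin m → ℤ) : walkPos p n 0 = p := by simp [walkPos]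

lemma walkPos_cons {m : ℕ} (p e : ℤ) (n : Fin m → ℤ) (s : ℕ) :
    walkPos p (Fin.cons e n : Fin (m + 1) → ℤ) (s + 1) = walkPos (p + e) n s := by
  simp only [walkPos, Finset.sum_filter, Fin.sum_univ_succ, Fin.cons_zero, Fin.cons_succ,
    Fin.val_zero, Fin.val_succ, Nat.succ_lt_succ_iff]
  simp [add_assoc]

lemma walkPos_succ {m : ℕ} (p : ℤ) (n : Fin m → ℤ) {s : ℕ} (hs : s < m) :
    walkPos p n (s + 1) = walkPos p n s + n ⟨s, hs⟩ := by
  have : ∀ i : Fin m, (if i.val < s + 1 then n i else 0) =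
      (if i.val < s then n i else 0) + (if i = ⟨s, hs⟩ then n i else 0) := by
    intro i
    simp only [Fin.ext_iff]
    split_ifs <;> omega
  simp only [walkPos, Finset.sum_filter, this, Finset.sum_add_distrib, Finset.sum_ite_eq',
    Finset.mem_univ, if_true]
  ring

/-- All sign sequences of length `m`. -/
def signSeqs (m : ℕ) : Finset (Fin m → ℤ) :=
  Fintype.piFinset (fun _ : Fin m => ({-1, 1} : Finset ℤ))

/-- The total weight of the walks of length `m` from `p` to `1`. -/
noncomputable def walkSum (z : ℂ) (m : ℕ) (p : ℤ) : ℂ :=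
  ∑ n ∈ signSeqs m, if walkPos p n m = 1 then ∏ s ∈ Finset.range m, weight z (walkPos p n s) else 0

lemma walkSum_zero (z : ℂ) (p : ℤ) : walkSum z 0 p = if p = 1 then 1 else 0 := by
  simp [walkSum, signSeqs, walkPos]

lemma walkSum_succ (z : ℂ) (m : ℕ) (p : ℤ) :
    walkSum z (m + 1) p = weight z p * (walkSum z m (p - 1) + walkSum z m (p + 1)) := by
  have h : walkSum z (m + 1) p = ∑ q ∈ ({-1, 1} : Finset ℤ) ×ˢ signSeqs m,
      weight z p * (if walkPos (p + q.1) q.2 m = 1 then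
        ∏ s ∈ Finset.range m, weight z (walkPos (p + q.1) q.2 s) else 0) := by
    symm
    refine Finset.sum_nbij' (fun q => (Fin.cons q.1 q.2 : Fin (m + 1) → ℤ))
      (fun n => (n 0, Fin.tail n)) ?_ ?_ ?_ ?_ ?_
    · rintro ⟨e, n⟩ h
      rw [Finset.mem_product] at h
      rw [signSeqs, Fintype.mem_piFinset]
      intro i
      refine Fin.cases ?_ (fun i => ?_) i
      · exact h.1
      · exact (Fintype.mem_piFinset.1 h.2) i
    · intro n h
      rw [signSeqs, Fintype.mem_piFinset] at h
      rw [Finset.mem_product, signSeqs, Fintype.mem_piFinset]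
      exact ⟨h 0, fun i => h i.succ⟩
    · rintro ⟨e, n⟩ -
      simp
    · intro n _
      simp
    · rintro ⟨e, n⟩ -
      simp only [walkPos_cons, Finset.prod_range_succ', walkPos_zero]
      split_ifs
      · ring
      · ring
  rw [h, Finset.sum_product, Finset.sum_pair (by norm_num), ← Finset.mul_sum, ← Finset.mul_sum,
    ← mul_add]
  rfl

/-- Both sides obey the same recursion. Ending at `1` instead of `2` adds a final step that supplies
the weight of level `2`; since weights vanish below `2`, only walks meeting level `1` for the first
time at their end count. -/
lemma neumannTerm_eq_walkSum (a z : ℂ) (k : ℕ) (p : ℤ) :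
    neumannTerm a z k p = -(a ^ k * walkSum z (k + 1) p) := by
  induction k generalizing p with
  | zero =>
    rw [walkSum_succ, walkSum_zero, walkSum_zero]
    change (if p = 2 then -weight z 2 else 0) = _
    by_cases hp : p < 2
    · rw [weight_of_lt z hp, if_neg (by omega)]; simp
    · by_cases h2 : p = 2
      · subst h2; simp
      · rw [if_neg h2, if_neg (by omega), if_neg (by omega)]; simp
  | succ k ih =>
    change stepFun a z (neumannTerm a z k) p = _
    rw [stepFun, ih, ih, walkSum_succ z (k + 1) p]
    ring

lemma walkPos_emod_two {m : ℕ} (p : ℤ) {n : Fin m → ℤ} (hn : n ∈ signSeqs m) {s : ℕ} (hs : s ≤ m) :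
    walkPos p n s % 2 = (p + s) % 2 := by
  induction s with
  | zero => rw [walkPos_zero]; simp
  | succ s ih =>
    have h1 := ih (by omega)
    rw [walkPos_succ p n (show s < m by omega)]
    have := Fintype.mem_piFinset.1 hn ⟨s, by omega⟩
    simp only [Finset.mem_insert, Finset.mem_singleton] at this
    push_cast
    omega

/-- Positions after an even number of steps are odd, so exceeding `1` means being at least `3`; one
further step then stays at or above `2`. This is why the constraint on even times suffices. -/
lemma two_le_walkPos {k : ℕ} {n : Fin (2 * k) → ℤ} (hn : n ∈ signSeqs (2 * k))
    (h : ∀ s ∈ Finset.Ico 1 k, 1 < position n (2 * s)) {s : ℕ} (hs : s < 2 * k) :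
    2 ≤ walkPos 3 n s := by
  have heven : ∀ j < k, 3 ≤ walkPos 3 n (2 * j) := by
    intro j hj
    rcases Nat.eq_zero_or_pos j with rfl | hj0
    · rw [Nat.mul_zero, walkPos_zero]
    · have h1 : 1 < walkPos 3 n (2 * j) := h j (Finset.mem_Ico.2 ⟨hj0, hj⟩)
      have h2 := walkPos_emod_two 3 hn (show 2 * j ≤ 2 * k by omega)
      push_cast at h2
      omega
  rcases Nat.even_or_odd' s with ⟨j, rfl | rfl⟩
  · linarith [heven j (by omega)]
  · rw [walkPos_succ 3 n (show 2 * j < 2 * k by omega)]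
    have := Fintype.mem_piFinset.1 hn ⟨2 * j, by omega⟩
    simp only [Finset.mem_insert, Finset.mem_singleton] at this
    have := heven j (by omega)
    omega

/-- The constraints on the sign sequences are encoded in the vanishing of the weights. The factor `z
- 36` is the weight of the starting level `3`, which `walkSum` includes; `z - 16` is supplied
separately. -/
lemma A_eq_walkSum (a z : ℂ) {k : ℕ} (hk : 1 ≤ k) :
    A k a z = a ^ (2 * k + 2) * weight z 2 * walkSum z (2 * k) 3 := by
  have hw2 : weight z 2 = 1 / (z - 16) := by rw [weight_of_le z le_rfl]; norm_num
  have hw3 : weight z 3 = 1 / (z - 36) := by rw [weight_of_le z (by norm_num)]; norm_num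
  unfold A signs walkSum
  rw [Finset.sum_filter, Finset.mul_sum]
  refine Finset.sum_congr rfl fun n hn => ?_
  change n ∈ signSeqs (2 * k) at hn
  have hpos : ∀ s, position n s = walkPos 3 n s := fun _ => rfl
  simp only [hpos]
  by_cases h1 : walkPos 3 n (2 * k) = 1
  swap
  · rw [if_neg (fun h => h1 h.1), if_neg h1, mul_zero]
  rw [if_pos h1]
  by_cases h2 : ∀ s ∈ Finset.Ico 1 k, 1 < walkPos 3 n (2 * s)
  · rw [if_pos ⟨h1, h2⟩, Finset.prod_range_eq_mul_Ico _ (by omega), walkPos_zero, hw2, hw3]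
    have : ∏ s ∈ Finset.Ico 1 (2 * k), weight z (walkPos 3 n s) =
        (∏ s ∈ Finset.Ico 1 (2 * k), (z - ((2 * walkPos 3 n s : ℤ) : ℂ) ^ 2))⁻¹ := by
      rw [← Finset.prod_inv_distrib]
      refine Finset.prod_congr rfl fun s hs => ?_
      rw [weight_of_le z (two_le_walkPos hn h2 (Finset.mem_Ico.1 hs).2), one_div]
      congr 2
      push_cast; ring
    rw [this, div_eq_mul_inv, mul_inv, mul_inv]
    ring
  · rw [if_neg (fun h => h2 h.2)]
    -- A walk violating the constraint visits a level below `2`, so its product has a zero factor.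
    push Not at h2
    obtain ⟨s, hs, hle⟩ := h2
    have hs' := Finset.mem_Ico.1 hs
    rw [Finset.prod_eq_zero (i := 2 * s) (Finset.mem_range.2 (by omega))
      (weight_of_lt z (by omega)), mul_zero]

/-- A walk of length `2 k + 1` from `2` must step up first: after a step down to `1` the next weight
is zero. -/
lemma A_eq_neumannTerm (a z : ℂ) {k : ℕ} (hk : 1 ≤ k) :
    A k a z = -(a ^ 2 * neumannTerm a z (2 * k) 2) := by
  have h1 : walkSum z (2 * k) 1 = 0 := by
    obtain ⟨j, hj⟩ : ∃ j, 2 * k = j + 1 := ⟨2 * k - 1, by omega⟩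
    rw [hj, walkSum_succ, weight_of_lt z (by norm_num), zero_mul]
  rw [A_eq_walkSum a z hk, neumannTerm_eq_walkSum, walkSum_succ, show (2 : ℤ) - 1 = 1 by norm_num,
    h1, show (2 : ℤ) + 1 = 3 by norm_num]
  ring

lemma hasSum_A {a z : ℂ} (ha : ‖a‖ ≤ 2) (hz : ‖z‖ < 10) :
    HasSum (fun k : ℕ => z * A (k + 1) a z) (-(z * a ^ 2 * green a z) - a ^ 2 * z / (z - 16)) := by
  -- The zeroth term `-weight z 2` is split off; it accounts for the separate term `a² z / (z -
  -- 16)`.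
  have h1 := (hasSum_nat_add_iff' 1).2 (hasSum_neumannTerm_even ha hz)
  have h2 := h1.mul_left (-(z * a ^ 2))
  have e1 : (fun k : ℕ => z * A (k + 1) a z) =
      fun k => -(z * a ^ 2) * neumannTerm a z (2 * (k + 1)) 2 := by
    funext k
    rw [A_eq_neumannTerm a z (by omega)]
    ring
  have e2 : -(z * a ^ 2 * green a z) - a ^ 2 * z / (z - 16) =
      -(z * a ^ 2) * (green a z - ∑ i ∈ Finset.range 1, neumannTerm a z (2 * i) 2) := by
    rw [Finset.sum_range_one]
    change _ = -(z * a ^ 2) * (green a z - -weight z 2)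
    rw [weight_of_le z le_rfl]
    norm_num
    ring
  rw [e1, e2]
  exact h2

lemma scalarFun_eq_charFun {a z : ℂ} (ha : ‖a‖ ≤ 2) (hz : ‖z‖ < 10) :
    scalarFun a z = charFun a z := by
  unfold scalarFun charFun
  rw [(hasSum_A ha hz).tsum_eq]
  ring

end Mathieu

/-! ### Fourier coefficients and classical solutions -/

namespace Mathieu

/-- The `π`-periodic exponential `e^{2inx}`. -/
noncomputable def expo (n : ℤ) (x : ℝ) : ℂ := Complex.exp (2 * Complex.I * n * x)

lemma hasDerivAt_expo (n : ℤ) (x : ℝ) :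
    HasDerivAt (expo n) (2 * Complex.I * n * expo n x) x := by
  have h1 : HasDerivAt (fun x : ℝ => 2 * Complex.I * n * (x : ℂ)) (2 * Complex.I * n) x := by
    simpa using (Complex.ofRealCLM.hasDerivAt (x := x)).const_mul (2 * Complex.I * n)
  exact h1.cexp.congr_deriv (mul_comm _ _)

lemma continuous_expo (n : ℤ) : Continuous (expo n) := by unfold expo; fun_prop

lemma norm_expo (n : ℤ) (x : ℝ) : ‖expo n x‖ = 1 := by
  have : 2 * Complex.I * n * (x : ℂ) = ((2 * n * x : ℝ) : ℂ) * Complex.I := by push_cast; ring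
  rw [expo, this, Complex.norm_exp_ofReal_mul_I]

lemma expo_add (m n : ℤ) (x : ℝ) : expo (m + n) x = expo m x * expo n x := by
  rw [expo, expo, expo, ← Complex.exp_add]; congr 1; push_cast; ring

lemma expo_zero (n : ℤ) : expo n 0 = 1 := by simp [expo]

lemma expo_pi (n : ℤ) : expo n Real.pi = 1 := by
  rw [expo, Complex.exp_eq_one_iff]
  exact ⟨n, by ring⟩

lemma expo_pi_sub (n : ℤ) (x : ℝ) : expo n (Real.pi - x) = expo (-n) x := by
  have h : 2 * Complex.I * n * ((Real.pi - x : ℝ) : ℂ) =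
      2 * Complex.I * n * (Real.pi : ℂ) + 2 * Complex.I * ((-n : ℤ) : ℂ) * x := by push_cast; ring
  have h2 := expo_pi n
  unfold expo at *
  rw [h, Complex.exp_add, h2, one_mul]

lemma potential_eq (a : ℂ) (x : ℝ) : potential a x = a * (expo 1 x + expo (-1) x) := by
  unfold potential expo
  rw [Complex.ofReal_cos, Complex.cos]
  push_cast
  ring_nf

lemma potential_mul_expo (a : ℂ) (n : ℤ) (x : ℝ) :
    potential a x * expo n x = a * (expo (n - 1) x + expo (n + 1) x) := by
  rw [potential_eq, sub_eq_add_neg, expo_add n (-1), expo_add n 1]; ring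

lemma continuous_potential (a : ℂ) : Continuous (potential a) := by unfold potential; fun_prop

/-- The Fourier coefficients of a function on `[0, π]`. -/
noncomputable def coef (f : ℝ → ℂ) (n : ℤ) : ℂ := fourierCoeffOn Real.pi_pos f n

lemma coef_eq (f : ℝ → ℂ) (n : ℤ) :
    coef f n = (1 / Real.pi : ℝ) • ∫ x in (0 : ℝ)..Real.pi, expo (-n) x * f x := by
  unfold coef
  rw [fourierCoeffOn_eq_integral, sub_zero]
  congr 2
  funext x
  rw [fourier_coe_apply, smul_eq_mul, expo]
  congr 2
  have : (Real.pi : ℂ) ≠ 0 := by exact_mod_cast Real.pi_ne_zero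
  push_cast
  field_simp

lemma Ioc_subset_Icc_pi : Set.Ioc (0 : ℝ) Real.pi ⊆ Set.Icc 0 Real.pi := Set.Ioc_subset_Icc_self

lemma coef_congr {f g : ℝ → ℂ} (h : f =ᵐ[volume.restrict (Set.Icc (0 : ℝ) Real.pi)] g) :
    coef f = coef g :=
  fourierCoeffOn_congr_ae Real.pi_pos (ae_restrict_of_ae_restrict_of_subset Ioc_subset_Icc_pi h)

lemma intervalIntegrable_of_memLp {f : ℝ → ℂ}
    (hf : MemLp f 2 (volume.restrict (Set.Icc (0 : ℝ) Real.pi))) :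
    IntervalIntegrable f volume 0 Real.pi := by
  rw [intervalIntegrable_iff_integrableOn_Icc_of_le Real.pi_pos.le]
  exact hf.integrable (by norm_num)

lemma intervalIntegrable_expo_mul {f : ℝ → ℂ} (hf : IntervalIntegrable f volume 0 Real.pi) (n : ℤ) :
    IntervalIntegrable (fun x => expo n x * f x) volume 0 Real.pi :=
  hf.continuousOn_mul (continuous_expo n).continuousOn

lemma coef_add {f g : ℝ → ℂ} (hf : IntervalIntegrable f volume 0 Real.pi)
    (hg : IntervalIntegrable g volume 0 Real.pi) (n : ℤ) :
    coef (f + g) n = coef f n + coef g n := by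
  rw [coef_eq, coef_eq, coef_eq, ← smul_add, ← intervalIntegral.integral_add
    (intervalIntegrable_expo_mul hf _) (intervalIntegrable_expo_mul hg _)]
  congr 2
  funext x
  simp [mul_add]

lemma coef_smul (c : ℂ) (f : ℝ → ℂ) (n : ℤ) : coef (c • f) n = c * coef f n := by
  rw [coef_eq, coef_eq, mul_smul_comm, ← intervalIntegral.integral_const_mul]
  congr 2
  funext x
  simp only [Pi.smul_apply, smul_eq_mul]
  ring

/-- The Fourier coefficients of an element of `L₂[0, π]`, as a linear map. -/
noncomputable def coefL : L2 →ₗ[ℂ] (ℤ → ℂ) where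
  toFun f := coef f
  map_add' f g := by
    funext n
    rw [coef_congr (Lp.coeFn_add f g), coef_add (intervalIntegrable_of_memLp (Lp.memLp f))
      (intervalIntegrable_of_memLp (Lp.memLp g))]
    rfl
  map_smul' c f := by
    funext n
    rw [coef_congr (Lp.coeFn_smul c f), coef_smul]
    rfl

lemma coefL_apply (f : L2) : coefL f = coef f := rfl

lemma hasSum_norm_sq_coef {f : ℝ → ℂ}
    (hf : MemLp f 2 (volume.restrict (Set.Icc (0 : ℝ) Real.pi))) :
    HasSum (fun n => ‖coef f n‖ ^ 2) ((Real.pi - 0)⁻¹ • ∫ x in (0 : ℝ)..Real.pi, ‖f x‖ ^ 2) :=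
  hasSum_sq_fourierCoeffOn Real.pi_pos (hf.mono_measure (Measure.restrict_mono_set _ Ioc_subset_Icc_pi))

/-- Parseval makes the integral of `‖f‖²` vanish. -/
lemma ae_eq_zero_of_coef {f : ℝ → ℂ} (hf : MemLp f 2 (volume.restrict (Set.Icc (0 : ℝ) Real.pi)))
    (h : ∀ n, coef f n = 0) : f =ᵐ[volume.restrict (Set.Icc (0 : ℝ) Real.pi)] 0 := by
  have h1 := hasSum_norm_sq_coef hf
  have h2 : HasSum (fun n : ℤ => ‖coef f n‖ ^ 2) 0 := by
    simp only [h, norm_zero]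
    norm_num
  have h3 := h1.unique h2
  rw [smul_eq_mul, sub_zero, mul_eq_zero, inv_eq_zero, or_iff_right Real.pi_ne_zero,
    intervalIntegral.integral_of_le Real.pi_pos.le, ← integral_Icc_eq_integral_Ioc,
    integral_eq_zero_iff_of_nonneg (fun x => by positivity) hf.integrable_norm_pow'] at h3
  filter_upwards [h3] with x hx
  simpa using hx

lemma coefL_injective : Function.Injective coefL := by
  rw [injective_iff_map_eq_zero]
  intro f hf
  exact (Lp.eq_zero_iff_ae_eq_zero).2 (ae_eq_zero_of_coef (Lp.memLp f) fun n => congrFun hf n)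

lemma exists_norm_coefL_le (f : L2) : ∃ C, ∀ n, ‖coefL f n‖ ≤ C := by
  have h := hasSum_norm_sq_coef (Lp.memLp f)
  refine ⟨√((Real.pi - 0)⁻¹ • ∫ x in (0 : ℝ)..Real.pi, ‖f x‖ ^ 2), fun n => Real.le_sqrt_of_sq_le ?_⟩
  exact le_hasSum h n fun _ _ => by positivity

/-- `y` solves `-y'' + q y = h` classically on `[0, π]`, with `y' = y₁`. -/
structure IsClassical (a : ℂ) (y y₁ h : ℝ → ℂ) : Prop where
  deriv : ∀ x ∈ Set.Icc (0 : ℝ) Real.pi, HasDerivWithinAt y (y₁ x) (Set.Icc (0 : ℝ) Real.pi) x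
  deriv₂ : ∀ x ∈ Set.Icc (0 : ℝ) Real.pi,
    HasDerivWithinAt y₁ (potential a x * y x - h x) (Set.Icc (0 : ℝ) Real.pi) x

lemma IsClassical.continuousOn {a : ℂ} {y y₁ h : ℝ → ℂ} (H : IsClassical a y y₁ h) :
    ContinuousOn y (Set.Icc (0 : ℝ) Real.pi) := fun x hx => (H.deriv x hx).continuousWithinAt

lemma IsClassical.continuousOn₁ {a : ℂ} {y y₁ h : ℝ → ℂ} (H : IsClassical a y y₁ h) :
    ContinuousOn y₁ (Set.Icc (0 : ℝ) Real.pi) := fun x hx => (H.deriv₂ x hx).continuousWithinAt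

lemma integral_congr_Icc {f g : ℝ → ℂ} (h : f =ᵐ[volume.restrict (Set.Icc (0 : ℝ) Real.pi)] g)
    {x : ℝ} (hx : x ∈ Set.Icc (0 : ℝ) Real.pi) :
    ∫ t in (0 : ℝ)..x, f t = ∫ t in (0 : ℝ)..x, g t := by
  rw [intervalIntegral.integral_of_le hx.1, intervalIntegral.integral_of_le hx.1]
  have hs : Set.Ioc (0 : ℝ) x ⊆ Set.Icc 0 Real.pi := fun t ht => ⟨ht.1.le, ht.2.trans hx.2⟩
  exact integral_congr_ae (ae_restrict_of_ae_restrict_of_subset hs h)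

lemma Solves.isClassical {a : ℂ} {y y₁ : ℝ → ℂ} {h : L2} (H : Solves a y y₁ h) {g : ℝ → ℂ}
    (hg : (h : ℝ → ℂ) =ᵐ[volume.restrict (Set.Icc (0 : ℝ) Real.pi)] g)
    (hgc : ContinuousOn g (Set.Icc (0 : ℝ) Real.pi)) : IsClassical a y y₁ g := by
  have hy : ContinuousOn y (Set.Icc (0 : ℝ) Real.pi) :=
    fun x hx => (H.1 x hx).continuousWithinAt
  set F : ℝ → ℂ := fun t => potential a t * y t - g t with hF
  have hFc : ContinuousOn F (Set.Icc (0 : ℝ) Real.pi) :=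
    ((continuous_potential a).continuousOn.mul hy).sub hgc
  refine ⟨H.1, fun x hx => ?_⟩
  have he : ∀ x ∈ Set.Icc (0 : ℝ) Real.pi, y₁ x = y₁ 0 + ∫ t in (0 : ℝ)..x, F t := by
    intro x hx
    rw [H.2 x hx]
    congr 1
    refine integral_congr_Icc ?_ hx
    filter_upwards [hg] with t ht
    rw [hF, ht]
  have : Fact (x ∈ Set.Icc (0 : ℝ) Real.pi) := ⟨hx⟩
  have hd : HasDerivWithinAt (fun u => ∫ t in (0 : ℝ)..u, F t) (F x) (Set.Icc (0 : ℝ) Real.pi) x := by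
    refine intervalIntegral.integral_hasDerivWithinAt_right (t := Set.Icc (0 : ℝ) Real.pi) ?_ ?_
      (hFc x hx)
    · rw [intervalIntegrable_iff_integrableOn_Icc_of_le hx.1]
      exact (hFc.integrableOn_compact isCompact_Icc).mono_set (Set.Icc_subset_Icc le_rfl hx.2)
    · exact hFc.stronglyMeasurableAtFilter_nhdsWithin measurableSet_Icc x
  exact (hd.const_add (y₁ 0)).congr he (he x hx)

lemma IsClassical.solves {a : ℂ} {y y₁ g : ℝ → ℂ} (H : IsClassical a y y₁ g) {h : L2}
    (hg : (h : ℝ → ℂ) =ᵐ[volume.restrict (Set.Icc (0 : ℝ) Real.pi)] g)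
    (hgc : ContinuousOn g (Set.Icc (0 : ℝ) Real.pi)) : Solves a y y₁ h := by
  have hFc : ContinuousOn (fun t => potential a t * y t - g t) (Set.Icc (0 : ℝ) Real.pi) :=
    ((continuous_potential a).continuousOn.mul H.continuousOn).sub hgc
  refine ⟨H.deriv, fun x hx => ?_⟩
  have e : ∫ t in (0 : ℝ)..x, (potential a t * y t - h t) = y₁ x - y₁ 0 := by
    rw [integral_congr_Icc (g := fun t => potential a t * y t - g t) ?_ hx]
    · have hsub : Set.Icc 0 x ⊆ Set.Icc (0 : ℝ) Real.pi := Set.Icc_subset_Icc le_rfl hx.2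
      refine intervalIntegral.integral_eq_sub_of_hasDerivAt_of_le hx.1 (H.continuousOn₁.mono hsub)
        (fun t ht => ?_) ?_
      · exact (H.deriv₂ t (hsub ⟨ht.1.le, ht.2.le⟩)).hasDerivAt
          (Icc_mem_nhds ht.1 (ht.2.trans_le hx.2))
      · rw [intervalIntegrable_iff_integrableOn_Icc_of_le hx.1]
        exact (hFc.integrableOn_compact isCompact_Icc).mono_set hsub
    · filter_upwards [hg] with t ht
      rw [ht]
  rw [e]; ring

/-- The Mathieu recursion for the Fourier coefficients of a periodic solution. -/
lemma IsClassical.coef_eq {a : ℂ} {y y₁ h : ℝ → ℂ} (H : IsClassical a y y₁ h)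
    (hh : ContinuousOn h (Set.Icc (0 : ℝ) Real.pi))
    (h0 : y Real.pi = y 0) (h1 : y₁ Real.pi = y₁ 0) (n : ℤ) :
    4 * (n : ℂ) ^ 2 * coef y n + a * (coef y (n - 1) + coef y (n + 1)) = coef h n := by
  -- With `e = expo (-n)`, the function `e y' - e' y` has derivative `e y'' - e'' y`. This performs
  -- both integrations by parts at once, and periodicity cancels the boundary terms.
  set Φ : ℝ → ℂ := fun x => expo (-n) x * y₁ x - 2 * Complex.I * (-n : ℤ) * expo (-n) x * y x with hΦ
  set Φ' : ℝ → ℂ := fun x => (4 * (n : ℂ) ^ 2) * (expo (-n) x * y x) +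
    a * (expo (-(n - 1)) x * y x + expo (-(n + 1)) x * y x) - expo (-n) x * h x with hΦ'
  have ii : ∀ {f : ℝ → ℂ}, ContinuousOn f (Set.Icc (0 : ℝ) Real.pi) → ∀ m : ℤ,
      IntervalIntegrable (fun x => expo m x * f x) volume 0 Real.pi := by
    intro f hf m
    refine ContinuousOn.intervalIntegrable ?_
    rw [Set.uIcc_of_le Real.pi_pos.le]
    exact (continuous_expo m).continuousOn.mul hf
  have hy := H.continuousOn
  have hd : ∀ x ∈ Set.Icc (0 : ℝ) Real.pi, HasDerivWithinAt Φ (Φ' x) (Set.Icc (0 : ℝ) Real.pi) x := by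
    intro x hx
    have e := (hasDerivAt_expo (-n) x).hasDerivWithinAt (s := Set.Icc (0 : ℝ) Real.pi)
    have e2 := e.const_mul (2 * Complex.I * (-n : ℤ))
    refine ((e.mul (H.deriv₂ x hx)).sub (e2.mul (H.deriv x hx))).congr_deriv ?_
    have hp := potential_mul_expo a (-n) x
    rw [hΦ', show -(n - 1) = -n + 1 by ring, show -(n + 1) = -n - 1 by ring]
    push_cast
    linear_combination y x * hp - 4 * (n : ℂ) ^ 2 * expo (-n) x * y x * Complex.I_sq
  have hint : ∫ x in (0 : ℝ)..Real.pi, Φ' x = Φ Real.pi - Φ 0 := by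
    refine intervalIntegral.integral_eq_sub_of_hasDerivAt_of_le Real.pi_pos.le
      (fun x hx => (hd x hx).continuousWithinAt) (fun x hx => ?_) ?_
    · exact (hd x ⟨hx.1.le, hx.2.le⟩).hasDerivAt (Icc_mem_nhds hx.1 hx.2)
    · exact (((ii hy _).const_mul _).add (((ii hy _).add (ii hy _)).const_mul _)).sub (ii hh _)
  have hΦ0 : Φ Real.pi - Φ 0 = 0 := by
    rw [hΦ]
    simp only [expo_pi, expo_zero, h0, h1, sub_self]
  rw [hΦ0, hΦ', intervalIntegral.integral_sub (((ii hy _).const_mul _).add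
    (((ii hy _).add (ii hy _)).const_mul _)) (ii hh _), intervalIntegral.integral_add
    ((ii hy _).const_mul _) (((ii hy _).add (ii hy _)).const_mul _),
    intervalIntegral.integral_const_mul, intervalIntegral.integral_const_mul,
    intervalIntegral.integral_add (ii hy _) (ii hy _)] at hint
  rw [Mathieu.coef_eq, Mathieu.coef_eq, Mathieu.coef_eq, Mathieu.coef_eq]
  simp only [Complex.real_smul]
  linear_combination ((1 / Real.pi : ℝ) : ℂ) * hint

end Mathieu

/-! ### Trigonometric series as elements of the operator graphs -/

namespace Mathieu

/-- The trigonometric series with coefficients `φ`. -/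
noncomputable def trig (φ : ℤ → ℂ) (x : ℝ) : ℂ := ∑' n, φ n * expo n x

section Trig

variable {φ ψ : ℤ → ℂ}

lemma norm_mul_expo (c : ℂ) (n : ℤ) (x : ℝ) : ‖c * expo n x‖ = ‖c‖ := by
  rw [norm_mul, norm_expo, mul_one]

lemma hasSum_trig (hφ : Summable fun n => ‖φ n‖) (x : ℝ) :
    HasSum (fun n => φ n * expo n x) (trig φ x) :=
  (Summable.of_norm (by simpa only [norm_mul_expo] using hφ)).hasSum

lemma continuous_trig (hφ : Summable fun n => ‖φ n‖) : Continuous (trig φ) :=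
  continuous_tsum (fun n => continuous_const.mul (continuous_expo n)) hφ
    fun _ _ => (norm_mul_expo _ _ _).le

lemma trig_pi (φ : ℤ → ℂ) : trig φ Real.pi = trig φ 0 := by simp [trig, expo_pi, expo_zero]

lemma integral_expo (n : ℤ) : ∫ x in (0 : ℝ)..Real.pi, expo n x = if n = 0 then (Real.pi : ℂ) else 0 := by
  split_ifs with hn
  · subst hn; simp [expo]
  · have hc : 2 * Complex.I * (n : ℂ) ≠ 0 :=
      mul_ne_zero (mul_ne_zero two_ne_zero Complex.I_ne_zero) (by exact_mod_cast hn)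
    have h := intervalIntegral.integral_eq_sub_of_hasDerivAt
      (f := fun x => (2 * Complex.I * (n : ℂ))⁻¹ * expo n x) (f' := expo n) (a := 0) (b := Real.pi)
      (fun x _ => ((hasDerivAt_expo n x).const_mul _).congr_deriv (by field_simp))
      ((continuous_expo n).intervalIntegrable _ _)
    rw [h, expo_pi, expo_zero, sub_self]

lemma coef_trig (hφ : Summable fun n => ‖φ n‖) : coef (trig φ) = φ := by
  funext n
  have h : HasSum (fun m => ∫ x in (0 : ℝ)..Real.pi, expo (-n) x * (φ m * expo m x))
      (∫ x in (0 : ℝ)..Real.pi, expo (-n) x * trig φ x) := by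
    refine intervalIntegral.hasSum_integral_of_dominated_convergence (fun m _ => ‖φ m‖) ?_ ?_ ?_ ?_ ?_
    · intro m
      exact ((continuous_expo (-n)).mul
        (continuous_const.mul (continuous_expo m))).aestronglyMeasurable
    · intro m
      refine Filter.Eventually.of_forall fun x _ => ?_
      rw [norm_mul, norm_expo, one_mul, norm_mul_expo]
    · exact Filter.Eventually.of_forall fun x _ => hφ
    · exact intervalIntegrable_const
    · exact Filter.Eventually.of_forall fun x _ => (hasSum_trig hφ x).mul_left _
  have e : ∀ m, ∫ x in (0 : ℝ)..Real.pi, expo (-n) x * (φ m * expo m x) =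
      if m = n then φ n * Real.pi else 0 := by
    intro m
    have : ∀ x, expo (-n) x * (φ m * expo m x) = φ m * expo (m - n) x := by
      intro x; rw [sub_eq_add_neg, expo_add]; ring
    simp only [this, intervalIntegral.integral_const_mul, integral_expo, sub_eq_zero]
    split_ifs with hmn
    · rw [hmn]
    · rw [mul_zero]
  simp only [e] at h
  have h2 := h.unique (hasSum_ite_eq n (φ n * (Real.pi : ℂ)))
  rw [coef_eq, h2, Complex.real_smul]
  have : (Real.pi : ℂ) ≠ 0 := by exact_mod_cast Real.pi_ne_zero
  push_cast
  field_simp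

lemma hasDerivAt_trig (hφ : Summable fun n => ‖φ n‖)
    (hφ' : Summable fun n => ‖2 * Complex.I * n * φ n‖) (x : ℝ) :
    HasDerivAt (trig φ) (trig (fun n => 2 * Complex.I * n * φ n) x) x := by
  have h := hasDerivAt_tsum (𝕜 := ℝ) (F := ℂ) (g := fun n x => φ n * expo n x)
    (g' := fun n x => 2 * Complex.I * n * φ n * expo n x) (y₀ := x) hφ'
    (fun n y => ((hasDerivAt_expo n y).const_mul (φ n)).congr_deriv (by ring))
    (fun n y => (norm_mul_expo _ _ _).le) (hasSum_trig hφ x).summable x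
  exact h

lemma trig_sub (hφ : Summable fun n => ‖φ n‖) (hψ : Summable fun n => ‖ψ n‖) (x : ℝ) :
    trig (fun n => φ n - ψ n) x = trig φ x - trig ψ x := by
  have h := (hasSum_trig hφ x).sub (hasSum_trig hψ x)
  rw [← h.tsum_eq, trig]
  congr 1; funext n; ring

lemma summable_shift (hφ : Summable fun n => ‖φ n‖) (k : ℤ) : Summable fun n => ‖φ (n + k)‖ :=
  (Equiv.addRight k).summable_iff.2 hφ

lemma summable_neighbours (hφ : Summable fun n => ‖φ n‖) (a : ℂ) :
    Summable fun n => ‖a * (φ (n - 1) + φ (n + 1))‖ := by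
  refine Summable.of_nonneg_of_le (fun _ => norm_nonneg _) (fun n => ?_)
    (((summable_shift hφ (-1)).add (summable_shift hφ 1)).mul_left ‖a‖)
  rw [norm_mul, ← sub_eq_add_neg]
  gcongr
  exact norm_add_le _ _

lemma potential_mul_trig (hφ : Summable fun n => ‖φ n‖) (a : ℂ) (x : ℝ) :
    potential a x * trig φ x = trig (fun n => a * (φ (n - 1) + φ (n + 1))) x := by
  have h := hasSum_trig hφ x
  have hs : ∀ k : ℤ, HasSum (fun n => φ (n + k) * expo n x) (expo (-k) x * trig φ x) := by
    intro k
    have h1 := ((Equiv.addRight k).hasSum_iff.2 h).mul_left (expo (-k) x)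
    have e : (fun n => φ (n + k) * expo n x) =
        fun n => expo (-k) x * ((fun n => φ n * expo n x) ∘ Equiv.addRight k) n := by
      funext n
      simp only [Function.comp, Equiv.coe_addRight]
      rw [mul_left_comm, ← expo_add, neg_add_cancel_comm_assoc]
    rw [e]
    exact h1
  have h3 := ((hs (-1)).add (hs 1)).mul_left a
  have e : (fun n => a * (φ (n - 1) + φ (n + 1)) * expo n x) =
      fun n => a * (φ (n + -1) * expo n x + φ (n + 1) * expo n x) := by
    funext n; rw [sub_eq_add_neg]; ring
  have ht : trig (fun n => a * (φ (n - 1) + φ (n + 1))) x =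
      ∑' n, (fun n => a * (φ (n - 1) + φ (n + 1)) * expo n x) n := rfl
  rw [ht, e, h3.tsum_eq, potential_eq, neg_neg]
  ring

/-- The Mathieu operator on Fourier coefficients. -/
def mathieuSeq (a : ℂ) (φ : ℤ → ℂ) (n : ℤ) : ℂ := 4 * (n : ℂ) ^ 2 * φ n + a * (φ (n - 1) + φ (n + 1))

/-- The equation itself expresses `4 n² φ n` through summable sequences; this is the regularity
needed to differentiate the series twice. -/
lemma summable_sq_mul {a : ℂ} (hφ : Summable fun n => ‖φ n‖)
    (hη : Summable fun n => ‖mathieuSeq a φ n‖) : Summable fun n : ℤ => ‖4 * (n : ℂ) ^ 2 * φ n‖ := by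
  refine Summable.of_nonneg_of_le (fun _ => norm_nonneg _) (fun n => ?_)
    (hη.add (summable_neighbours hφ a))
  have : 4 * (n : ℂ) ^ 2 * φ n = mathieuSeq a φ n - a * (φ (n - 1) + φ (n + 1)) := by
    unfold mathieuSeq; ring
  rw [this]
  exact norm_sub_le _ _

lemma isClassical_trig {a : ℂ} (hφ : Summable fun n => ‖φ n‖)
    (hη : Summable fun n => ‖mathieuSeq a φ n‖) :
    IsClassical a (trig φ) (trig fun n => 2 * Complex.I * n * φ n) (trig (mathieuSeq a φ)) := by
  have h2 := summable_sq_mul hφ hη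
  have h1 : Summable fun n : ℤ => ‖2 * Complex.I * n * φ n‖ := by
    refine Summable.of_nonneg_of_le (fun _ => norm_nonneg _) (fun n => ?_) h2
    rw [norm_mul, norm_mul (4 * (n : ℂ) ^ 2), norm_four_sq]
    gcongr
    rw [norm_mul, norm_mul, Complex.norm_I, Complex.norm_intCast, Complex.norm_ofNat, mul_one]
    rcases eq_or_ne n 0 with rfl | hn
    · simp
    · have : (1 : ℝ) ≤ |(n : ℝ)| := by exact_mod_cast Int.one_le_abs hn
      rw [← sq_abs]
      nlinarith
  have h3 : (fun n : ℤ => 2 * Complex.I * n * (2 * Complex.I * n * φ n)) =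
      fun n => a * (φ (n - 1) + φ (n + 1)) - mathieuSeq a φ n := by
    funext n
    unfold mathieuSeq
    linear_combination 4 * (n : ℂ) ^ 2 * φ n * Complex.I_sq
  have h4 : Summable fun n : ℤ => ‖2 * Complex.I * n * (2 * Complex.I * n * φ n)‖ := by
    convert h2 using 2 with n
    have : 2 * Complex.I * n * (2 * Complex.I * n * φ n) = -(4 * (n : ℂ) ^ 2 * φ n) := by
      linear_combination 4 * (n : ℂ) ^ 2 * φ n * Complex.I_sq
    rw [this, norm_neg]
  refine ⟨fun x _ => (hasDerivAt_trig hφ h1 x).hasDerivWithinAt, fun x _ => ?_⟩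
  have h5 := hasDerivAt_trig h1 h4 x
  rw [h3, trig_sub (summable_neighbours hφ a) hη, ← potential_mul_trig hφ] at h5
  exact h5.hasDerivWithinAt

lemma memLp_trig (hφ : Summable fun n => ‖φ n‖) :
    MemLp (trig φ) 2 (volume.restrict (Set.Icc (0 : ℝ) Real.pi)) := by
  refine MemLp.of_bound (continuous_trig hφ).aestronglyMeasurable (∑' n, ‖φ n‖)
    (Filter.Eventually.of_forall fun x => ?_)
  exact tsum_of_norm_bounded hφ.hasSum fun n => (norm_mul_expo _ _ _).le

/-- The element of `L₂[0, π]` with given absolutely summable Fourier coefficients. -/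
noncomputable def toL2 (hφ : Summable fun n => ‖φ n‖) : L2 := (memLp_trig hφ).toLp

lemma toL2_ae (hφ : Summable fun n => ‖φ n‖) :
    (toL2 hφ : ℝ → ℂ) =ᵐ[volume.restrict (Set.Icc (0 : ℝ) Real.pi)] trig φ :=
  MemLp.coeFn_toLp _

lemma coefL_toL2 (hφ : Summable fun n => ‖φ n‖) : coefL (toL2 hφ) = φ := by
  rw [coefL_apply, coef_congr (toL2_ae hφ), coef_trig hφ]

lemma toL2_mem_H0 {a : ℂ} (hφ : Summable fun n => ‖φ n‖)
    (hη : Summable fun n => ‖mathieuSeq a φ n‖) : (toL2 hφ, toL2 hη) ∈ H0 a :=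
  ⟨trig φ, trig fun n => 2 * Complex.I * n * φ n, toL2_ae hφ,
    (isClassical_trig hφ hη).solves (toL2_ae hη) (continuous_trig hη).continuousOn,
    trig_pi _, trig_pi _⟩

/-- At `0` the differentiated series sums an odd sequence, so it vanishes; periodicity carries this
to `π`. -/
lemma toL2_mem_Neu {a : ℂ} (hφ : Summable fun n => ‖φ n‖)
    (hη : Summable fun n => ‖mathieuSeq a φ n‖) (heven : ∀ n, φ (-n) = φ n) :
    (toL2 hφ, toL2 hη) ∈ Neu a := by
  have h0 : trig (fun n => 2 * Complex.I * n * φ n) 0 = 0 := by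
    have h1 : trig (fun n => 2 * Complex.I * n * φ n) 0 =
        -trig (fun n => 2 * Complex.I * n * φ n) 0 := by
      unfold trig
      rw [← tsum_neg, ← (Equiv.neg ℤ).tsum_eq]
      congr 1
      funext n
      simp [expo_zero, heven]
    linear_combination h1 / 2
  exact ⟨trig φ, trig fun n => 2 * Complex.I * n * φ n, toL2_ae hφ,
    (isClassical_trig hφ hη).solves (toL2_ae hη) (continuous_trig hη).continuousOn,
    h0, (trig_pi _).trans h0⟩

end Trig

/-! ### Wronskian, initial value problem and parity -/

section Uniqueness

variable {a z : ℂ} {y y₁ u u₁ : ℝ → ℂ}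

lemma IsClassical.wronskian (H : IsClassical a y y₁ (z • y)) (K : IsClassical a u u₁ (z • u)) :
    y Real.pi * u₁ Real.pi - y₁ Real.pi * u Real.pi = y 0 * u₁ 0 - y₁ 0 * u 0 := by
  have hd : ∀ x ∈ Set.Icc (0 : ℝ) Real.pi,
      HasDerivWithinAt (fun x => y x * u₁ x - y₁ x * u x) 0 (Set.Icc (0 : ℝ) Real.pi) x := by
    intro x hx
    refine (((H.deriv x hx).mul (K.deriv₂ x hx)).sub
      ((H.deriv₂ x hx).mul (K.deriv x hx))).congr_deriv ?_
    simp only [Pi.smul_apply, smul_eq_mul]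
    ring
  have h := intervalIntegral.integral_eq_sub_of_hasDerivAt_of_le (f' := fun _ => (0 : ℂ))
    Real.pi_pos.le (fun x hx => (hd x hx).continuousWithinAt)
    (fun x hx => (hd x ⟨hx.1.le, hx.2.le⟩).hasDerivAt (Icc_mem_nhds hx.1 hx.2))
    intervalIntegrable_const
  simp only [intervalIntegral.integral_zero] at h
  exact (sub_eq_zero.1 h.symm)

lemma norm_potential_le (a : ℂ) (x : ℝ) : ‖potential a x‖ ≤ 2 * ‖a‖ := by
  rw [potential_eq, norm_mul]
  have := norm_add_le (expo 1 x) (expo (-1) x)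
  rw [norm_expo, norm_expo] at this
  nlinarith [norm_nonneg a]

/-- Uniqueness for the first-order system in `(y, y')`, whose Lipschitz constant is bounded through
`‖q‖ ≤ 2 ‖a‖`. -/
lemma IsClassical.eq_zero (H : IsClassical a y y₁ (z • y)) (h0 : y 0 = 0) (h1 : y₁ 0 = 0) :
    ∀ x ∈ Set.Icc (0 : ℝ) Real.pi, y x = 0 := by
  set v : ℝ → ℂ × ℂ → ℂ × ℂ := fun t p => (p.2, (potential a t - z) * p.1) with hv
  set K : NNReal := 1 + (2 * ‖a‖₊ + ‖z‖₊) with hK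
  have hlip : ∀ t ∈ Set.Ico (0 : ℝ) Real.pi, LipschitzOnWith K (v t) Set.univ := by
    intro t _
    refine (LipschitzWith.of_dist_le_mul fun p q => ?_).lipschitzOnWith
    have hq : ‖potential a t - z‖ ≤ 2 * ‖a‖ + ‖z‖ :=
      (norm_sub_le _ _).trans (by gcongr; exact norm_potential_le a t)
    have hKc : (K : ℝ) = 1 + (2 * ‖a‖ + ‖z‖) := by rw [hK]; push_cast; rfl
    rw [hKc, Prod.dist_eq, Prod.dist_eq]
    have ha := norm_nonneg a
    have hz := norm_nonneg z
    have m0 : 0 ≤ max (dist p.1 q.1) (dist p.2 q.2) := le_max_of_le_left dist_nonneg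
    refine max_le ?_ ?_
    · calc dist p.2 q.2 ≤ 1 * max (dist p.1 q.1) (dist p.2 q.2) := by
            rw [one_mul]; exact le_max_right _ _
        _ ≤ _ := by gcongr; linarith
    · calc dist ((potential a t - z) * p.1) ((potential a t - z) * q.1)
          = ‖potential a t - z‖ * dist p.1 q.1 := by
            rw [dist_eq_norm, dist_eq_norm, ← mul_sub, norm_mul]
        _ ≤ (1 + (2 * ‖a‖ + ‖z‖)) * max (dist p.1 q.1) (dist p.2 q.2) := by
            gcongr
            · linarith
            · exact le_max_left _ _
  have hd : ∀ t ∈ Set.Ico (0 : ℝ) Real.pi,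
      HasDerivWithinAt (fun t => (y t, y₁ t)) (v t (y t, y₁ t)) (Set.Ici t) t := by
    intro t ht
    have ht' : t ∈ Set.Icc (0 : ℝ) Real.pi := ⟨ht.1, ht.2.le⟩
    have h := (H.deriv t ht').prodMk (H.deriv₂ t ht')
    have h2 : HasDerivWithinAt (fun t => (y t, y₁ t)) (v t (y t, y₁ t)) (Set.Icc 0 Real.pi) t := by
      refine h.congr_deriv ?_
      simp only [hv, Pi.smul_apply, smul_eq_mul]
      rw [sub_mul]
    exact h2.mono_of_mem_nhdsWithin (Filter.mem_of_superset (Icc_mem_nhdsGE ht.2)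
      (Set.Icc_subset_Icc ht.1 le_rfl))
  have hz : ∀ t ∈ Set.Ico (0 : ℝ) Real.pi,
      HasDerivWithinAt (fun _ : ℝ => ((0 : ℂ), (0 : ℂ))) (v t (0, 0)) (Set.Ici t) t := by
    intro t _
    refine (hasDerivWithinAt_const _ _ _).congr_deriv ?_
    simp only [hv, mul_zero]
    rfl
  have := ODE_solution_unique_of_mem_Icc_right hlip
    (H.continuousOn.prodMk H.continuousOn₁) hd (fun _ _ => Set.mem_univ _)
    continuousOn_const hz (fun _ _ => Set.mem_univ _) (by simp [h0, h1])
  intro x hx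
  exact congrArg Prod.fst (this hx)

lemma coef_reflect (u : ℝ → ℂ) (n : ℤ) : coef (fun x => u (Real.pi - x)) n = coef u (-n) := by
  rw [coef_eq, coef_eq]
  congr 1
  have h := intervalIntegral.integral_comp_sub_left (a := 0) (b := Real.pi)
    (fun x => expo (-(-n)) x * u x) Real.pi
  rw [sub_zero, sub_self] at h
  rw [← h]
  congr 1
  funext x
  rw [expo_pi_sub, neg_neg]

/-- A continuous function with odd Fourier coefficients takes opposite values at the end points. -/
lemma add_eq_zero_of_coef_odd (hu : ContinuousOn u (Set.Icc (0 : ℝ) Real.pi))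
    (h : ∀ n, coef u (-n) = -coef u n) : u 0 + u Real.pi = 0 := by
  have hr : ContinuousOn (fun x => u (Real.pi - x)) (Set.Icc (0 : ℝ) Real.pi) := by
    refine hu.comp (by fun_prop) fun x hx => ?_
    exact ⟨by linarith [hx.2], by linarith [hx.1]⟩
  have hw : ContinuousOn (u + fun x => u (Real.pi - x)) (Set.Icc (0 : ℝ) Real.pi) := hu.add hr
  have hi : ∀ {f : ℝ → ℂ}, ContinuousOn f (Set.Icc (0 : ℝ) Real.pi) →
      IntervalIntegrable f volume 0 Real.pi := fun hf =>
    ContinuousOn.intervalIntegrable (by rwa [Set.uIcc_of_le Real.pi_pos.le])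
  obtain ⟨C, hC⟩ := isCompact_Icc.exists_bound_of_continuousOn hw
  have hmem : MemLp (u + fun x => u (Real.pi - x)) 2 (volume.restrict (Set.Icc (0 : ℝ) Real.pi)) :=
    MemLp.of_bound (hw.aestronglyMeasurable measurableSet_Icc) C
      (ae_restrict_of_forall_mem measurableSet_Icc hC)
  -- The reflection `x ↦ π - x` reverses the sign of the index, so all coefficients of `u` plus its
  -- reflection cancel; continuity then extends the vanishing to the end point `0`.
  have hae := ae_eq_zero_of_coef hmem fun n => by
    rw [coef_add (hi hu) (hi hr), coef_reflect, h, add_neg_cancel]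
  have := Measure.eqOn_Icc_of_ae_eq volume Real.pi_pos.ne hae hw continuousOn_const
    (Set.left_mem_Icc.2 Real.pi_pos.le)
  simpa using this

end Uniqueness

end Mathieu

/-! ### Even solutions and formal Jordan chains -/

namespace Mathieu

/-- The even sequence with values `c₀` at `0`, `c₁` at `±1` and tail `ω`. -/
def evenExt (c₀ c₁ : ℂ) (ω : ℤ → ℂ) (n : ℤ) : ℂ :=
  if n = 0 then c₀ else if |n| = 1 then c₁ else ω |n|

section EvenExt

variable {c₀ c₁ : ℂ} {ω : ℤ → ℂ}

lemma evenExt_zero : evenExt c₀ c₁ ω 0 = c₀ := if_pos rfl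

lemma evenExt_one : evenExt c₀ c₁ ω 1 = c₁ := by simp [evenExt]

lemma evenExt_of_le {n : ℤ} (hn : 2 ≤ n) : evenExt c₀ c₁ ω n = ω n := by
  rw [evenExt, if_neg (by omega), abs_of_nonneg (by omega), if_neg (by omega)]

lemma evenExt_neg (n : ℤ) : evenExt c₀ c₁ ω (-n) = evenExt c₀ c₁ ω n := by
  simp [evenExt]

lemma eq_of_even {φ ψ : ℤ → ℂ} (hφ : ∀ n, φ (-n) = φ n) (hψ : ∀ n, ψ (-n) = ψ n)
    (h : ∀ n, 0 ≤ n → φ n = ψ n) (n : ℤ) : φ n = ψ n := by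
  rcases le_total 0 n with hn | hn
  · exact h n hn
  · rw [← hφ, ← hψ]; exact h (-n) (by omega)

lemma int_cases {P : ℤ → Prop} (h0 : P 0) (h1 : P 1) (h2 : ∀ n, 2 ≤ n → P n) (n : ℤ) (hn : 0 ≤ n) :
    P n := by
  rcases eq_or_ne n 0 with rfl | hn0
  · exact h0
  rcases eq_or_ne n 1 with rfl | hn1
  · exact h1
  exact h2 n (by omega)

lemma mathieuSeq_neg {a : ℂ} {φ : ℤ → ℂ} (hφ : ∀ n, φ (-n) = φ n) (n : ℤ) :
    mathieuSeq a φ (-n) = mathieuSeq a φ n := by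
  unfold mathieuSeq
  rw [hφ, show -n - 1 = -(n + 1) by ring, show -n + 1 = -(n - 1) by ring, hφ, hφ]
  push_cast; ring

/-- Evenness reduces the check to `n ≥ 0`. The tail is zero at level `1`, so the actual value `c₁`
there enters the tail equation as the source `-a c₁` at level `2`. -/
lemma mathieuSeq_evenExt {a z d₀ d₁ : ℂ} {η ξ : ℤ → ℂ} (hω : IsTail a z η ω)
    (h0 : -z * c₀ + 2 * a * c₁ = d₀) (h1 : (4 - z) * c₁ + a * (c₀ + ω 2) = d₁)
    (h2 : ∀ p, 2 ≤ p → η p = ξ p - a * c₁ * delta2 p) (n : ℤ) :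
    mathieuSeq a (evenExt c₀ c₁ ω) n = z * evenExt c₀ c₁ ω n + evenExt d₀ d₁ ξ n := by
  refine eq_of_even (ψ := fun n => z * evenExt c₀ c₁ ω n + evenExt d₀ d₁ ξ n)
    (mathieuSeq_neg evenExt_neg) (fun n => by simp only [evenExt_neg]) (int_cases ?_ ?_ fun n hn => ?_) n
  · have : evenExt c₀ c₁ ω (0 - 1) = c₁ := by rw [zero_sub, evenExt_neg, evenExt_one]
    simp only [mathieuSeq, this, zero_add, evenExt_zero, evenExt_one, ← h0]
    push_cast; ring
  · simp only [mathieuSeq, sub_self, evenExt_zero, evenExt_one, ← h1]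
    rw [show (1 : ℤ) + 1 = 2 by norm_num, evenExt_of_le le_rfl]
    push_cast; ring
  · have e := hω.2 n hn
    rw [h2 n hn, delta2_apply] at e
    unfold mathieuSeq
    rw [evenExt_of_le hn, evenExt_of_le hn, evenExt_of_le (show 2 ≤ n + 1 by omega)]
    rcases eq_or_ne n 2 with rfl | hn2
    · rw [show (2 : ℤ) - 1 = 1 by norm_num, evenExt_one]
      rw [if_pos rfl, hω.1 (2 - 1) (by norm_num)] at e
      linear_combination e
    · rw [evenExt_of_le (show 2 ≤ n - 1 by omega)]
      rw [if_neg hn2] at e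
      linear_combination e

end EvenExt

/-- The delta sequence at `0`. -/
def delta0 (n : ℤ) : ℂ := if n = 0 then 1 else 0

/-- A formal eigenvector, solving the recursion away from level `0`. -/
noncomputable def chain₀ (a z : ℂ) : ℤ → ℂ :=
  evenExt ((z - 4 + a ^ 2 * green a z) / a) 1 ((-a) • res a z delta2)

/-- The derivative of `chain₀` with respect to `z`. -/
noncomputable def chain₁ (a z : ℂ) : ℤ → ℂ :=
  evenExt ((1 + a ^ 2 * green₂ a z z) / a) 0 ((-a) • res a z (res a z delta2))

/-- Half the second derivative of `chain₀` with respect to `z`. -/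
noncomputable def chain₂ (a z : ℂ) : ℤ → ℂ :=
  evenExt (a * green₃ a z z z) 0 ((-a) • res a z (res a z (res a z delta2)))

section Chain

variable {a z : ℂ}

lemma isTail_smul_res (ha : ‖a‖ ≤ 2) (hz : ‖z‖ < 10) (η : Seq) :
    IsTail a z (fun p => -a * η p) ((-a) • res a z η) :=
  (isTail_res ha hz η).smul (-a)

lemma evenExt_sub_delta0 (c₀ c₁ d : ℂ) (ω : ℤ → ℂ) (n : ℤ) :
    evenExt (c₀ - d) c₁ ω n = evenExt c₀ c₁ ω n - d * delta0 n := by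
  unfold evenExt delta0; split_ifs <;> ring

/-- The value at `0` is chosen to satisfy the equation at level `1`; the equation at level `0` is
then the only one that can fail. -/
lemma mathieuSeq_chain₀ (ha : ‖a‖ ≤ 2) (ha0 : a ≠ 0) (hz : ‖z‖ < 10) (n : ℤ) :
    mathieuSeq a (chain₀ a z) n = z * chain₀ a z n - charFun a z / a * delta0 n := by
  unfold chain₀
  rw [mathieuSeq_evenExt (d₀ := 0 - charFun a z / a) (d₁ := 0) (ξ := 0)
    (isTail_smul_res ha hz delta2), evenExt_sub_delta0]
  · simp [evenExt]; ring
  · unfold charFun; field_simp; ring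
  · change (4 - z) * 1 + a * (_ + -a * green a z) = 0
    field_simp; ring
  · intro p _; simp

/-- Formally the `z`-derivative of the relation for `chain₀`, with the derivative of `charFun` as
new defect. -/
lemma mathieuSeq_chain₁ (ha : ‖a‖ ≤ 2) (ha0 : a ≠ 0) (hz : ‖z‖ < 10) (n : ℤ) :
    mathieuSeq a (chain₁ a z) n =
      z * chain₁ a z n + chain₀ a z n - charFun₂ a z z / a * delta0 n := by
  unfold chain₁ chain₀
  rw [mathieuSeq_evenExt (d₀ := (z - 4 + a ^ 2 * green a z) / a - charFun₂ a z z / a) (d₁ := 1)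
    (ξ := (-a) • res a z delta2) (isTail_smul_res ha hz _), evenExt_sub_delta0]
  · ring
  · unfold charFun₂; field_simp; ring
  · change (4 - z) * 0 + a * (_ + -a * green₂ a z z) = 1
    field_simp; ring
  · intro p _
    rw [mul_zero, zero_mul, sub_zero]; rfl

lemma mathieuSeq_chain₂ (ha : ‖a‖ ≤ 2) (ha0 : a ≠ 0) (hz : ‖z‖ < 10) (n : ℤ) :
    mathieuSeq a (chain₂ a z) n =
      z * chain₂ a z n + chain₁ a z n - charFun₃ a z z z / a * delta0 n := by
  unfold chain₂ chain₁
  rw [mathieuSeq_evenExt (d₀ := (1 + a ^ 2 * green₂ a z z) / a - charFun₃ a z z z / a) (d₁ := 0)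
    (ξ := (-a) • res a z (res a z delta2)) (isTail_smul_res ha hz _), evenExt_sub_delta0]
  · ring
  · unfold charFun₃; field_simp; ring
  · change (4 - z) * 0 + a * (_ + -a * green₃ a z z z) = 0
    ring
  · intro p _
    rw [mul_zero, zero_mul, sub_zero]; rfl

/-- By the recursion `4 n² ω n` is bounded, so the entries decay like `1 / n²`. -/
lemma summable_evenExt_res (ha : ‖a‖ ≤ 2) (hz : ‖z‖ < 10) (c₀ c₁ : ℂ) (η : Seq) :
    Summable fun n => ‖evenExt c₀ c₁ ((-a) • res a z η) n‖ := by
  set ω := res a z η with hω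
  have ht : IsTail a z η ω := isTail_res ha hz η
  set B := ‖η‖ + 14 * ‖ω‖ + ‖c₁‖ with hB
  have hB0 : 0 ≤ B := by positivity
  have hb : ∀ n : ℤ, n ≠ 0 → ‖evenExt c₀ c₁ ((-a) • ω) n‖ ≤ B * (1 / (n : ℝ) ^ 2) := by
    have hpos : ∀ n : ℤ, 0 ≤ n → n ≠ 0 →
        ‖evenExt c₀ c₁ ((-a) • ω) n‖ ≤ B * (1 / (n : ℝ) ^ 2) := by
      refine int_cases (fun h => absurd rfl h) (fun _ => ?_) fun n hn _ => ?_
      · rw [evenExt_one]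
        simp only [Int.cast_one, one_pow, div_one, mul_one, hB]
        have := norm_nonneg η
        have := norm_nonneg ω
        linarith
      · rw [evenExt_of_le hn]
        have h1 : 4 * (n : ℂ) ^ 2 * ω n = η n + z * ω n - a * (ω (n - 1) + ω (n + 1)) := by
          linear_combination ht.2 n hn
        have hW : ∀ p, ‖ω p‖ ≤ ‖ω‖ := fun p => ω.norm_coe_le_norm p
        have h2 : 4 * (n : ℝ) ^ 2 * ‖ω n‖ ≤ ‖η‖ + 10 * ‖ω‖ + 2 * (‖ω‖ + ‖ω‖) := by
          rw [← norm_four_sq, ← norm_mul, h1]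
          refine (norm_sub_le _ _).trans (add_le_add ((norm_add_le _ _).trans
            (add_le_add (η.norm_coe_le_norm n) ?_)) ?_)
          · rw [norm_mul]; gcongr; exact hW n
          · rw [norm_mul]; gcongr
            exact (norm_add_le _ _).trans (add_le_add (hW _) (hW _))
        have hn2 : (0 : ℝ) < (n : ℝ) ^ 2 := by linarith [four_sq_ge hn]
        have h3 : ‖((-a) • (ω : ℤ → ℂ)) n‖ ≤ 2 * ‖ω n‖ := by
          rw [Pi.smul_apply, smul_eq_mul, norm_mul, norm_neg]; gcongr
        rw [mul_one_div, le_div_iff₀ hn2]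
        have := norm_nonneg c₁
        have := norm_nonneg (ω n)
        nlinarith [norm_nonneg η, norm_nonneg ω]
    intro n hn
    rcases le_total 0 n with h | h
    · exact hpos n h hn
    · have := hpos (-n) (by omega) (by omega)
      rw [evenExt_neg] at this
      simpa using this
  have hs : Summable fun n : ℤ => B * (1 / (n : ℝ) ^ 2) :=
    (Real.summable_one_div_int_pow.2 (by norm_num)).mul_left B
  have hs2 : Summable fun n : ℤ => B * (1 / (n : ℝ) ^ 2) + if n = 0 then ‖c₀‖ else 0 :=
    hs.add (hasSum_ite_eq 0 ‖c₀‖).summable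
  refine Summable.of_nonneg_of_le (fun _ => norm_nonneg _) (fun n => ?_) hs2
  rcases eq_or_ne n 0 with rfl | hn
  · rw [evenExt_zero]; simp
  · rw [if_neg hn, add_zero]; exact hb n hn

lemma summable_chain₀ (ha : ‖a‖ ≤ 2) (hz : ‖z‖ < 10) : Summable fun n => ‖chain₀ a z n‖ :=
  summable_evenExt_res ha hz _ _ _

lemma summable_chain₁ (ha : ‖a‖ ≤ 2) (hz : ‖z‖ < 10) : Summable fun n => ‖chain₁ a z n‖ :=
  summable_evenExt_res ha hz _ _ _

lemma summable_chain₂ (ha : ‖a‖ ≤ 2) (hz : ‖z‖ < 10) : Summable fun n => ‖chain₂ a z n‖ :=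
  summable_evenExt_res ha hz _ _ _

/-- Above level `1` a bounded solution is determined by its value at `1`. -/
lemma eq_res_of_bounded (ha : ‖a‖ ≤ 2) (hz : ‖z‖ < 10) {φ : ℤ → ℂ} (hb : ∃ C, ∀ n, ‖φ n‖ ≤ C)
    (h : ∀ n, 2 ≤ n → mathieuSeq a φ n = z * φ n) {p : ℤ} (hp : 2 ≤ p) :
    φ p = -a * φ 1 * res a z delta2 p := by
  obtain ⟨C, hC⟩ := hb
  set ω : Seq := Seq.mk (fun p => if 2 ≤ p then φ p else 0) C (by
    intro p
    split_ifs
    · exact hC p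
    · rw [norm_zero]; exact (norm_nonneg _).trans (hC 0)) with hω
  have hωp : ∀ p, ω p = if 2 ≤ p then φ p else 0 := fun p => rfl
  have ht : IsTail a z ((-a * φ 1) • delta2 : Seq) ω := by
    refine ⟨fun p hp => by rw [hωp, if_neg (by omega)], fun p hp => ?_⟩
    have e := h p hp
    unfold mathieuSeq at e
    rw [hωp, hωp, hωp, if_pos hp, if_pos (show 2 ≤ p + 1 by omega)]
    change _ = (-a * φ 1) * delta2 p
    rw [delta2_apply]
    rcases eq_or_ne p 2 with rfl | hp2
    · rw [if_neg (by norm_num), if_pos rfl]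
      rw [show (2 : ℤ) - 1 = 1 by norm_num] at e
      linear_combination e
    · rw [if_pos (show 2 ≤ p - 1 by omega), if_neg hp2]
      linear_combination e
  have h2 := ht.eq_res ha hz
  have h3 : ω p = ((-a * φ 1) • res a z delta2 : Seq) p := by rw [h2, map_smul]
  rw [hωp, if_pos hp] at h3
  exact h3

/-- A bounded even sequence solving the recursion away from `0` is a multiple of `chain₀`. -/
lemma eq_smul_chain₀_of_even (ha : ‖a‖ ≤ 2) (ha0 : a ≠ 0) (hz : ‖z‖ < 10) {φ : ℤ → ℂ} {c : ℂ}
    (hb : ∃ C, ∀ n, ‖φ n‖ ≤ C) (heven : ∀ n, φ (-n) = φ n)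
    (h : ∀ n, mathieuSeq a φ n = z * φ n + c * delta0 n) :
    (∀ n, φ n = φ 1 * chain₀ a z n) ∧ a * c = -(φ 1 * charFun a z) := by
  have htail : ∀ p, 2 ≤ p → φ p = -a * φ 1 * res a z delta2 p := fun p hp =>
    eq_res_of_bounded ha hz hb (fun n hn => by rw [h, delta0, if_neg (by omega)]; ring) hp
  have h0 := h 0
  have h1 := h 1
  simp only [mathieuSeq, delta0, sub_self, zero_sub, zero_add, heven, if_true, one_ne_zero, if_false,
    show (1 : ℤ) + 1 = 2 by norm_num, htail 2 le_rfl, Int.cast_zero, Int.cast_one] at h0 h1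
  change 4 * (1 : ℂ) ^ 2 * φ 1 + a * (φ 0 + -a * φ 1 * green a z) = _ at h1
  have e0 : φ 0 = φ 1 * ((z - 4 + a ^ 2 * green a z) / a) := by
    field_simp; linear_combination h1
  constructor
  · refine eq_of_even heven (fun n => by rw [chain₀, evenExt_neg]) (int_cases ?_ ?_ fun n hn => ?_)
    · rw [chain₀, evenExt_zero, e0]
    · rw [chain₀, evenExt_one, mul_one]
    · rw [chain₀, evenExt_of_le hn, htail n hn, Pi.smul_apply, smul_eq_mul]; ring
  · rw [e0] at h0
    unfold charFun
    field_simp at h0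
    linear_combination -h0

/-- An odd solution has `φ 0 = 0`, so level `1` reads `(z - 4 + a² g) φ 1 = 0`. Multiplied by `z`
and compared with `charFun a z = 0`, this leaves `2 a² φ 1 = 0`. -/
lemma eq_zero_of_odd (ha : ‖a‖ ≤ 2) (ha0 : a ≠ 0) (hz : ‖z‖ < 10) (hF : charFun a z = 0)
    {φ : ℤ → ℂ} (hb : ∃ C, ∀ n, ‖φ n‖ ≤ C) (hodd : ∀ n, φ (-n) = -φ n)
    (h : ∀ n, mathieuSeq a φ n = z * φ n) (n : ℤ) : φ n = 0 := by
  have htail : ∀ p, 2 ≤ p → φ p = -a * φ 1 * res a z delta2 p := fun p hp =>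
    eq_res_of_bounded ha hz hb (fun n _ => h n) hp
  have h00 : φ 0 = 0 := by
    have := hodd 0
    rw [neg_zero] at this
    linear_combination this / 2
  have h1 := h 1
  simp only [mathieuSeq, sub_self, show (1 : ℤ) + 1 = 2 by norm_num, htail 2 le_rfl, h00,
    Int.cast_one] at h1
  change 4 * (1 : ℂ) ^ 2 * φ 1 + a * (0 + -a * φ 1 * green a z) = _ at h1
  have h2 : a ^ 2 * φ 1 = 0 := by
    unfold charFun at hF
    linear_combination -(φ 1) / 2 * hF - z / 2 * h1
  have h11 : φ 1 = 0 := by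
    rcases mul_eq_zero.1 h2 with h | h
    · exact absurd (pow_eq_zero_iff (two_ne_zero)|>.1 h) ha0
    · exact h
  have hnn : ∀ n, 0 ≤ n → φ n = 0 := by
    refine int_cases h00 h11 fun n hn => ?_
    rw [htail n hn, h11]; ring
  rcases le_total 0 n with hn | hn
  · exact hnn n hn
  · rw [← neg_neg n, hodd, hnn (-n) (by omega), neg_zero]

lemma mathieuSeq_reflect (φ : ℤ → ℂ) (n : ℤ) :
    mathieuSeq a (fun n => φ (-n)) n = mathieuSeq a φ (-n) := by
  unfold mathieuSeq
  rw [show -n - 1 = -(n + 1) by ring, show -n + 1 = -(n - 1) by ring]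
  push_cast; ring

lemma mathieuSeq_add (φ ψ : ℤ → ℂ) (n : ℤ) :
    mathieuSeq a (fun n => φ n + ψ n) n = mathieuSeq a φ n + mathieuSeq a ψ n := by
  unfold mathieuSeq; ring

lemma mathieuSeq_sub (φ ψ : ℤ → ℂ) (n : ℤ) :
    mathieuSeq a (fun n => φ n - ψ n) n = mathieuSeq a φ n - mathieuSeq a ψ n := by
  unfold mathieuSeq; ring

lemma mathieuSeq_mul (c : ℂ) (φ : ℤ → ℂ) (n : ℤ) :
    mathieuSeq a (fun n => c * φ n) n = c * mathieuSeq a φ n := by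
  unfold mathieuSeq; ring

lemma delta0_neg (n : ℤ) : delta0 (-n) = delta0 n := by simp [delta0]

/-- At a zero of `charFun`, the bounded solutions are the multiples of `chain₀`, and the equation
with source at `0` is not solvable. -/
lemma eq_smul_chain₀ (ha : ‖a‖ ≤ 2) (ha0 : a ≠ 0) (hz : ‖z‖ < 10) (hF : charFun a z = 0)
    {φ : ℤ → ℂ} {c : ℂ} (hb : ∃ C, ∀ n, ‖φ n‖ ≤ C)
    (h : ∀ n, mathieuSeq a φ n = z * φ n + c * delta0 n) :
    (∀ n, φ n = φ 1 * chain₀ a z n) ∧ c = 0 := by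
  obtain ⟨C, hC⟩ := hb
  -- The source at `0` is even and drops out of the odd part, which therefore vanishes.
  have hodd := eq_zero_of_odd ha ha0 hz hF (φ := fun n => φ n - φ (-n))
    ⟨C + C, fun n => (norm_sub_le _ _).trans (add_le_add (hC _) (hC _))⟩
    (fun n => by simp only [neg_neg]; ring)
    (fun n => by
      rw [mathieuSeq_sub φ (fun n => φ (-n)), mathieuSeq_reflect, h, h, delta0_neg]; ring)
  obtain ⟨h1, h2⟩ := eq_smul_chain₀_of_even ha ha0 hz ⟨C, hC⟩
    (fun n => (sub_eq_zero.1 (hodd n)).symm) h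
  refine ⟨h1, ?_⟩
  rw [hF, mul_zero, neg_zero] at h2
  exact (mul_eq_zero.1 h2).resolve_left ha0

/-- Off the zeros of `charFun`, the bounded solutions are odd. -/
lemma odd_of_charFun_ne_zero (ha : ‖a‖ ≤ 2) (ha0 : a ≠ 0) (hz : ‖z‖ < 10) (hF : charFun a z ≠ 0)
    {φ : ℤ → ℂ} (hb : ∃ C, ∀ n, ‖φ n‖ ≤ C)
    (h : ∀ n, mathieuSeq a φ n = z * φ n) (n : ℤ) : φ (-n) = -φ n := by
  obtain ⟨C, hC⟩ := hb
  obtain ⟨h1, h2⟩ := eq_smul_chain₀_of_even ha ha0 hz (φ := fun n => φ n + φ (-n)) (c := 0)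
    ⟨C + C, fun n => (norm_add_le _ _).trans (add_le_add (hC _) (hC _))⟩
    (fun n => by simp only [neg_neg]; ring)
    (fun n => by
      rw [mathieuSeq_add φ (fun n => φ (-n)), mathieuSeq_reflect, h, h]; ring)
  rw [mul_zero, eq_comm, neg_eq_zero] at h2
  have h3 := (mul_eq_zero.1 h2).resolve_right hF
  have h4 := h1 n
  rw [h3, zero_mul] at h4
  linear_combination h4

end Chain

end Mathieu

/-! ### Eigenvalues and root subspaces -/

namespace Mathieu

lemma mem_kerPow_succ {G : Submodule ℂ (L2 × L2)} {z : ℂ} {n : ℕ} {f : L2} :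
    f ∈ kerPow G z (n + 1) ↔ ∃ h, (f, h) ∈ G ∧ h - z • f ∈ kerPow G z n := by
  rw [kerPow, Submodule.mem_map]
  constructor
  · rintro ⟨⟨f', h⟩, ⟨h1, h2⟩, rfl⟩
    exact ⟨h, h1, h2⟩
  · rintro ⟨h, h1, h2⟩
    exact ⟨(f, h), ⟨h1, h2⟩, rfl⟩

/-- `f` has a representative that is continuous on `[0, π]`. -/
def HasContRep (f : L2) : Prop := ∃ g : ℝ → ℂ, ContinuousOn g (Set.Icc (0 : ℝ) Real.pi) ∧
  (f : ℝ → ℂ) =ᵐ[volume.restrict (Set.Icc (0 : ℝ) Real.pi)] g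

lemma HasContRep.add {f g : L2} (hf : HasContRep f) (hg : HasContRep g) : HasContRep (f + g) := by
  obtain ⟨u, hu, hfu⟩ := hf
  obtain ⟨v, hv, hgv⟩ := hg
  exact ⟨u + v, hu.add hv, (Lp.coeFn_add f g).trans (hfu.add hgv)⟩

lemma HasContRep.smul {f : L2} (c : ℂ) (hf : HasContRep f) : HasContRep (c • f) := by
  obtain ⟨u, hu, hfu⟩ := hf
  exact ⟨c • u, hu.const_smul c, (Lp.coeFn_smul c f).trans (hfu.const_smul c)⟩

lemma hasContRep_of_mem_H0 {a : ℂ} {f h : L2} (hf : (f, h) ∈ H0 a) : HasContRep f := by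
  obtain ⟨y, y₁, hy, H, -⟩ := hf
  exact ⟨y, fun x hx => (H.1 x hx).continuousWithinAt, hy⟩

/-- Elements of the root subspace serve as right-hand sides; a continuous representative makes the
corresponding solution classical, so that the coefficient recursion applies. -/
lemma hasContRep_of_mem_kerPow {a z : ℂ} {n : ℕ} {f : L2} (hf : f ∈ kerPow (H0 a) z n) :
    HasContRep f := by
  cases n with
  | zero =>
    rw [show f = 0 from hf]
    exact ⟨0, continuousOn_const, Lp.coeFn_zero _ _ _⟩
  | succ n =>
    obtain ⟨h, h1, -⟩ := mem_kerPow_succ.1 hf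
    exact hasContRep_of_mem_H0 h1

lemma mathieuSeq_of_mem_H0 {a : ℂ} {f h : L2} (hf : (f, h) ∈ H0 a) (hh : HasContRep h) (n : ℤ) :
    mathieuSeq a (coefL f) n = coefL h n := by
  obtain ⟨y, y₁, hy, H, hB⟩ := hf
  obtain ⟨g, hg, hhg⟩ := hh
  rw [coefL_apply, coefL_apply, coef_congr hy, coef_congr hhg]
  exact (H.isClassical hhg hg).coef_eq hg hB.1 hB.2 n

lemma exists_of_mem_kerPow_succ {a z : ℂ} {n : ℕ} {f : L2} (hf : f ∈ kerPow (H0 a) z (n + 1)) :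
    ∃ g ∈ kerPow (H0 a) z n, ∀ m, mathieuSeq a (coefL f) m = z * coefL f m + coefL g m := by
  obtain ⟨h, h1, h2⟩ := mem_kerPow_succ.1 hf
  refine ⟨h - z • f, h2, fun m => ?_⟩
  have hh : HasContRep h := by
    have := (hasContRep_of_mem_kerPow h2).add ((hasContRep_of_mem_H0 h1).smul z)
    rwa [sub_add_cancel] at this
  rw [mathieuSeq_of_mem_H0 h1 hh, map_sub, map_smul, Pi.sub_apply, Pi.smul_apply, smul_eq_mul]
  ring

/-- A nice solution of the recursion gives an element of the graph. -/
lemma toL2_mem_H0_of_eq {a : ℂ} {φ : ℤ → ℂ} (hφ : Summable fun n => ‖φ n‖) {h : L2}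
    (hs : Summable fun n => ‖coefL h n‖) (e : ∀ n, mathieuSeq a φ n = coefL h n) :
    (toL2 hφ, h) ∈ H0 a := by
  have e' : mathieuSeq a φ = coefL h := funext e
  have hη : Summable fun n => ‖mathieuSeq a φ n‖ := by rwa [e']
  have h2 : h = toL2 hη := coefL_injective (by rw [coefL_toL2, e'])
  rw [h2]
  exact toL2_mem_H0 hφ hη

section Spectrum

variable {a z : ℂ}

lemma summable_smul {φ : ℤ → ℂ} (c : ℂ) (hφ : Summable fun n => ‖φ n‖) :
    Summable fun n => ‖c * φ n‖ := by
  simpa only [norm_mul] using hφ.mul_left ‖c‖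

lemma summable_coefL_smul_toL2 {φ : ℤ → ℂ} (c : ℂ) (hφ : Summable fun n => ‖φ n‖) :
    Summable fun n => ‖coefL (c • toL2 hφ) n‖ := by
  rw [map_smul, coefL_toL2]
  exact summable_smul c hφ

lemma toL2_chain₀_ne_zero (ha : ‖a‖ ≤ 2) (hz : ‖z‖ < 10) : toL2 (summable_chain₀ ha hz) ≠ 0 := by
  intro h
  have h1 := congrArg (fun f => coefL f 1) h
  simp only [coefL_toL2, map_zero, Pi.zero_apply] at h1
  rw [chain₀, evenExt_one] at h1
  exact one_ne_zero h1

lemma toL2_chain₀_mem_H0 (ha : ‖a‖ ≤ 2) (ha0 : a ≠ 0) (hz : ‖z‖ < 10) (hF : charFun a z = 0) :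
    (toL2 (summable_chain₀ ha hz), z • toL2 (summable_chain₀ ha hz)) ∈ H0 a := by
  refine toL2_mem_H0_of_eq _ (summable_coefL_smul_toL2 z _) fun n => ?_
  rw [mathieuSeq_chain₀ ha ha0 hz, hF, map_smul, coefL_toL2, Pi.smul_apply, smul_eq_mul]
  ring

lemma isPN_of_charFun_eq_zero (ha : ‖a‖ ≤ 2) (ha0 : a ≠ 0) (hz : ‖z‖ < 10)
    (hF : charFun a z = 0) : IsPN a z := by
  refine ⟨⟨_, toL2_chain₀_ne_zero ha hz, toL2_chain₀_mem_H0 ha ha0 hz hF⟩,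
    ⟨_, toL2_chain₀_ne_zero ha hz, ?_⟩⟩
  have e : mathieuSeq a (chain₀ a z) = coefL (z • toL2 (summable_chain₀ ha hz)) := by
    funext n
    rw [mathieuSeq_chain₀ ha ha0 hz, hF, map_smul, coefL_toL2, Pi.smul_apply, smul_eq_mul]
    ring
  have hη : Summable fun n => ‖mathieuSeq a (chain₀ a z) n‖ := by
    rw [e]; exact summable_coefL_smul_toL2 z _
  have h2 : z • toL2 (summable_chain₀ ha hz) = toL2 hη := coefL_injective (by rw [coefL_toL2, e])
  rw [h2]
  exact toL2_mem_Neu _ hη fun n => by rw [chain₀, evenExt_neg]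

/-- The classical solution behind an eigenfunction. -/
lemma exists_isClassical {B : Submodule ℂ BV} {f : L2} (h : (f, z • f) ∈ graph B a) :
    ∃ y y₁ : ℝ → ℂ, (f : ℝ → ℂ) =ᵐ[volume.restrict (Set.Icc (0 : ℝ) Real.pi)] y ∧
      IsClassical a y y₁ (z • y) ∧ (y 0, y₁ 0, y Real.pi, y₁ Real.pi) ∈ B := by
  obtain ⟨y, y₁, hy, H, hB⟩ := h
  refine ⟨y, y₁, hy, H.isClassical ((Lp.coeFn_smul z f).trans (hy.const_smul z)) ?_, hB⟩
  have hc : ContinuousOn y (Set.Icc (0 : ℝ) Real.pi) := fun x hx => (H.1 x hx).continuousWithinAt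
  exact hc.const_smul z

/-- A nontrivial solution that is both periodic and Neumann forces a zero of `charFun`. -/
lemma charFun_eq_zero_of_isClassical (ha : ‖a‖ ≤ 2) (ha0 : a ≠ 0) (hz : ‖z‖ < 10)
    {f : L2} (hf : f ≠ 0) {u u₁ : ℝ → ℂ}
    (hu : (f : ℝ → ℂ) =ᵐ[volume.restrict (Set.Icc (0 : ℝ) Real.pi)] u)
    (H : IsClassical a u u₁ (z • u)) (h0 : u Real.pi = u 0) (h1 : u₁ Real.pi = 0)
    (h1' : u₁ 0 = 0) : charFun a z = 0 := by
  by_contra hF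
  have hc := H.continuousOn
  have hrec : ∀ n, mathieuSeq a (coef u) n = z * coef u n := by
    intro n
    rw [← coef_smul]
    exact H.coef_eq (hc.const_smul z) h0 (h1.trans h1'.symm) n
  have hb : ∃ C, ∀ n, ‖coef u n‖ ≤ C := by
    have := exists_norm_coefL_le f
    rwa [coefL_apply, coef_congr hu] at this
  -- Odd coefficients make the end values opposite, periodicity makes them equal, so both are zero;
  -- with zero initial slope the solution is trivial.
  have hodd := odd_of_charFun_ne_zero ha ha0 hz hF hb hrec
  have hsum := add_eq_zero_of_coef_odd hc hodd
  rw [h0] at hsum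
  have hu0 : u 0 = 0 := by linear_combination hsum / 2
  have hzero := H.eq_zero hu0 h1'
  refine hf ((Lp.eq_zero_iff_ae_eq_zero).2 ?_)
  filter_upwards [hu, ae_restrict_mem measurableSet_Icc] with x hx hxI
  rw [hx, hzero x hxI]; rfl

theorem isPN_iff (ha : ‖a‖ ≤ 2) (ha0 : a ≠ 0) (hz : ‖z‖ < 10) : IsPN a z ↔ charFun a z = 0 := by
  refine ⟨?_, isPN_of_charFun_eq_zero ha ha0 hz⟩
  rintro ⟨⟨f, hf0, hf⟩, ⟨g, hg0, hg⟩⟩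
  obtain ⟨y, y₁, hy, H, hyB⟩ := exists_isClassical hf
  obtain ⟨u, u₁, hu, K, huB⟩ := exists_isClassical hg
  have p1 : y Real.pi = y 0 := hyB.1
  have p2 : y₁ Real.pi = y₁ 0 := hyB.2
  have n1 : u₁ 0 = 0 := huB.1
  have n2 : u₁ Real.pi = 0 := huB.2
  have w := H.wronskian K
  rw [n1, n2, p2] at w
  -- The Wronskian of the periodic and the Neumann eigenfunction yields a dichotomy: either the
  -- former is also Neumann or the latter is also periodic.
  have w' : y₁ 0 * (u Real.pi - u 0) = 0 := by linear_combination -w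
  rcases mul_eq_zero.1 w' with h | h
  · exact charFun_eq_zero_of_isClassical ha ha0 hz hf0 hy H p1 (p2.trans h) h
  · exact charFun_eq_zero_of_isClassical ha ha0 hz hg0 hu K (sub_eq_zero.1 h) n2 n1

lemma exists_bound_of_summable {φ : ℤ → ℂ} (hφ : Summable fun n => ‖φ n‖) : ∃ C, ∀ n, ‖φ n‖ ≤ C :=
  ⟨∑' n, ‖φ n‖, fun n => hφ.le_tsum n fun _ _ => norm_nonneg _⟩

lemma exists_bound_sub {φ ψ : ℤ → ℂ} (hφ : ∃ C, ∀ n, ‖φ n‖ ≤ C) (hψ : ∃ C, ∀ n, ‖ψ n‖ ≤ C) :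
    ∃ C, ∀ n, ‖φ n - ψ n‖ ≤ C := by
  obtain ⟨C, hC⟩ := hφ
  obtain ⟨D, hD⟩ := hψ
  exact ⟨C + D, fun n => (norm_sub_le _ _).trans (add_le_add (hC n) (hD n))⟩

lemma kerPow_le_of_step {G : Submodule ℂ (L2 × L2)} {S : Submodule ℂ L2}
    (h : ∀ n, ∀ f ∈ kerPow G z (n + 1), (∀ g ∈ kerPow G z n, g ∈ S) → f ∈ S) (n : ℕ) :
    kerPow G z n ≤ S := by
  induction n with
  | zero => exact bot_le
  | succ n ih => exact fun f hf => h n f hf ih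

/-- At a simple zero of `charFun` the root subspace is spanned by the eigenfunction. -/
lemma iSup_kerPow_of_simple (ha : ‖a‖ ≤ 2) (ha0 : a ≠ 0) (hz : ‖z‖ < 10)
    (hF : charFun a z = 0) (hF' : charFun₂ a z z ≠ 0) :
    ⨆ n, kerPow (H0 a) z n = Submodule.span ℂ {toL2 (summable_chain₀ ha hz)} := by
  apply le_antisymm
  · refine iSup_le (kerPow_le_of_step fun n f hf ih => ?_)
    obtain ⟨g, hg, hrec⟩ := exists_of_mem_kerPow_succ hf
    obtain ⟨c, rfl⟩ := Submodule.mem_span_singleton.1 (ih g hg)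
    simp only [map_smul, coefL_toL2, Pi.smul_apply, smul_eq_mul] at hrec
    -- Subtracting `c * chain₁` removes the source `c * chain₀` and leaves `c` times the defect at
    -- level `0`. That is unsolvable unless `c = 0`, so the chain cannot be prolonged.
    obtain ⟨h1, h2⟩ := eq_smul_chain₀ ha ha0 hz hF
      (φ := fun m => coefL f m - c * chain₁ a z m) (c := c * (charFun₂ a z z / a))
      (exists_bound_sub (exists_norm_coefL_le f)
        (exists_bound_of_summable (summable_smul c (summable_chain₁ ha hz)))) (fun m => by
        rw [mathieuSeq_sub (coefL f) (fun m => c * chain₁ a z m), mathieuSeq_mul, hrec,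
          mathieuSeq_chain₁ ha ha0 hz]
        ring)
    have hc : c = 0 := (mul_eq_zero.1 h2).resolve_right (div_ne_zero hF' ha0)
    refine Submodule.mem_span_singleton.2 ⟨coefL f 1 - c * chain₁ a z 1, coefL_injective ?_⟩
    funext m
    rw [map_smul, coefL_toL2, Pi.smul_apply, smul_eq_mul]
    have := h1 m
    rw [← this, hc]; ring
  · refine le_trans ?_ (le_iSup _ 1)
    rw [Submodule.span_singleton_le_iff_mem, mem_kerPow_succ]
    exact ⟨_, toL2_chain₀_mem_H0 ha ha0 hz hF, by rw [sub_self]; exact Submodule.zero_mem _⟩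

/-- At a double zero of `charFun` the root subspace is spanned by a Jordan chain of length two. -/
lemma iSup_kerPow_of_double (ha : ‖a‖ ≤ 2) (ha0 : a ≠ 0) (hz : ‖z‖ ≤ 9)
    (hF : charFun a z = 0) (hF' : charFun₂ a z z = 0) (hz' : ‖z‖ < 10) :
    ⨆ n, kerPow (H0 a) z n =
      Submodule.span ℂ {toL2 (summable_chain₀ ha hz'), toL2 (summable_chain₁ ha hz')} := by
  set f₀ := toL2 (summable_chain₀ ha hz') with hf₀
  set f₁ := toL2 (summable_chain₁ ha hz') with hf₁
  have h0 : f₀ ∈ kerPow (H0 a) z 1 := by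
    rw [mem_kerPow_succ]
    exact ⟨_, toL2_chain₀_mem_H0 ha ha0 hz' hF, by rw [sub_self]; exact Submodule.zero_mem _⟩
  apply le_antisymm
  · refine iSup_le (kerPow_le_of_step fun n f hf ih => ?_)
    obtain ⟨g, hg, hrec⟩ := exists_of_mem_kerPow_succ hf
    obtain ⟨c, d, rfl⟩ := Submodule.mem_span_pair.1 (ih g hg)
    simp only [map_add, map_smul, hf₀, hf₁, coefL_toL2, Pi.add_apply, Pi.smul_apply,
      smul_eq_mul] at hrec
    -- The defect of `chain₁` is now zero, and the obstruction moves to `chain₂`, whose defect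
    -- `charFun₃ / a` never vanishes: the chain has length exactly two.
    obtain ⟨h1, h2⟩ := eq_smul_chain₀ ha ha0 hz' hF
      (φ := fun m => coefL f m - c * chain₁ a z m - d * chain₂ a z m)
      (c := d * (charFun₃ a z z z / a))
      (exists_bound_sub (exists_bound_sub (exists_norm_coefL_le f)
        (exists_bound_of_summable (summable_smul c (summable_chain₁ ha hz'))))
        (exists_bound_of_summable (summable_smul d (summable_chain₂ ha hz')))) (fun m => by
        rw [mathieuSeq_sub (fun m => coefL f m - c * chain₁ a z m) (fun m => d * chain₂ a z m),
          mathieuSeq_sub (coefL f) (fun m => c * chain₁ a z m), mathieuSeq_mul, mathieuSeq_mul, hrec,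
          mathieuSeq_chain₁ ha ha0 hz', mathieuSeq_chain₂ ha ha0 hz', hF']
        ring)
    have hd : d = 0 := (mul_eq_zero.1 h2).resolve_right
      (div_ne_zero (charFun₃_ne_zero ha hz hz hz) ha0)
    refine Submodule.mem_span_pair.2
      ⟨coefL f 1 - c * chain₁ a z 1 - d * chain₂ a z 1, c, coefL_injective ?_⟩
    funext m
    rw [map_add, map_smul, map_smul, hf₀, hf₁, coefL_toL2, coefL_toL2, Pi.add_apply, Pi.smul_apply,
      Pi.smul_apply, smul_eq_mul, smul_eq_mul]
    have := h1 m
    rw [← this, hd]; ring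
  · rw [Submodule.span_le]
    rintro f (rfl | rfl)
    · exact (le_iSup (kerPow (H0 a) z) 1) h0
    · refine (le_iSup (kerPow (H0 a) z) 2) (mem_kerPow_succ.2 ⟨z • f₁ + f₀, ?_, ?_⟩)
      · refine toL2_mem_H0_of_eq _ ?_ fun n => ?_
        · have hadd := (summable_smul z (summable_chain₁ ha hz')).add (summable_chain₀ ha hz')
          refine Summable.of_nonneg_of_le (fun _ => norm_nonneg _) (fun n => ?_) hadd
          rw [map_add, map_smul, hf₀, hf₁, coefL_toL2, coefL_toL2]
          exact norm_add_le _ _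
        · rw [mathieuSeq_chain₁ ha ha0 hz', hF', map_add, map_smul, hf₀, hf₁, coefL_toL2, coefL_toL2,
            Pi.add_apply, Pi.smul_apply, smul_eq_mul]
          ring
      · rw [add_sub_cancel_left]; exact h0

lemma toENat_rank_span {ι : Type} [Fintype ι] {v : ι → L2} (hv : LinearIndependent ℂ v) :
    Cardinal.toENat (Module.rank ℂ ↥(Submodule.span ℂ (Set.range v))) = (Fintype.card ι : ℕ∞) := by
  rw [rank_span hv, Cardinal.mk_range_eq _ hv.injective, Cardinal.mk_fintype,
    map_natCast]

lemma multiplicity_of_simple (ha : ‖a‖ ≤ 2) (ha0 : a ≠ 0) (hz : ‖z‖ < 10)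
    (hF : charFun a z = 0) (hF' : charFun₂ a z z ≠ 0) : multiplicity (H0 a) z = 1 := by
  rw [multiplicity, iSup_kerPow_of_simple ha ha0 hz hF hF',
    ← Set.range_const (ι := Unit) (c := toL2 (summable_chain₀ ha hz)),
    toENat_rank_span (linearIndependent_unique_iff.2 (toL2_chain₀_ne_zero ha hz))]
  simp

lemma multiplicity_of_double (ha : ‖a‖ ≤ 2) (ha0 : a ≠ 0) (hz : ‖z‖ ≤ 9)
    (hF : charFun a z = 0) (hF' : charFun₂ a z z = 0) : multiplicity (H0 a) z = 2 := by
  have hz' : ‖z‖ < 10 := by linarith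
  have hind : LinearIndependent ℂ
      ![toL2 (summable_chain₀ ha hz'), toL2 (summable_chain₁ ha hz')] := by
    rw [LinearIndependent.pair_iff]
    intro s t hst
    have hc : ∀ n, s * chain₀ a z n + t * chain₁ a z n = 0 := by
      intro n
      have := congrArg (fun f => coefL f n) hst
      simpa only [map_add, map_smul, coefL_toL2, map_zero, Pi.zero_apply, Pi.add_apply,
        Pi.smul_apply, smul_eq_mul] using this
    have hs : s = 0 := by
      have := hc 1
      rw [chain₀, chain₁, evenExt_one, evenExt_one] at this
      linear_combination this
    refine ⟨hs, ?_⟩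
    by_contra ht
    have h1 : ∀ n, chain₁ a z n = 0 := by
      intro n
      have := hc n
      rw [hs, zero_mul, zero_add] at this
      exact (mul_eq_zero.1 this).resolve_left ht
    -- If `chain₁` were zero, its relation at level `1` would read `0 = chain₀ 1 = 1`.
    have h2 := mathieuSeq_chain₁ ha ha0 hz' 1
    rw [hF'] at h2
    simp only [mathieuSeq, h1] at h2
    rw [chain₀, evenExt_one] at h2
    norm_num at h2
  rw [multiplicity, iSup_kerPow_of_double ha ha0 hz hF hF' hz', ← Matrix.range_cons_cons_empty,
    toENat_rank_span hind]
  simp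

end Spectrum

end Mathieu

/-! ### Listings of the eigenvalues and collisions -/

namespace Mathieu

section Pair

variable {x : ℝ}

lemma I_mul_ne_zero (hx : 0 < x) : Complex.I * (x : ℂ) ≠ 0 :=
  mul_ne_zero Complex.I_ne_zero (by exact_mod_cast hx.ne')

lemma norm_lt_nine {z : ℂ} (hz : ‖z - 2‖ < 5) : ‖z‖ < 9 := by
  linarith [norm_le_seven hz.le]

lemma norm_le_nine_of_mem {z : ℂ} (hz : z ∈ Metric.closedBall (3 : ℂ) 6) : ‖z‖ ≤ 9 := by
  have h1 : ‖z - 3‖ ≤ 6 := by simpa [dist_eq_norm] using hz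
  have h2 := norm_add_le (z - 3) 3
  rw [sub_add_cancel] at h2
  have : ‖(3 : ℂ)‖ = 3 := by simp
  linarith

lemma mem_closedBall_of_norm {z : ℂ} (hz : ‖z - 2‖ < 5) : z ∈ Metric.closedBall (3 : ℂ) 6 := by
  have h2 := norm_sub_le (z - 2) 1
  rw [show z - 2 - 1 = z - 3 by ring, norm_one] at h2
  rw [Metric.mem_closedBall, dist_eq_norm]
  linarith

/-- `μ, ν` are the two zeros of `charFun`, with multiplicity. -/
structure IsZeroPair (a μ ν : ℂ) : Prop where
  left : ‖μ - 2‖ < 5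
  right : ‖ν - 2‖ < 5
  factor : ∃ H : ℂ → ℂ, (∀ z, ‖z‖ < 10 → DifferentiableAt ℂ H z) ∧
    ∀ z, ‖z‖ ≤ 9 → H z ≠ 0 ∧ charFun a z = (z - μ) * (z - ν) * H z

variable {a μ ν : ℂ}

lemma IsZeroPair.symm (h : IsZeroPair a μ ν) : IsZeroPair a ν μ := by
  obtain ⟨H, hd, hH⟩ := h.factor
  exact ⟨h.right, h.left, H, hd, fun z hz => ⟨(hH z hz).1, by rw [(hH z hz).2]; ring⟩⟩

lemma IsZeroPair.eq_zero_iff (h : IsZeroPair a μ ν) {z : ℂ} (hz : ‖z‖ ≤ 9) :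
    charFun a z = 0 ↔ z = μ ∨ z = ν := by
  obtain ⟨H, hd, hH⟩ := h.factor
  rw [(hH z hz).2, mul_eq_zero, or_iff_left (hH z hz).1, mul_eq_zero, sub_eq_zero, sub_eq_zero]

lemma eventually_norm_le_nine {z : ℂ} (hz : ‖z‖ < 9) : ∀ᶠ w in nhds z, ‖w‖ ≤ 9 := by
  filter_upwards [Metric.isOpen_ball.mem_nhds (show z ∈ Metric.ball (0 : ℂ) 9 by simpa using hz)]
    with w hw
  simpa using (Metric.mem_ball.1 hw).le

lemma IsZeroPair.charFun₂_eq_zero_iff (h : IsZeroPair a μ ν) (ha : ‖a‖ ≤ 2) {z : ℂ} (hz : ‖z‖ < 9)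
    (h0 : charFun a z = 0) : charFun₂ a z z = 0 ↔ z = μ ∧ z = ν := by
  obtain ⟨H, hd, hH⟩ := h.factor
  have h1 := hasDerivAt_charFun ha (show ‖z‖ < 10 by linarith)
  have h3 := (hd z (show ‖z‖ < 10 by linarith)).hasDerivAt
  have h2 := ((((hasDerivAt_id z).sub_const μ).mul ((hasDerivAt_id z).sub_const ν)).mul
    h3).congr_of_eventuallyEq (f₁ := charFun a)
      ((eventually_norm_le_nine hz).mono fun w hw => (hH w hw).2)
  have h4 : (z - μ) * (z - ν) = 0 := by
    rw [(hH z hz.le).2] at h0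
    exact (mul_eq_zero.1 h0).resolve_right (hH z hz.le).1
  have h5 : charFun₂ a z z = ((z - μ) + (z - ν)) * H z := by
    rw [h1.unique h2]
    simp only [Pi.mul_apply, id]
    rw [h4]
    ring
  rw [h5, mul_eq_zero, or_iff_left (hH z hz.le).1]
  constructor
  · intro h6
    rcases mul_eq_zero.1 h4 with h7 | h7
    · exact ⟨sub_eq_zero.1 h7, by linear_combination h6 - h7⟩
    · exact ⟨by linear_combination h6 - h7, sub_eq_zero.1 h7⟩
  · rintro ⟨h6, h7⟩
    linear_combination h6 + h7

lemma IsZeroPair.analyticOrderAt_eq (h : IsZeroPair a μ ν) (ha : ‖a‖ ≤ 2) {z : ℂ} (hz : ‖z‖ < 9) :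
    analyticOrderAt (charFun a) z = ((({μ, ν} : Multiset ℂ).count z : ℕ) : ℕ∞) := by
  obtain ⟨H, hd, hH⟩ := h.factor
  have hz' : ‖z‖ < 10 := by linarith
  exact analyticOrderAt_of_factorization (analyticAt_charFun ha hz')
    (analyticAt_of_differentiableAt_ball hd hz') (hH z hz.le).1
    ((eventually_norm_le_nine hz).mono fun w hw => (hH w hw).2)

lemma IsZeroPair.isPNPair (h : IsZeroPair a μ ν) (ha : ‖a‖ ≤ 2) (ha0 : a ≠ 0) :
    IsPNPair a μ ν := by
  have hPN : ∀ z ∈ Metric.closedBall (3 : ℂ) 6, IsPN a z ↔ z = μ ∨ z = ν := fun z hz => by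
    have hz9 := norm_le_nine_of_mem hz
    rw [isPN_iff ha ha0 (by linarith), h.eq_zero_iff hz9]
  refine ⟨mem_closedBall_of_norm h.left, mem_closedBall_of_norm h.right, hPN, fun z hz hzPN => ?_⟩
  have hz9 : ‖z‖ < 9 := by
    rcases (hPN z hz).1 hzPN with rfl | rfl
    · exact norm_lt_nine h.left
    · exact norm_lt_nine h.right
  have hz10 : ‖z‖ < 10 := by linarith
  have h0 := (isPN_iff ha ha0 hz10).1 hzPN
  have h2 := h.charFun₂_eq_zero_iff ha hz9 h0
  by_cases e : z = μ ∧ z = ν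
  · rw [multiplicity_of_double ha ha0 hz9.le h0 (h2.2 e), count_pair, if_pos e.1, if_pos e.2]
    rfl
  · rw [multiplicity_of_simple ha ha0 hz10 h0 (mt h2.1 e), count_pair]
    rcases (hPN z hz).1 hzPN with h1 | h1
    · rw [if_pos h1, if_neg fun h => e ⟨h1, h⟩]; rfl
    · rw [if_neg fun h => e ⟨h, h1⟩, if_pos h1]; rfl

/-- The counts are prescribed by the multiplicities, so a listing is determined up to order. -/
lemma IsPNPair.multiset_eq {μ' ν' : ℂ} (h : IsPNPair a μ ν) (h' : IsPNPair a μ' ν') :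
    ({μ, ν} : Multiset ℂ) = {μ', ν'} := by
  obtain ⟨hμ, hν, hPN, hm⟩ := h
  obtain ⟨hμ', hν', hPN', hm'⟩ := h'
  ext z
  by_cases hz : z ∈ Metric.closedBall (3 : ℂ) 6 ∧ IsPN a z
  · exact_mod_cast (hm z hz.1 hz.2).symm.trans (hm' z hz.1 hz.2)
  · have h1 : ∀ w ∈ Metric.closedBall (3 : ℂ) 6, IsPN a w → z ≠ w := by
      rintro w hw hw' rfl
      exact hz ⟨hw, hw'⟩
    rw [count_pair, count_pair, if_neg (h1 _ hμ ((hPN _ hμ).2 (Or.inl rfl))),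
      if_neg (h1 _ hν ((hPN _ hν).2 (Or.inr rfl))),
      if_neg (h1 _ hμ' ((hPN' _ hμ').2 (Or.inl rfl))),
      if_neg (h1 _ hν' ((hPN' _ hν').2 (Or.inr rfl)))]

lemma exists_isZeroPair (hx : 0 ≤ x) (hx2 : x ≤ 2) : ∃ μ ν, IsZeroPair (Complex.I * x) μ ν := by
  obtain ⟨μ, ν, h1, h2, h3⟩ := exists_charFun_factorization hx hx2
  have ha := norm_I_mul_le hx hx2
  exact ⟨μ, ν, h1, h2, fun z => charFun₃ (Complex.I * x) z ν μ,
    fun z hz => differentiableAt_charFun₃ ha hz ν μ,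
    fun z hz => ⟨charFun₃_ne_zero ha hz (norm_lt_nine h2).le (norm_lt_nine h1).le, h3 z hz⟩⟩

/-- Any listing of the `PN(a)` eigenvalues is a listing of the zeros of `charFun`. -/
lemma IsPNPair.isZeroPair (hx : 0 < x) (hx2 : x < 2) (h : IsPNPair (Complex.I * x) μ ν) :
    IsZeroPair (Complex.I * x) μ ν := by
  have ha := norm_I_mul_le hx.le hx2.le
  obtain ⟨μ', ν', h'⟩ := exists_isZeroPair hx.le hx2.le
  have e := h.multiset_eq (h'.isPNPair ha (I_mul_ne_zero hx))
  simp only [Multiset.insert_eq_cons] at e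
  rcases Multiset.cons_eq_cons.1 e with ⟨rfl, e2⟩ | ⟨hne, cs, e1, e2⟩
  · rw [Multiset.singleton_inj.1 e2]; exact h'
  · have hc : cs = 0 := by
      have := congrArg Multiset.card e1
      simpa using this
    rw [hc] at e1 e2
    have e1' : ν = μ' := by simpa using e1
    have e2' : ν' = μ := by simpa using e2
    rw [e1', ← e2']
    exact h'.symm

/-- Either both zeros are real or they are complex conjugates. -/
lemma IsZeroPair.conj_cases (hx : 0 ≤ x) (hx2 : x ≤ 2) (h : IsZeroPair (Complex.I * x) μ ν) :
    (starRingEnd ℂ μ = μ ∧ starRingEnd ℂ ν = ν) ∨ starRingEnd ℂ μ = ν := by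
  have key : ∀ z : ℂ, ‖z‖ < 9 → (z = μ ∨ z = ν) → (starRingEnd ℂ z = μ ∨ starRingEnd ℂ z = ν) := by
    intro z hz h0
    rw [← h.eq_zero_iff hz.le] at h0
    rw [← h.eq_zero_iff (by rw [Complex.norm_conj]; exact hz.le),
      charFun_conj hx hx2 (by linarith), h0, map_zero]
  rcases key μ (norm_lt_nine h.left) (Or.inl rfl) with h1 | h1
  · rcases key ν (norm_lt_nine h.right) (Or.inr rfl) with h2 | h2
    · right
      rw [← h2, Complex.conj_conj]
    · exact Or.inl ⟨h1, h2⟩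
  · exact Or.inr h1

lemma IsZeroPair.sub_real_or_imaginary (hx : 0 ≤ x) (hx2 : x ≤ 2)
    (h : IsZeroPair (Complex.I * x) μ ν) : (μ - ν).im = 0 ∨ (μ - ν).re = 0 := by
  rcases h.conj_cases hx hx2 with ⟨h1, h2⟩ | h1
  · left
    rw [Complex.sub_im, Complex.conj_eq_iff_im.1 h1, Complex.conj_eq_iff_im.1 h2, sub_zero]
  · right
    rw [← h1]; simp

lemma mem_Icc_of_norm {l : ℝ} (hl : ‖(l : ℂ) - 2‖ < 5) : l ∈ Set.Icc (-3 : ℝ) 9 := by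
  rw [show (l : ℂ) - 2 = ((l - 2 : ℝ) : ℂ) by push_cast; rfl, Complex.norm_real, Real.norm_eq_abs,
    abs_lt] at hl
  constructor <;> linarith [hl.1, hl.2]

/-- A collision at a parameter `y` excludes a collision at every smaller parameter. -/
lemma IsZeroPair.not_collision {y : ℝ} {ρ : ℂ} (hx : 0 ≤ x) (hxy : x < y) (hy : y ≤ 2)
    (h : IsZeroPair (Complex.I * y) μ μ) (h' : IsZeroPair (Complex.I * x) ρ ρ) : False := by
  have hy0 : 0 ≤ y := hx.trans hxy.le
  -- For a repeated zero the real and the conjugate alternatives both say that it is real.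
  have hμ : starRingEnd ℂ μ = μ := by
    rcases h.conj_cases hy0 hy with ⟨h1, -⟩ | h1 <;> exact h1
  obtain ⟨l, rfl⟩ := Complex.conj_eq_iff_real.1 hμ
  have hl := mem_Icc_of_norm h.left
  have hr : ∀ l ∈ Set.Icc (-3 : ℝ) 9, ∀ x : ℝ, 0 ≤ x → x ≤ 2 →
      charFun (Complex.I * x) l = realCharFun x l := fun l hl x hx hx2 =>
    charFun_ofReal hx hx2 ((norm_ofReal_lt hl).trans_lt (by norm_num))
  have h0 : realCharFun y l = 0 := by
    have h1 := (h.eq_zero_iff (norm_ofReal_lt hl)).2 (Or.inl rfl)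
    rw [hr l hl y hy0 hy] at h1
    exact_mod_cast h1
  obtain ⟨l₁, hl₁, l₂, hl₂, hlt, e₁, e₂⟩ := exists_two_zeros hx hxy hy hl h0
  have hz : ∀ l ∈ Set.Icc (-3 : ℝ) 9, realCharFun x l = 0 → (l : ℂ) = ρ := fun l hl e => by
    have h1 : charFun (Complex.I * x) l = 0 := by
      rw [hr l hl x hx (hxy.le.trans hy), e, Complex.ofReal_zero]
    rcases (h'.eq_zero_iff (norm_ofReal_lt hl)).1 h1 with h | h <;> exact h
  have := (hz l₁ hl₁ e₁).trans (hz l₂ hl₂ e₂).symm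
  exact hlt.ne (by exact_mod_cast this)

/-- Some parameter has a collision. -/
lemma exists_collision : ∃ x : ℝ, 0 < x ∧ x < 2 ∧
    ∀ μ ν, IsZeroPair (Complex.I * x) μ ν → μ = ν := by
  obtain ⟨x, hx, hx2, l, hl, h0, hd⟩ := exists_double_zero
  refine ⟨x, hx, hx2, fun μ ν h => ?_⟩
  have ha := norm_I_mul_le hx.le hx2.le
  have hl9 : ‖(l : ℂ)‖ < 9 := by
    rcases (h.eq_zero_iff (norm_ofReal_lt hl)).1 h0 with e | e <;> rw [e]
    · exact norm_lt_nine h.left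
    · exact norm_lt_nine h.right
  have h1 := (hasDerivAt_charFun ha (show ‖(l : ℂ)‖ < 10 by linarith)).unique hd
  obtain ⟨e1, e2⟩ := (h.charFun₂_eq_zero_iff ha hl9 h0).1 h1
  exact e1.symm.trans e2

end Pair

lemma scalarFun_eventuallyEq {a z : ℂ} (ha : ‖a‖ ≤ 2) (hz : ‖z‖ < 10) :
    scalarFun a =ᶠ[nhds z] charFun a := by
  filter_upwards [Metric.isOpen_ball.mem_nhds (show z ∈ Metric.ball (0 : ℂ) 10 by simpa using hz)]
    with w hw
  exact scalarFun_eq_charFun ha (by simpa using hw)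

end Mathieu

/-! ### The main theorem -/

theorem theorem10 :
    -- in the disc there are exactly two PN eigenvalues, counted with multiplicity
    (∀ a ∈ Mathieu.I 2, ∃ μ ν : ℂ, Mathieu.IsPNPair a μ ν) ∧
    -- whichever way they are labelled as `lam₀ a` and `lam₂ a`:
    ∀ lam₀ lam₂ : ℂ → ℂ,
      (∀ a ∈ Mathieu.I 2, Mathieu.IsPNPair a (lam₀ a) (lam₂ a)) →
      -- the scalar equation has exactly these two roots in the open disc of radius 9
      (∀ a ∈ Mathieu.I 2,
        (∀ z : ℂ, ‖z‖ ≤ 9 → Summable (fun k : ℕ => z * Mathieu.A (k + 1) a z)) ∧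
        AnalyticOnNhd ℂ (Mathieu.scalarFun a) (Metric.closedBall 0 9) ∧
        lam₀ a ∈ Metric.ball (0 : ℂ) 9 ∧ lam₂ a ∈ Metric.ball (0 : ℂ) 9 ∧
        ∀ z ∈ Metric.ball (0 : ℂ) 9,
          (Mathieu.scalarFun a z = 0 ↔ z = lam₀ a ∨ z = lam₂ a) ∧
          analyticOrderAt (Mathieu.scalarFun a) z =
            ((({lam₀ a, lam₂ a} : Multiset ℂ).count z : ℕ) : ℕ∞)) ∧
      -- their difference is real or purely imaginary
      (∀ a ∈ Mathieu.I 2, (lam₀ a - lam₂ a).im = 0 ∨ (lam₀ a - lam₂ a).re = 0) ∧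
      -- they coincide for exactly one `a`
      ∃! a : ℂ, a ∈ Mathieu.I 2 ∧ lam₀ a = lam₂ a := by
  refine ⟨?_, fun lam₀ lam₂ hpair => ?_⟩
  · rintro a ⟨x, hx, hx2, rfl⟩
    obtain ⟨μ, ν, h⟩ := Mathieu.exists_isZeroPair hx.le hx2.le
    exact ⟨μ, ν, h.isPNPair (Mathieu.norm_I_mul_le hx.le hx2.le) (Mathieu.I_mul_ne_zero hx)⟩
  have hI : ∀ x : ℝ, 0 < x → x < 2 → Complex.I * (x : ℂ) ∈ Mathieu.I 2 :=
    fun x hx hx2 => ⟨x, hx, hx2, rfl⟩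
  have hzero : ∀ x : ℝ, 0 < x → x < 2 →
      Mathieu.IsZeroPair (Complex.I * x) (lam₀ (Complex.I * x)) (lam₂ (Complex.I * x)) :=
    fun x hx hx2 => (hpair _ (hI x hx hx2)).isZeroPair hx hx2
  refine ⟨?_, ?_, ?_⟩
  · rintro a ⟨x, hx, hx2, rfl⟩
    have h := hzero x hx hx2
    have ha := Mathieu.norm_I_mul_le hx.le hx2.le
    refine ⟨fun z hz => (Mathieu.hasSum_A ha (by linarith)).summable, fun z hz => ?_,
      by simpa using Mathieu.norm_lt_nine h.left, by simpa using Mathieu.norm_lt_nine h.right,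
      fun z hz => ?_⟩
    · have hz' : ‖z‖ < 10 := by
        have : ‖z‖ ≤ 9 := by simpa using hz
        linarith
      exact (Mathieu.analyticAt_charFun ha hz').congr (Mathieu.scalarFun_eventuallyEq ha hz').symm
    · have hz9 : ‖z‖ < 9 := by simpa using hz
      have hz' : ‖z‖ < 10 := by linarith
      rw [Mathieu.scalarFun_eq_charFun ha hz',
        analyticOrderAt_congr (Mathieu.scalarFun_eventuallyEq ha hz')]
      exact ⟨h.eq_zero_iff hz9.le, h.analyticOrderAt_eq ha hz9⟩
  · rintro a ⟨x, hx, hx2, rfl⟩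
    exact (hzero x hx hx2).sub_real_or_imaginary hx.le hx2.le
  · obtain ⟨x, hx, hx2, hcol⟩ := Mathieu.exists_collision
    refine ⟨Complex.I * x, ⟨hI x hx hx2, hcol _ _ (hzero x hx hx2)⟩, ?_⟩
    rintro _ ⟨⟨y, hy, hy2, rfl⟩, he⟩
    have h1 := hzero y hy hy2
    have h2 := hzero x hx hx2
    rw [he] at h1
    rw [hcol _ _ h2] at h2
    rcases lt_trichotomy x y with hlt | rfl | hlt
    · exact (h1.not_collision hx.le hlt hy2.le h2).elim
    · rfl
    · exact (h2.not_collision hy.le hlt hx2.le h1).elim
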